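/- Let $v>1$ be a real number and let $S$ be a set of $n\ge 3$ points in the Euclidean plane. A highway is a straight line $h$. The travel time from $p$ to $q$ with respect to $h$ is the infimum, over all rectifiable paths from $p$ to $q$, of the time needed to traverse the path when one moves with speed $v$ on $h$ and with speed $1$ elsewhere. The travel-time diameter of $S$ with respect to $h$ is the maximum travel time over all pairs of points of $S$, and an optimal highway is a line, of arbitrary orientation, that minimizes the travel-time diameter of $S$ among all lines. Let $\alpha=\arccos(1/v)$. For $\phi\in\mathbb{R}$ let $u(\phi)$ be the width (the distance between opposite sides) of a smallest rhombus that contains $S$, whose diagonals point in the directions $\phi$ and $\phi+\pi/2$ and whose diagonal in direction $\phi$ is $\tan\alpha$ times as long as the other one. For $p,q\in S$ let $f_{pq}(\phi)=|p-q|$ if $p \ne q$ and the line $pq$ makes an angle larger than $\alpha$ with the direction $\phi$, and $f_{pq}(\phi)=0$ otherwise. Put $z(\phi)=\max\{u(\phi),\max_{p,q\in S}f_{pq}(\phi)\}$. **Theorem.** (1) For every $\phi$, the smallest travel-time diameter of $S$ with respect to a highway of orientation $\phi$ exists and is equal to $z(\phi)$. (2) An optimal highway of speed $v$ can be computed in $O(n^2\log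 n)$ time, and its orientation is a lowest point of $z$ on $[0,\pi)$. More precisely: there are a program for the real RAM (unit-cost operations $+,-,\cdot,/,\sqrt{\phantom{x}}$ and comparisons on reals; addition, truncated subtraction and comparisons on natural numbers; memory cells addressed by natural numbers) and a constant $C$, both independent of $v$, $n$ and $S$, such that for all $v>1$, all $n\ge 3$ and all sets $S$ of $n$ points, given in arbitrary order by their coordinates, the program with input $n$, $v$, $S$ halts after at most $C\,n^2\log n$ steps with a point and a direction of an optimal highway $h$ for $S$, and $h$ has an orientation $\phi\in[0,\pi)$ at which $z$ attains its minimum over $[0,\pi)$. -/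

import Mathlib

/-! ## Highways, travel times and rhombi in the Euclidean plane -/

namespace Highway

/-- The Euclidean plane. -/
abbrev Plane : Type := EuclideanSpace ℝ (Fin 2)

/-- The unit vector that makes the angle `φ` with the positive `x`-axis. -/
noncomputable def unitDir (φ : ℝ) : Plane := !₂[Real.cos φ, Real.sin φ]

/-- The line through `a` in direction `d` (a line if `d ≠ 0`, the single point `a` otherwise). -/
noncomputable def lineThrough (a d : Plane) : AffineSubspace ℝ Plane :=
  AffineSubspace.mk' a (Submodule.span ℝ {d})

/-- A highway is a straight line in the plane. -/
def IsHighway (h : AffineSubspace ℝ Plane) : Prop := Module.finrank ℝ h.direction = 1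

/-- The highway `h` has orientation `φ`. -/
def HasOrientation (h : AffineSubspace ℝ Plane) (φ : ℝ) : Prop :=
  h.direction = Submodule.span ℝ {unitDir φ}

open Classical in
/-- The time needed to traverse the path `γ : [0,1] → ℝ²`: arc length is traversed with speed `v`
on the highway `h` and with speed `1` elsewhere. -/
noncomputable def pathTime (v : ℝ) (h : AffineSubspace ℝ Plane) (γ : ℝ → Plane) : ℝ :=
  ∫ t in (0 : ℝ)..1, (if γ t ∈ h then v⁻¹ else 1) * ‖deriv γ t‖

/-- The travel time from `p` to `q` in the presence of the speed-`v` highway `h`: the infimum of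
the times of all rectifiable paths from `p` to `q`. Every rectifiable path has a Lipschitz
parametrization on `[0,1]`, which extends to a Lipschitz map on `ℝ`, constant outside `[0,1]`. -/
noncomputable def travelTime (v : ℝ) (h : AffineSubspace ℝ Plane) (p q : Plane) : ℝ :=
  sInf {T : ℝ | ∃ γ : ℝ → Plane, (∃ K : NNReal, LipschitzWith K γ) ∧ γ 0 = p ∧ γ 1 = q ∧
    T = pathTime v h γ}

/-- The travel-time diameter of the points `p 0, …, p (n - 1)`: the maximum travel time over all
pairs of points. -/
noncomputable def travelDiam {n : ℕ} (v : ℝ) (h : AffineSubspace ℝ Plane) (p : Fin n → Plane) : ℝ :=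
  ⨆ ij : Fin n × Fin n, travelTime v h (p ij.1) (p ij.2)

/-- An optimal highway of speed `v` minimizes the travel-time diameter among all lines, of all
orientations. -/
def IsOptimalHighway {n : ℕ} (v : ℝ) (p : Fin n → Plane) (h : AffineSubspace ℝ Plane) : Prop :=
  IsHighway h ∧ ∀ h' : AffineSubspace ℝ Plane, IsHighway h' → travelDiam v h p ≤ travelDiam v h' p

/-- The angle `α` with `cos α = 1 / v`. -/
noncomputable def criticalAngle (v : ℝ) : ℝ := Real.arccos (1 / v)

/-- The rhombus of width `w` with center `c`, whose diagonals point in the directions `φ` and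
`φ + π / 2` and have the ratio `tan α : 1`. In the coordinates `(x, y)` along the diagonals it is
given by `|x| cos α + |y| sin α ≤ w / 2`, and `(± cos α, ± sin α)` are the unit normals of its
sides, so that opposite sides have distance `w`. -/
def rhombus (v φ : ℝ) (c : Plane) (w : ℝ) : Set Plane :=
  {x | |inner ℝ (unitDir φ) (x - c)| * Real.cos (criticalAngle v)
      + |inner ℝ (unitDir (φ + Real.pi / 2)) (x - c)| * Real.sin (criticalAngle v) ≤ w / 2}

/-- `u(φ)`: the width of a smallest such rhombus with orientation `φ` that contains all points. -/
noncomputable def rhombusWidth {n : ℕ} (v : ℝ) (p : Fin n → Plane) (φ : ℝ) : ℝ :=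
  sInf {w : ℝ | ∃ c : Plane, ∀ i, p i ∈ rhombus v φ c w}

open Classical in
/-- `f_{ab}(φ)`: the distance of `a` and `b` if the line through `a` and `b` makes an angle larger
than `α` with the orientation `φ`, and `0` otherwise. -/
noncomputable def pairDist (v : ℝ) (a b : Plane) (φ : ℝ) : ℝ :=
  if criticalAngle v < InnerProductGeometry.angle (a - b) (unitDir φ) ∧
      InnerProductGeometry.angle (a - b) (unitDir φ) < Real.pi - criticalAngle v
  then dist a b else 0

/-- `z(φ)`: the upper envelope of `u` and of all the functions `f_{ab}`. -/
noncomputable def envelope {n : ℕ} (v : ℝ) (p : Fin n → Plane) (φ : ℝ) : ℝ :=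
  max (rhombusWidth v p φ) (⨆ ij : Fin n × Fin n, pairDist v (p ij.1) (p ij.2) φ)

end Highway

/-! ## The real RAM

A structured real RAM with unit costs. The memory consists of arrays of natural numbers (for
indices and counters) and of arrays of real numbers. A program names finitely many arrays; a scalar
variable is an array of which only the cell `0` is used. Natural numbers can be added, subtracted
(with `a - b = 0` for `a < b`) and compared; reals can be added, subtracted, multiplied, divided and
compared, and square roots can be taken. Only natural numbers serve as addresses, and there is no
conversion between the two kinds of numbers. Division by `0` and the square root of a negative number
return `0`. -/

namespace RealRAM

/-- The contents of the memory: cell `i` of the array `A` holds `nat A i`, respectively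
`real A i`. -/
structure State where
  nat : ℕ → ℕ → ℕ
  real : ℕ → ℕ → ℝ

/-- Write the natural number `x` into the cell `i` of the array `A`. -/
def State.setNat (s : State) (A i x : ℕ) : State :=
  { s with nat := fun B j => if B = A ∧ j = i then x else s.nat B j }

/-- Write the real number `x` into the cell `i` of the array `A`. -/
noncomputable def State.setReal (s : State) (A i : ℕ) (x : ℝ) : State :=
  { s with real := fun B j => if B = A ∧ j = i then x else s.real B j }

/-- Expressions for natural numbers; `get A e` reads the cell with index `e` of the array `A`. -/
inductive NExp where
  | lit (k : ℕ)
  | get (A : ℕ) (e : NExp)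
  | add (e₁ e₂ : NExp)
  | sub (e₁ e₂ : NExp)

/-- Expressions for real numbers. -/
inductive RExp where
  | lit (q : ℚ)
  | get (A : ℕ) (e : NExp)
  | add (e₁ e₂ : RExp)
  | sub (e₁ e₂ : RExp)
  | mul (e₁ e₂ : RExp)
  | div (e₁ e₂ : RExp)
  | sqrt (e : RExp)

/-- Tests. -/
inductive Test where
  | natLt (e₁ e₂ : NExp)
  | natEq (e₁ e₂ : NExp)
  | realLt (e₁ e₂ : RExp)
  | realLe (e₁ e₂ : RExp)
  | not (b : Test)
  | and (b₁ b₂ : Test)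

/-- Programs; `setNat A e x` and `setReal A e x` write the value of `x` into the cell with index `e`
of the array `A`. -/
inductive Prog where
  | nop
  | setNat (A : ℕ) (e x : NExp)
  | setReal (A : ℕ) (e : NExp) (x : RExp)
  | seq (P Q : Prog)
  | branch (b : Test) (P Q : Prog)
  | loop (b : Test) (P : Prog)

def NExp.eval (s : State) : NExp → ℕ
  | .lit k => k
  | .get A e => s.nat A (e.eval s)
  | .add e₁ e₂ => e₁.eval s + e₂.eval s
  | .sub e₁ e₂ => e₁.eval s - e₂.eval s

noncomputable def RExp.eval (s : State) : RExp → ℝ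
  | .lit q => (q : ℝ)
  | .get A e => s.real A (e.eval s)
  | .add e₁ e₂ => e₁.eval s + e₂.eval s
  | .sub e₁ e₂ => e₁.eval s - e₂.eval s
  | .mul e₁ e₂ => e₁.eval s * e₂.eval s
  | .div e₁ e₂ => e₁.eval s / e₂.eval s
  | .sqrt e => Real.sqrt (e.eval s)

def Test.Holds (s : State) : Test → Prop
  | .natLt e₁ e₂ => e₁.eval s < e₂.eval s
  | .natEq e₁ e₂ => e₁.eval s = e₂.eval s
  | .realLt e₁ e₂ => e₁.eval s < e₂.eval s
  | .realLe e₁ e₂ => e₁.eval s ≤ e₂.eval s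
  | .not b => ¬ b.Holds s
  | .and b₁ b₂ => b₁.Holds s ∧ b₂.Holds s

/-! Every constant, memory access, arithmetic operation and logical operation costs one step. -/

def NExp.cost : NExp → ℕ
  | .lit _ => 1
  | .get _ e => e.cost + 1
  | .add e₁ e₂ => e₁.cost + e₂.cost + 1
  | .sub e₁ e₂ => e₁.cost + e₂.cost + 1

def RExp.cost : RExp → ℕ
  | .lit _ => 1
  | .get _ e => e.cost + 1
  | .add e₁ e₂ => e₁.cost + e₂.cost + 1
  | .sub e₁ e₂ => e₁.cost + e₂.cost + 1
  | .mul e₁ e₂ => e₁.cost + e₂.cost + 1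
  | .div e₁ e₂ => e₁.cost + e₂.cost + 1
  | .sqrt e => e.cost + 1

def Test.cost : Test → ℕ
  | .natLt e₁ e₂ => e₁.cost + e₂.cost + 1
  | .natEq e₁ e₂ => e₁.cost + e₂.cost + 1
  | .realLt e₁ e₂ => e₁.cost + e₂.cost + 1
  | .realLe e₁ e₂ => e₁.cost + e₂.cost + 1
  | .not b => b.cost + 1
  | .and b₁ b₂ => b₁.cost + b₂.cost + 1

/-- `Exec P s t s'`: the program `P`, started in the state `s`, terminates after `t` steps in the
state `s'`. -/
inductive Exec : Prog → State → ℕ → State → Prop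
  | nop (s : State) : Exec .nop s 1 s
  | setNat (s : State) (A : ℕ) (e x : NExp) :
      Exec (.setNat A e x) s (e.cost + x.cost + 1) (s.setNat A (e.eval s) (x.eval s))
  | setReal (s : State) (A : ℕ) (e : NExp) (x : RExp) :
      Exec (.setReal A e x) s (e.cost + x.cost + 1) (s.setReal A (e.eval s) (x.eval s))
  | seq {P Q : Prog} {s s' s'' : State} {t t' : ℕ} :
      Exec P s t s' → Exec Q s' t' s'' → Exec (.seq P Q) s (t + t') s''
  | branch_true {b : Test} {P Q : Prog} {s s' : State} {t : ℕ} :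
      b.Holds s → Exec P s t s' → Exec (.branch b P Q) s (b.cost + t + 1) s'
  | branch_false {b : Test} {P Q : Prog} {s s' : State} {t : ℕ} :
      ¬ b.Holds s → Exec Q s t s' → Exec (.branch b P Q) s (b.cost + t + 1) s'
  | loop_true {b : Test} {P : Prog} {s s' s'' : State} {t t' : ℕ} :
      b.Holds s → Exec P s t s' → Exec (.loop b P) s' t' s'' →
        Exec (.loop b P) s (b.cost + t + t' + 1) s''
  | loop_false {b : Test} {P : Prog} {s : State} :
      ¬ b.Holds s → Exec (.loop b P) s (b.cost + 1) s

end RealRAM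

namespace Highway

/-- The input: the number `n` of points, the speed `v`, and the arrays `1` and `2` with the `x`- and
the `y`-coordinates of the points. All other cells are `0`. -/
noncomputable def inputState {n : ℕ} (v : ℝ) (p : Fin n → Plane) : RealRAM.State where
  nat A i := if A = 0 ∧ i = 0 then n else 0
  real A i :=
    if A = 0 ∧ i = 0 then v
    else if hi : i < n then
      if A = 1 then p ⟨i, hi⟩ 0
      else if A = 2 then p ⟨i, hi⟩ 1
      else 0
    else 0

/-- The output: the line through the point with coordinates in the cells `0`, `1` of the array `3`
in the direction with coordinates in the cells `2`, `3` of this array. -/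
noncomputable def outputLine (s : RealRAM.State) : AffineSubspace ℝ Plane :=
  lineThrough !₂[s.real 3 0, s.real 3 1] !₂[s.real 3 2, s.real 3 3]

end Highway

/-! Fix the orientation `φ` of the highway and project a moving point to a direction `ψ`. Off the
highway the projection moves with speed at most `1`. On the highway the velocity is parallel to it
almost always, so the projection moves with speed at most `v |cos (ψ - φ)|`, which is at most `1` as
soon as `|cos (ψ - φ)| ≤ 1 / v`. Hence the travel time is at least the length of the projection of
`q - p` (`ip_le_pathTime`). The directions `φ ± α` yield the norm `rhNorm` whose balls are the
rhombi, and the direction of a steep pair yields its full distance, so no highway of orientation `φ`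
beats `z(φ)`. Conversely, the line through the center of a smallest rhombus attains `z(φ)`: two
points either walk straight or enter and leave the highway at the angle `α` (`travelTime_le_max`).
This is part (1), `isLeast_travelDiam`. As `z` has period `π`, part (2) asks for a lowest point of
`z` on `[0, π)`.

The width `u` is the larger of the two widths of `S` in the directions `φ - α` and `φ + α`
(`rhombusWidth_eq`). Each of these is a sinusoid belonging to a fixed pair of extreme points until a
hull edge becomes perpendicular to the direction. Instead of computing the hull, a linear scan finds
for every point a pivot, which for a hull vertex spans the next edge. A function `f_{pq}` jumps only
where `pq` and the highway make the angle `α`; there `rhNorm` of `p - q` equals `|p - q|`, so `z` is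
continuous. Between consecutive events (changes of extreme pairs, crossings of the two widths, ends
of the windows of the `f_{pq}`) `z` is the maximum of a constant and one nonnegative sinusoid. A
nonnegative sinusoid is concave, so one end of the interval is as good as any inner point
(`IsEventList.exists_envelope_le`), and it suffices to evaluate `z` at the `O(n²)` events.

The machine has no trigonometric functions, so an orientation in `[0, π)` is represented by its key
`-cos φ`, which increases with `φ` and costs one square root. Each pair and each slot (an interval
with known extreme pairs) contributes a sorted block of three events. A bottom-up merge sort orders
the events and at the same time forms the pointwise maximum of the step functions of the pairs
(`Merging.step`, `Sorting.step`). A final scan carries the current slot along and keeps the best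
value (`scanBody_spec`). The `O(n)` slots cost `O(n)` each, the pairs `O(n²)` and the sorting `O(n²
log n)`.

Programs without loops are evaluated by the function `Prog.run`; loops are handled by counted
invariants (`Runs.loop`), and untouched arrays by the lists of written arrays (`Exec.frame`). -/

open MeasureTheory Set Filter Topology

/-! ### Travel times: the lower bound by projection and the upper bound by three-segment paths. -/

namespace Highway

/-- The inner product with the unit vector of direction `ψ`, in coordinates. -/
noncomputable def ip (ψ : ℝ) (x : Plane) : ℝ := Real.cos ψ * x 0 + Real.sin ψ * x 1

theorem inner_unitDir (ψ : ℝ) (x : Plane) : inner ℝ (unitDir ψ) x = ip ψ x := by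
  simp [unitDir, ip, PiLp.inner_apply, Fin.sum_univ_two, mul_comm]

theorem ip_sub (ψ : ℝ) (x y : Plane) : ip ψ (x - y) = ip ψ x - ip ψ y := by
  simp [ip]; ring

theorem ip_smul (ψ c : ℝ) (x : Plane) : ip ψ (c • x) = c * ip ψ x := by
  simp [ip]; ring

theorem ip_neg (ψ : ℝ) (x : Plane) : ip ψ (-x) = -ip ψ x := by
  simp [ip]; ring

theorem ip_add_pi (ψ : ℝ) (x : Plane) : ip (ψ + Real.pi) x = -ip ψ x := by
  simp [ip, Real.cos_add_pi, Real.sin_add_pi]; ring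

theorem ip_unitDir (ψ φ : ℝ) : ip ψ (unitDir φ) = Real.cos (ψ - φ) := by
  simp [ip, unitDir, Real.cos_sub]

theorem norm_sq_eq (x : Plane) : ‖x‖ ^ 2 = x 0 ^ 2 + x 1 ^ 2 := by
  rw [EuclideanSpace.norm_sq_eq]; simp [Fin.sum_univ_two]

theorem norm_sq_eq_ip (ψ : ℝ) (x : Plane) :
    ‖x‖ ^ 2 = ip ψ x ^ 2 + ip (ψ + Real.pi / 2) x ^ 2 := by
  rw [norm_sq_eq, ip, ip, Real.cos_add_pi_div_two, Real.sin_add_pi_div_two]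
  linear_combination (-(x 0 ^ 2) - x 1 ^ 2) * Real.cos_sq_add_sin_sq ψ

theorem ip_le_norm (ψ : ℝ) (x : Plane) : |ip ψ x| ≤ ‖x‖ := by
  refine abs_le_of_sq_le_sq ?_ (norm_nonneg x)
  rw [norm_sq_eq_ip ψ x]; nlinarith [sq_nonneg (ip (ψ + Real.pi / 2) x)]

/-- The expansion of a vector in the orthonormal basis of directions `φ` and `φ + π / 2`. -/
theorem ip_eq_expand (φ ψ : ℝ) (x : Plane) :
    ip ψ x = Real.cos (ψ - φ) * ip φ x + Real.sin (ψ - φ) * ip (φ + Real.pi / 2) x := by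
  simp only [ip, Real.cos_add_pi_div_two, Real.sin_add_pi_div_two, Real.cos_sub, Real.sin_sub]
  linear_combination (-(Real.cos ψ * x 0) - Real.sin ψ * x 1) * Real.cos_sq_add_sin_sq φ

theorem eq_smul_unitDir_of_ip_eq_zero {φ : ℝ} {x : Plane} (h : ip (φ + Real.pi / 2) x = 0) :
    x = ip φ x • unitDir φ := by
  rw [ip, Real.cos_add_pi_div_two, Real.sin_add_pi_div_two] at h
  ext i
  fin_cases i
  · simp [unitDir, ip]
    linear_combination (-(x 0)) * Real.cos_sq_add_sin_sq φ - Real.sin φ * h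
  · simp [unitDir, ip]
    linear_combination (-(x 1)) * Real.cos_sq_add_sin_sq φ + Real.cos φ * h

theorem unitDir_ne_zero (φ : ℝ) : unitDir φ ≠ 0 := by
  intro h
  have := ip_unitDir φ φ
  rw [h] at this
  simp [ip] at this

theorem mem_span_unitDir {φ : ℝ} {x : Plane} :
    x ∈ Submodule.span ℝ {unitDir φ} ↔ ip (φ + Real.pi / 2) x = 0 := by
  constructor
  · intro h
    obtain ⟨c, rfl⟩ := Submodule.mem_span_singleton.1 h
    rw [ip_smul, ip_unitDir]; simp
  · intro h
    rw [eq_smul_unitDir_of_ip_eq_zero h]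
    exact Submodule.smul_mem _ _ (Submodule.mem_span_singleton_self _)

theorem HasOrientation.mem_iff {h : AffineSubspace ℝ Plane} {φ : ℝ} (ho : HasOrientation h φ)
    {a : Plane} (ha : a ∈ h) (x : Plane) : x ∈ h ↔ ip (φ + Real.pi / 2) (x - a) = 0 := by
  rw [← mem_span_unitDir, ← ho, ← vsub_eq_sub, AffineSubspace.vsub_right_mem_direction_iff_mem ha]

theorem IsHighway.nonempty {h : AffineSubspace ℝ Plane} (hh : IsHighway h) : ∃ a, a ∈ h := by
  by_contra hc
  push Not at hc
  have : h = ⊥ := by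
    rw [← SetLike.coe_set_eq]; ext x; simp [hc x]
  subst this
  rw [IsHighway, AffineSubspace.direction_bot, finrank_bot] at hh
  omega

/-- At almost every zero of a real function at which the function is differentiable, the
derivative vanishes. -/
theorem ae_deriv_eq_zero_of_eq_zero (g : ℝ → ℝ) :
    ∀ᵐ t : ℝ, g t = 0 → DifferentiableAt ℝ g t → deriv g t = 0 := by
  let E : Set ℝ := {t | g t = 0 ∧ DifferentiableAt ℝ g t ∧ deriv g t ≠ 0}
  have hE : E.Countable := by
    -- A zero with nonzero derivative has no other zero nearby, so every point of `E` is isolated in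
    -- `E` from the right, and there are only countably many such points.
    refine Set.Countable.mono ?_ (countable_setOfPred_isolated_right_within (s := E))
    intro t ht
    refine ⟨ht, ?_⟩
    have h := ht.2.1.hasDerivAt.eventually_ne (c := 0) ht.2.2
    rw [← Filter.empty_mem_iff_bot]
    have h2 : ∀ᶠ z in 𝓝[E ∩ Ioi t] t, g z ≠ 0 :=
      h.filter_mono (nhdsWithin_mono _ (fun z hz => ne_of_gt hz.2))
    have h3 : ∀ᶠ z in 𝓝[E ∩ Ioi t] t, z ∈ E ∩ Ioi t := eventually_mem_nhdsWithin
    filter_upwards [h2, h3] with z hz hz'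
    exact hz hz'.1.1
  have := hE.measure_zero volume
  rw [measure_eq_zero_iff_ae_notMem] at this
  filter_upwards [this] with t ht h0 hd
  by_contra hc
  exact ht ⟨h0, hd, hc⟩

-- The highway is closed, so the speed is a measurable function of time, and a Lipschitz path has
-- bounded derivative. Without integrability the integral in `pathTime` would be the default value
-- `0`, and could be neither split nor compared.
open Classical in
theorem pathTime_integrable (v : ℝ) (h : AffineSubspace ℝ Plane) {γ : ℝ → Plane} {K : NNReal}
    (hγ : LipschitzWith K γ) (a b : ℝ) :
    IntervalIntegrable (fun t => (if γ t ∈ h then v⁻¹ else 1) * ‖deriv γ t‖) volume a b := by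
  have hcl : IsClosed (h : Set Plane) := AffineSubspace.closed_of_finiteDimensional h
  have hms : MeasurableSet {t | γ t ∈ h} := (hcl.preimage hγ.continuous).measurableSet
  refine IntervalIntegrable.mono_fun' (g := fun _ => (|v⁻¹| + 1) * K)
    intervalIntegrable_const ?_ ?_
  · apply Measurable.aestronglyMeasurable
    exact (Measurable.ite hms measurable_const measurable_const).mul (measurable_deriv γ).norm
  · refine Eventually.of_forall fun t => ?_
    have h1 : ‖deriv γ t‖ ≤ K := norm_deriv_le_of_lipschitz hγ
    beta_reduce
    rw [norm_mul, norm_norm, Real.norm_eq_abs]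
    refine mul_le_mul ?_ h1 (norm_nonneg _) (by positivity)
    split_ifs
    · linarith
    · simp

theorem pathTime_nonneg {v : ℝ} (hv : 0 ≤ v) (h : AffineSubspace ℝ Plane) (γ : ℝ → Plane) :
    0 ≤ pathTime v h γ := by
  refine intervalIntegral.integral_nonneg (by norm_num) fun t _ => ?_
  have : 0 ≤ v⁻¹ := inv_nonneg.2 hv
  split_ifs <;> positivity

theorem lipschitz_ip (ψ : ℝ) : LipschitzWith 1 (ip ψ) :=
  LipschitzWith.of_dist_le_mul fun x y => by
    rw [Real.dist_eq, dist_eq_norm, ← ip_sub]; simpa using ip_le_norm ψ (x - y)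

theorem hasDerivAt_ip_comp (ψ : ℝ) {γ : ℝ → Plane} {t : ℝ} (a : Plane)
    (hd : DifferentiableAt ℝ γ t) :
    HasDerivAt (fun s => ip ψ (γ s - a)) (ip ψ (deriv γ t)) t := by
  have h : ∀ i, HasDerivAt (fun s => γ s i) (deriv γ t i) t := fun i =>
    (EuclideanSpace.proj (𝕜 := ℝ) i).hasFDerivAt.comp_hasDerivAt t hd.hasDerivAt
  simp only [ip, PiLp.sub_apply]
  exact (((h 0).sub_const _).const_mul _).add (((h 1).sub_const _).const_mul _)

/-- Every path is at least as long, in time, as its projection to a direction that makes an angle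
of at least the critical angle with the highway. -/
theorem ip_le_pathTime {v : ℝ} {h : AffineSubspace ℝ Plane} (hh : IsHighway h)
    {φ : ℝ} (ho : HasOrientation h φ) {ψ : ℝ} (hψ : |Real.cos (ψ - φ)| ≤ 1 / v) {γ : ℝ → Plane}
    {K : NNReal} (hγ : LipschitzWith K γ) : ip ψ (γ 1 - γ 0) ≤ pathTime v h γ := by
  obtain ⟨a, ha⟩ := hh.nonempty
  have hlip : LipschitzWith K (fun s => ip ψ (γ s - a)) := by
    have h1 := (lipschitz_ip ψ).comp (hγ.sub (LipschitzWith.const a))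
    simpa [Function.comp_def] using h1
  have hac : AbsolutelyContinuousOnInterval (fun s => ip ψ (γ s - a)) 0 1 :=
    (hlip.lipschitzOnWith (s := uIcc 0 1)).absolutelyContinuousOnInterval
  have hft := hac.integral_deriv_eq_sub
  have : ip ψ (γ 1 - γ 0) = ip ψ (γ 1 - a) - ip ψ (γ 0 - a) := by simp only [ip_sub]; ring
  rw [this, ← hft, pathTime]
  apply intervalIntegral.integral_mono_ae (by norm_num) hac.intervalIntegrable_deriv
    (pathTime_integrable v h hγ 0 1)
  -- While the path is on the highway its distance coordinate `ip (φ + π / 2)` is zero, so at almost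
  -- all such times the derivative of this coordinate vanishes and the velocity is parallel to the
  -- highway.
  filter_upwards [hγ.ae_differentiableAt_real,
    ae_deriv_eq_zero_of_eq_zero (fun s => ip (φ + Real.pi / 2) (γ s - a))] with t hd hz
  rw [(hasDerivAt_ip_comp ψ a hd).deriv]
  split_ifs with hm
  · have h1 := hasDerivAt_ip_comp (φ + Real.pi / 2) a hd
    have h2 := hz ((ho.mem_iff ha _).1 hm) h1.differentiableAt
    rw [h1.deriv] at h2
    have h3 := norm_sq_eq_ip φ (deriv γ t)
    rw [h2] at h3
    have h4 : ‖deriv γ t‖ = |ip φ (deriv γ t)| := by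
      rw [← abs_norm]; exact (sq_eq_sq_iff_abs_eq_abs _ _).1 (by rw [h3]; ring)
    rw [ip_eq_expand φ, h2, h4, mul_zero, add_zero, ← one_div]
    calc _ ≤ |Real.cos (ψ - φ) * ip φ (deriv γ t)| := le_abs_self _
      _ = |Real.cos (ψ - φ)| * |ip φ (deriv γ t)| := abs_mul _ _
      _ ≤ _ := mul_le_mul_of_nonneg_right hψ (abs_nonneg _)
  · rw [one_mul]; exact (le_abs_self _).trans (ip_le_norm _ _)

/-- The path that runs along the polygonal chain `p`, `A`, `B`, `q`. -/
noncomputable def chain (p A B q : Plane) (t : ℝ) : Plane :=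
  p + max 0 (min (3 * t) 1) • (A - p) + max 0 (min (3 * t - 1) 1) • (B - A)
    + max 0 (min (3 * t - 2) 1) • (q - B)

theorem lipschitz_clamp (c : ℝ) : LipschitzWith 3 (fun t : ℝ => max 0 (min (3 * t - c) 1)) := by
  have h1 : LipschitzWith 3 (fun t : ℝ => 3 * t - c) :=
    LipschitzWith.of_dist_le_mul fun x y => by
      rw [Real.dist_eq, Real.dist_eq, show 3 * x - c - (3 * y - c) = 3 * (x - y) by ring, abs_mul]
      simp
  exact (h1.min_const 1).const_max 0

theorem lipschitz_chain (p A B q : Plane) : ∃ K : NNReal, LipschitzWith K (chain p A B q) := by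
  have key : ∀ (c : ℝ) (u : Plane),
      LipschitzWith (3 * ‖u‖₊) (fun t : ℝ => max 0 (min (3 * t - c) 1) • u) := fun c u =>
    LipschitzWith.of_dist_le_mul fun x y => by
      rw [dist_eq_norm, ← sub_smul, norm_smul, ← dist_eq_norm]
      have := (lipschitz_clamp c).dist_le_mul x y
      push_cast at this ⊢
      nlinarith [norm_nonneg u]
  have h0 := key 0 (A - p)
  simp only [sub_zero] at h0
  exact ⟨_, (((LipschitzWith.const p).add h0).add (key 1 (B - A))).add (key 2 (q - B))⟩

theorem chain_zero (p A B q : Plane) : chain p A B q 0 = p := by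
  norm_num [chain]

theorem chain_one (p A B q : Plane) : chain p A B q 1 = q := by
  norm_num [chain]

/-- The term `3 * t - 0` keeps the shape `3 * t - c` that `segment_time_le` expects. -/
theorem chain_eq_first (p A B q : Plane) {t : ℝ} (h : t ∈ Icc (0 : ℝ) (1 / 3)) :
    chain p A B q t = (p) + (3 * t - 0) • (A - p) := by
  obtain ⟨h1, h2⟩ := h
  rw [chain, min_eq_left (by linarith), max_eq_right (by linarith),
    max_eq_left (min_le_of_left_le (by linarith)), max_eq_left (min_le_of_left_le (by linarith))]
  simp

theorem chain_eq_second (p A B q : Plane) {t : ℝ} (h : t ∈ Icc (1 / 3 : ℝ) (2 / 3)) :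
    chain p A B q t = A + (3 * t - 1) • (B - A) := by
  obtain ⟨h1, h2⟩ := h
  rw [chain, min_eq_right (by linarith), max_eq_right (by linarith), min_eq_left (by linarith),
    max_eq_right (by linarith), max_eq_left (min_le_of_left_le (by linarith))]
  simp

theorem chain_eq_third (p A B q : Plane) {t : ℝ} (h : t ∈ Icc (2 / 3 : ℝ) 1) :
    chain p A B q t = B + (3 * t - 2) • (q - B) := by
  obtain ⟨h1, h2⟩ := h
  rw [chain, min_eq_right (by linarith), max_eq_right (by linarith), min_eq_right (by linarith),
    max_eq_right (by linarith), min_eq_left (by linarith), max_eq_right (by linarith)]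
  simp

-- The bound on the slowness is required only for `P ≠ Q`, since a degenerate segment takes no time,
-- and only in the open interval, since at its ends the path may have a corner.
open Classical in
theorem segment_time_le {v : ℝ} {h : AffineSubspace ℝ Plane} {γ : ℝ → Plane}
    {K : NNReal} (hγ : LipschitzWith K γ) {a b k c : ℝ} {P Q : Plane} (hab : b = a + 1 / 3)
    (hseg : ∀ t ∈ Icc a b, γ t = P + (3 * t - c) • (Q - P))
    (hk : ∀ t ∈ Ioo a b, P ≠ Q → (if γ t ∈ h then v⁻¹ else 1) ≤ k) :
    ∫ t in a..b, (if γ t ∈ h then v⁻¹ else 1) * ‖deriv γ t‖ ≤ k * ‖Q - P‖ := by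
  have hle : a ≤ b := by linarith
  have h1 : ∫ t in a..b, (if γ t ∈ h then v⁻¹ else 1) * ‖deriv γ t‖ ≤
      ∫ t in a..b, k * (3 * ‖Q - P‖) := by
    apply intervalIntegral.integral_mono_on_of_le_Ioo hle (pathTime_integrable v h hγ a b)
      intervalIntegrable_const
    intro t ht
    have hd : HasDerivAt γ ((3 : ℝ) • (Q - P)) t := by
      have h2 : HasDerivAt (fun t : ℝ => P + (3 * t - c) • (Q - P)) ((3 : ℝ) • (Q - P)) t := by
        have h3 : HasDerivAt (fun t : ℝ => 3 * t - c) 3 t := by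
          simpa using ((hasDerivAt_id t).const_mul 3).sub_const c
        simpa using (h3.smul_const (Q - P)).const_add P
      apply h2.congr_of_eventuallyEq
      filter_upwards [Ioo_mem_nhds ht.1 ht.2] with s hs
      exact hseg s ⟨hs.1.le, hs.2.le⟩
    rw [hd.deriv, norm_smul, Real.norm_eq_abs, abs_of_pos (by norm_num : (0 : ℝ) < 3)]
    by_cases hPQ : P = Q
    · simp [hPQ]
    · exact mul_le_mul_of_nonneg_right (hk t ht hPQ) (by positivity)
  refine h1.trans (le_of_eq ?_)
  rw [intervalIntegral.integral_const, hab, smul_eq_mul]; ring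

theorem travelTime_bddBelow {v : ℝ} (hv : 0 ≤ v) (h : AffineSubspace ℝ Plane) (p q : Plane) :
    BddBelow {T : ℝ | ∃ γ : ℝ → Plane, (∃ K : NNReal, LipschitzWith K γ) ∧ γ 0 = p ∧ γ 1 = q ∧
      T = pathTime v h γ} :=
  ⟨0, by rintro T ⟨γ, -, -, -, rfl⟩; exact pathTime_nonneg hv h γ⟩

/-- Walk from `p` to `A`, ride to `B`, walk to `q`. For `A = B` nothing has to lie on the highway,
so plain walking is the case `A = B = p`. -/
theorem travelTime_le_chain {v : ℝ} (hv : 1 < v) (h : AffineSubspace ℝ Plane) (p A B q : Plane)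
    (hAB : A ≠ B → A ∈ h ∧ B ∈ h) :
    travelTime v h p q ≤ ‖A - p‖ + v⁻¹ * ‖B - A‖ + ‖q - B‖ := by
  classical
  obtain ⟨K, hK⟩ := lipschitz_chain p A B q
  refine (csInf_le (travelTime_bddBelow (by linarith) h p q)
    ⟨_, ⟨K, hK⟩, chain_zero p A B q, chain_one p A B q, rfl⟩).trans ?_
  have hv1 : v⁻¹ ≤ 1 := inv_le_one_of_one_le₀ hv.le
  have hw : ∀ t, (if chain p A B q t ∈ h then v⁻¹ else 1) ≤ (1 : ℝ) := fun t => by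
    split_ifs <;> linarith
  have h1 := segment_time_le (v := v) (h := h) hK (k := 1) (by norm_num)
    (fun t ht => chain_eq_first p A B q ht) (fun t _ _ => hw t)
  have h2 := segment_time_le (v := v) (h := h) hK (k := v⁻¹) (by norm_num)
    (fun t ht => chain_eq_second p A B q ht) (fun t ht hne => by
      rw [if_pos]
      rw [chain_eq_second p A B q ⟨ht.1.le, ht.2.le⟩]
      have := AffineMap.lineMap_mem (3 * t - 1) (hAB hne).1 (hAB hne).2
      rwa [AffineMap.lineMap_apply, vsub_eq_sub, vadd_eq_add, add_comm] at this)
  have h3 := segment_time_le (v := v) (h := h) hK (k := 1) (by norm_num)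
    (fun t ht => chain_eq_third p A B q ht) (fun t _ _ => hw t)
  rw [pathTime, ← intervalIntegral.integral_add_adjacent_intervals
    (pathTime_integrable v h hK 0 (2 / 3)) (pathTime_integrable v h hK (2 / 3) 1),
    ← intervalIntegral.integral_add_adjacent_intervals
    (pathTime_integrable v h hK 0 (1 / 3)) (pathTime_integrable v h hK (1 / 3) (2 / 3))]
  linarith

theorem travelTime_le_dist {v : ℝ} (hv : 1 < v) (h : AffineSubspace ℝ Plane) (p q : Plane) :
    travelTime v h p q ≤ dist p q := by
  have := travelTime_le_chain hv h p p p q (fun h => absurd rfl h)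
  simpa [dist_eq_norm, norm_sub_rev] using this

theorem ip_le_travelTime {v : ℝ} {h : AffineSubspace ℝ Plane} (hh : IsHighway h)
    {φ : ℝ} (ho : HasOrientation h φ) {ψ : ℝ} (hψ : |Real.cos (ψ - φ)| ≤ 1 / v) (p q : Plane) :
    ip ψ (q - p) ≤ travelTime v h p q := by
  -- The chain with `A = B = p` shows that the set of path times is nonempty.
  refine le_csInf ⟨_, _, lipschitz_chain p p p q, chain_zero p p p q, chain_one p p p q, rfl⟩ ?_
  rintro T ⟨γ, ⟨K, hK⟩, rfl, rfl, rfl⟩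
  exact ip_le_pathTime hh ho hψ hK

end Highway

/-! ### Rhombi, and the equality of `z(φ)` with the best diameter of orientation `φ`. -/

namespace Highway

theorem criticalAngle_pos {v : ℝ} (hv : 1 < v) : 0 < criticalAngle v :=
  Real.arccos_pos.2 (by rw [div_lt_one (by linarith)]; exact hv)

theorem criticalAngle_lt {v : ℝ} (hv : 1 < v) : criticalAngle v < Real.pi / 2 :=
  Real.arccos_lt_pi_div_two.2 (by positivity)

theorem cos_criticalAngle {v : ℝ} (hv : 1 < v) : Real.cos (criticalAngle v) = 1 / v := by
  have h0 : 0 < 1 / v := by positivity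
  have h1 : 1 / v ≤ 1 := by rw [div_le_one (by linarith)]; exact hv.le
  exact Real.cos_arccos (by linarith) h1

theorem sin_criticalAngle (v : ℝ) : Real.sin (criticalAngle v) = √(1 - (1 / v) ^ 2) :=
  Real.sin_arccos _

theorem cos_criticalAngle_pos {v : ℝ} (hv : 1 < v) : 0 < Real.cos (criticalAngle v) := by
  rw [cos_criticalAngle hv]; positivity

theorem sin_criticalAngle_pos {v : ℝ} (hv : 1 < v) : 0 < Real.sin (criticalAngle v) :=
  Real.sin_pos_of_pos_of_lt_pi (criticalAngle_pos hv)
    (by linarith [criticalAngle_lt hv, Real.pi_pos])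

/-- The norm whose balls are the rhombi of orientation `φ`. -/
noncomputable def rhNorm (v φ : ℝ) (x : Plane) : ℝ :=
  max |ip (φ - criticalAngle v) x| |ip (φ + criticalAngle v) x|

theorem ip_add_angle (φ α : ℝ) (x : Plane) :
    ip (φ + α) x = Real.cos α * ip φ x + Real.sin α * ip (φ + Real.pi / 2) x := by
  have := ip_eq_expand φ (φ + α) x
  rwa [add_sub_cancel_left] at this

theorem ip_sub_angle (φ α : ℝ) (x : Plane) :
    ip (φ - α) x = Real.cos α * ip φ x - Real.sin α * ip (φ + Real.pi / 2) x := by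
  have := ip_add_angle φ (-α) x
  rw [Real.cos_neg, Real.sin_neg] at this
  rw [sub_eq_add_neg, this]; ring

/-- This is `max |a - b| |a + b| = |a| + |b|`: a rhombus is the intersection of two strips
perpendicular to `φ - α` and `φ + α`. -/
theorem rhNorm_eq {v : ℝ} (hv : 1 < v) (φ : ℝ) (x : Plane) :
    rhNorm v φ x = |ip φ x| * Real.cos (criticalAngle v)
      + |ip (φ + Real.pi / 2) x| * Real.sin (criticalAngle v) := by
  have hc := cos_criticalAngle_pos hv
  have hs := sin_criticalAngle_pos hv
  rw [rhNorm, ip_add_angle, ip_sub_angle, ← abs_of_pos hc, ← abs_of_pos hs, ← abs_mul, ← abs_mul,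
    abs_of_pos hc, abs_of_pos hs, mul_comm _ (ip φ x), mul_comm _ (ip (φ + Real.pi / 2) x)]
  set a := ip φ x * Real.cos (criticalAngle v)
  set b := ip (φ + Real.pi / 2) x * Real.sin (criticalAngle v)
  apply le_antisymm
  · exact max_le (abs_sub a b) (abs_add_le a b)
  · rcases le_total 0 a with ha | ha <;> rcases le_total 0 b with hb | hb <;>
      simp only [abs_of_nonneg, abs_of_nonpos, ha, hb]
    · exact le_max_of_le_right (le_abs_self _)
    · exact le_max_of_le_left (by rw [← sub_eq_add_neg]; exact le_abs_self _)
    · exact le_max_of_le_left (by rw [abs_sub_comm]; linarith [le_abs_self (b - a)])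
    · exact le_max_of_le_right (by linarith [neg_abs_le (a + b)])

theorem mem_rhombus_iff {v : ℝ} (hv : 1 < v) {φ w : ℝ} {c x : Plane} :
    x ∈ rhombus v φ c w ↔ rhNorm v φ (x - c) ≤ w / 2 := by
  rw [rhNorm_eq hv, rhombus, mem_ofPred_eq, inner_unitDir, inner_unitDir]

theorem rhNorm_sub_le (v φ : ℝ) (x y c : Plane) :
    rhNorm v φ (x - y) ≤ rhNorm v φ (x - c) + rhNorm v φ (y - c) := by
  have key : ∀ ψ, |ip ψ (x - y)| ≤ |ip ψ (x - c)| + |ip ψ (y - c)| := fun ψ => by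
    have : ip ψ (x - y) = ip ψ (x - c) - ip ψ (y - c) := by simp only [ip_sub]; ring
    rw [this]; exact abs_sub _ _
  exact max_le ((key _).trans (add_le_add (le_max_left _ _) (le_max_left _ _)))
    ((key _).trans (add_le_add (le_max_right _ _) (le_max_right _ _)))

/-- The cosine decreases on `[0, π]`, so the two bounds on the angle become `|cos θ| < cos α`;
multiplication by the norm removes the angle. For `a = b` both sides are `0`. -/
theorem pairDist_eq {v : ℝ} (hv : 1 < v) (a b : Plane) (φ : ℝ) :
    pairDist v a b φ =
      if |ip φ (a - b)| < ‖a - b‖ * Real.cos (criticalAngle v) then ‖a - b‖ else 0 := by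
  by_cases hab : a = b
  · simp [pairDist, hab]
  have hd : 0 < ‖a - b‖ := norm_pos_iff.2 (sub_ne_zero.2 hab)
  have hn : ‖unitDir φ‖ = 1 := by
    have := norm_sq_eq_ip φ (unitDir φ)
    rw [ip_unitDir, ip_unitDir] at this
    rw [← sq_eq_sq₀ (norm_nonneg _) zero_le_one, this]
    simp
  have h1 := InnerProductGeometry.cos_angle_mul_norm_mul_norm (a - b) (unitDir φ)
  rw [hn, mul_one, real_inner_comm, inner_unitDir] at h1
  have hα := criticalAngle_pos hv
  have hα' := criticalAngle_lt hv
  set θ := InnerProductGeometry.angle (a - b) (unitDir φ)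
  have hθ0 : 0 ≤ θ := InnerProductGeometry.angle_nonneg _ _
  have hθ1 : θ ≤ Real.pi := InnerProductGeometry.angle_le_pi _ _
  have e1 : criticalAngle v < θ ↔ Real.cos θ < Real.cos (criticalAngle v) :=
    (Real.strictAntiOn_cos.lt_iff_gt (a := θ) (b := criticalAngle v) ⟨hθ0, hθ1⟩
      ⟨hα.le, by linarith⟩).symm
  have e2 : θ < Real.pi - criticalAngle v ↔ -Real.cos (criticalAngle v) < Real.cos θ := by
    rw [← Real.cos_pi_sub]
    exact (Real.strictAntiOn_cos.lt_iff_gt (b := θ) (a := Real.pi - criticalAngle v)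
      ⟨by linarith, by linarith⟩ ⟨hθ0, hθ1⟩).symm
  have e3 : (criticalAngle v < θ ∧ θ < Real.pi - criticalAngle v) ↔
      |ip φ (a - b)| < ‖a - b‖ * Real.cos (criticalAngle v) := by
    rw [e1, e2, ← h1, abs_mul, abs_of_pos hd, mul_comm, mul_lt_mul_iff_right₀ hd, abs_lt, and_comm]
  rw [pairDist, dist_eq_norm]
  by_cases h : |ip φ (a - b)| < ‖a - b‖ * Real.cos (criticalAngle v)
  · rw [if_pos h, if_pos (e3.2 h)]
  · rw [if_neg h, if_neg (mt e3.1 h)]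

theorem exists_eq_norm_smul_unitDir (x : Plane) : ∃ ψ, x = ‖x‖ • unitDir ψ := by
  refine ⟨Complex.arg ⟨x 0, x 1⟩, ?_⟩
  have hn : ‖(⟨x 0, x 1⟩ : ℂ)‖ = ‖x‖ := by
    rw [← sq_eq_sq₀ (norm_nonneg _) (norm_nonneg _), norm_sq_eq, Complex.sq_norm,
      Complex.normSq_apply]; ring
  have h1 := Complex.norm_mul_cos_arg ⟨x 0, x 1⟩
  have h2 := Complex.norm_mul_sin_arg ⟨x 0, x 1⟩
  rw [hn] at h1 h2
  ext i
  fin_cases i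
  · simpa [unitDir] using h1.symm
  · simpa [unitDir] using h2.symm

/-- Projection to the directions `φ ± α` and their opposites, for which `|cos (ψ - φ)| = 1 / v`
exactly. -/
theorem rhNorm_le_travelTime {v : ℝ} (hv : 1 < v) {h : AffineSubspace ℝ Plane}
    (hh : IsHighway h) {φ : ℝ} (ho : HasOrientation h φ) (p q : Plane) :
    rhNorm v φ (p - q) ≤ travelTime v h p q := by
  have key : ∀ ψ, |Real.cos (ψ - φ)| ≤ 1 / v → |ip ψ (p - q)| ≤ travelTime v h p q := by
    intro ψ hψ
    have h1 := ip_le_travelTime hh ho hψ p q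
    have h2 := ip_le_travelTime hh ho (ψ := ψ + Real.pi)
      (by rwa [add_sub_right_comm, Real.cos_add_pi, abs_neg]) p q
    rw [ip_add_pi] at h2
    rw [← neg_sub, ip_neg, abs_neg]
    exact abs_le.2 ⟨by linarith, h1⟩
  have hc := cos_criticalAngle hv
  have hc0 := cos_criticalAngle_pos hv
  refine max_le (key _ ?_) (key _ ?_)
  · rw [sub_sub_cancel_left, Real.cos_neg, abs_of_pos hc0, hc]
  · rw [add_sub_cancel_left, abs_of_pos hc0, hc]

/-- Projection to the direction of `q - p` itself: if the pair is steep, this direction is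
admissible and nothing of the length is lost. If it is not, the left side is `0`. -/
theorem pairDist_le_travelTime {v : ℝ} (hv : 1 < v) {h : AffineSubspace ℝ Plane}
    (hh : IsHighway h) {φ : ℝ} (ho : HasOrientation h φ) (p q : Plane) :
    pairDist v p q φ ≤ travelTime v h p q := by
  rw [pairDist_eq hv]
  split_ifs with hlt
  · obtain ⟨ψ, hψ⟩ := exists_eq_norm_smul_unitDir (q - p)
    have hpos : 0 < ‖p - q‖ := by
      by_contra hc
      have : ‖p - q‖ = 0 := le_antisymm (not_lt.1 hc) (norm_nonneg _)
      rw [this, zero_mul] at hlt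
      exact absurd hlt (not_lt.2 (abs_nonneg _))
    have h1 : ip ψ (q - p) = ‖p - q‖ := by
      rw [hψ, ip_smul, ip_unitDir, norm_sub_rev]; simp
    rw [← h1]
    refine ip_le_travelTime hh ho ?_ p q
    rw [← neg_sub, ip_neg, abs_neg, hψ, ip_smul, ip_unitDir, abs_mul, norm_neg, norm_smul,
      abs_norm, norm_norm] at hlt
    rw [← cos_criticalAngle hv, ← Real.cos_neg, neg_sub]
    have hu : ‖q - p‖ * ‖unitDir ψ‖ = ‖q - p‖ := by
      conv_rhs => rw [hψ, norm_smul, norm_norm]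
    rw [hu] at hlt
    rw [norm_sub_rev] at hpos
    exact (lt_of_mul_lt_mul_left hlt hpos.le).le
  · exact le_trans (abs_nonneg _) ((le_max_left _ _).trans (rhNorm_le_travelTime hv hh ho p q))

theorem hasOrientation_lineThrough (c : Plane) (φ : ℝ) :
    HasOrientation (lineThrough c (unitDir φ)) φ := by
  rw [HasOrientation, lineThrough, AffineSubspace.direction_mk']

theorem isHighway_of_hasOrientation {h : AffineSubspace ℝ Plane} {φ : ℝ}
    (ho : HasOrientation h φ) : IsHighway h := by
  rw [IsHighway, ho, finrank_span_singleton (unitDir_ne_zero φ)]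

theorem norm_eq_of_ip {φ : ℝ} {x : Plane} {r : ℝ} (hr : 0 ≤ r)
    (h : ip φ x ^ 2 + ip (φ + Real.pi / 2) x ^ 2 = r ^ 2) : ‖x‖ = r := by
  rw [← sq_eq_sq₀ (norm_nonneg _) hr, norm_sq_eq_ip φ, h]

/-- Two points in a rhombus of width `w` whose center lies on the highway have travel time at most
`w`, unless their connecting line is steep and they are farther apart than `w`. -/
theorem travelTime_le_max {v : ℝ} (hv : 1 < v) {φ w : ℝ} {c p q : Plane}
    (hp : p ∈ rhombus v φ c w) (hq : q ∈ rhombus v φ c w) :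
    travelTime v (lineThrough c (unitDir φ)) p q ≤ max w (pairDist v p q φ) := by
  have hc := cos_criticalAngle_pos hv
  have hs := sin_criticalAngle_pos hv
  have hcs := Real.cos_sq_add_sin_sq (criticalAngle v)
  have hcv : v⁻¹ = Real.cos (criticalAngle v) := by rw [cos_criticalAngle hv, one_div]
  rw [mem_rhombus_iff hv, rhNorm_eq hv] at hp hq
  set h := lineThrough c (unitDir φ) with hh
  rw [pairDist_eq hv]
  split_ifs with hlt
  · exact le_max_of_le_right (by rw [← dist_eq_norm]; exact travelTime_le_dist hv h p q)
  refine le_max_of_le_left ?_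
  have hX : ip φ (p - q) = ip φ (p - c) - ip φ (q - c) := by simp only [ip_sub]; ring
  rw [hX] at hlt
  set C := Real.cos (criticalAngle v)
  set S := Real.sin (criticalAngle v)
  set X₁ := ip φ (p - c)
  set X₂ := ip φ (q - c)
  set Y₁ := ip (φ + Real.pi / 2) (p - c) with hY₁
  set Y₂ := ip (φ + Real.pi / 2) (q - c) with hY₂
  -- The sum of the two rhombus conditions. This number is the time of the highway route built
  -- below.
  have hsum : |X₁ - X₂| * C + (|Y₁| + |Y₂|) * S ≤ w := by
    have := abs_sub X₁ X₂
    nlinarith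
  -- If the points are too close along the highway to enter and leave it at the angle `α`, they
  -- walk. As the pair is not steep, `‖p - q‖ * C ≤ |X₁ - X₂|`, and `C² + S² = 1` with the case
  -- assumption gives `|X₁ - X₂| ≤ w * C`.
  rcases lt_or_ge (|X₁ - X₂| * S) ((|Y₁| + |Y₂|) * C) with hst | hst
  · refine (travelTime_le_dist hv h p q).trans (le_trans ?_ hsum)
    rw [dist_eq_norm]
    refine le_of_mul_le_mul_right ((not_lt.1 hlt).trans ?_) hc
    have h1 := mul_le_mul_of_nonneg_right hst.le hs.le
    nlinarith [abs_nonneg (X₁ - X₂)]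
  · obtain ⟨σ, hσ, hσX⟩ : ∃ σ : ℝ, σ ^ 2 = 1 ∧ X₂ - X₁ = σ * |X₁ - X₂| := by
      rcases le_total X₁ X₂ with hle | hle
      · exact ⟨1, by norm_num, by rw [abs_of_nonpos (by linarith)]; ring⟩
      · exact ⟨-1, by norm_num, by rw [abs_of_nonneg (by linarith)]; ring⟩
    -- Both points approach the highway at the angle `α`, each heading towards the other one; `|Y| *
    -- (C / S)` is the resulting advance along the highway and `σ` the sign of `X₂ - X₁`.
    set a := X₁ + σ * (|Y₁| * (C / S)) with ha
    set b := X₂ - σ * (|Y₂| * (C / S)) with hb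
    have hmem : ∀ s : ℝ, c + s • unitDir φ ∈ h := fun s => by
      rw [hh, lineThrough, AffineSubspace.mem_mk']
      simpa using Submodule.smul_mem _ s (Submodule.mem_span_singleton_self (unitDir φ))
    have e1 : ∀ s : ℝ, ∀ x : Plane, ∀ ψ : ℝ,
        ip ψ (c + s • unitDir φ - x) = s * Real.cos (ψ - φ) - ip ψ (x - c) := fun s x ψ => by
      have : c + s • unitDir φ - x = s • unitDir φ - (x - c) := by abel
      rw [this, ip_sub, ip_smul, ip_unitDir]
    have hcot : (C / S) ^ 2 + 1 = (1 / S) ^ 2 := by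
      field_simp; linarith
    have hA : ‖c + a • unitDir φ - p‖ = |Y₁| * (1 / S) := by
      apply norm_eq_of_ip (φ := φ) (by positivity)
      rw [e1, e1, sub_self, Real.cos_zero, add_sub_cancel_left, Real.cos_pi_div_two, ← hY₁,
        mul_pow, ← hcot, sq_abs, ha]
      change (_ - X₁) ^ 2 + _ = _
      have : |Y₁| ^ 2 = Y₁ ^ 2 := sq_abs _
      linear_combination (|Y₁| * (C / S)) ^ 2 * hσ + (C / S) ^ 2 * this
    have hB : ‖q - (c + b • unitDir φ)‖ = |Y₂| * (1 / S) := by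
      rw [norm_sub_rev]
      apply norm_eq_of_ip (φ := φ) (by positivity)
      rw [e1, e1, sub_self, Real.cos_zero, add_sub_cancel_left, Real.cos_pi_div_two, ← hY₂,
        mul_pow, ← hcot, sq_abs, hb]
      change (_ - X₂) ^ 2 + _ = _
      have : |Y₂| ^ 2 = Y₂ ^ 2 := sq_abs _
      linear_combination (|Y₂| * (C / S)) ^ 2 * hσ + (C / S) ^ 2 * this
    have hge : 0 ≤ |X₁ - X₂| - (|Y₁| + |Y₂|) * (C / S) := by
      have : (|Y₁| + |Y₂|) * (C / S) ≤ |X₁ - X₂| := by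
        rw [← mul_div_assoc, div_le_iff₀ hs]; exact hst
      linarith
    have hAB : ‖c + b • unitDir φ - (c + a • unitDir φ)‖
        = |X₁ - X₂| - (|Y₁| + |Y₂|) * (C / S) := by
      apply norm_eq_of_ip (φ := φ) hge
      rw [add_sub_add_left_eq_sub, ← sub_smul, ip_smul, ip_smul, ip_unitDir, ip_unitDir, sub_self,
        add_sub_cancel_left, Real.cos_pi_div_two, Real.cos_zero]
      have : b - a = σ * (|X₁ - X₂| - (|Y₁| + |Y₂|) * (C / S)) := by
        rw [ha, hb]; linear_combination hσX
      rw [this]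
      linear_combination (|X₁ - X₂| - (|Y₁| + |Y₂|) * (C / S)) ^ 2 * hσ
    refine (travelTime_le_chain hv h p (c + a • unitDir φ) (c + b • unitDir φ) q
      fun _ => ⟨hmem _, hmem _⟩).trans (le_trans (le_of_eq ?_) hsum)
    -- Walking costs `|Y| / S` and saves `|Y| * C / S` of riding at slowness `C`; the net cost is
    -- `|Y| * (1 - C²) / S = |Y| * S`.
    rw [hA, hB, hAB, hcv]
    field_simp
    linear_combination (-|Y₁| - |Y₂|) * hcs

section Finite

variable {n : ℕ}

theorem le_iSup_fin {ι : Type*} [Finite ι] (f : ι → ℝ) (i : ι) : f i ≤ ⨆ j, f j :=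
  le_ciSup (Set.finite_range f).bddAbove i

/-- The distance of the two lines perpendicular to the direction `ψ` that enclose the points. -/
noncomputable def spread (p : Fin n → Plane) (ψ : ℝ) : ℝ :=
  ⨆ ij : Fin n × Fin n, ip ψ (p ij.1 - p ij.2)

theorem abs_ip_le_spread (p : Fin n → Plane) (ψ : ℝ) (i j : Fin n) :
    |ip ψ (p i - p j)| ≤ spread p ψ := by
  have h1 := le_iSup_fin (fun ij : Fin n × Fin n => ip ψ (p ij.1 - p ij.2)) (i, j)
  have h2 := le_iSup_fin (fun ij : Fin n × Fin n => ip ψ (p ij.1 - p ij.2)) (j, i)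
  simp only at h1 h2
  rw [← neg_sub, ip_neg] at h2
  exact abs_le.2 ⟨by rw [spread]; linarith, h1⟩

variable [NeZero n]

/-- The points `p a` and `p b` are the extreme ones in the directions `ψ` and `ψ + π`. -/
def IsExtreme (p : Fin n → Plane) (ψ : ℝ) (a b : Fin n) : Prop :=
  ∀ i, ip ψ (p b) ≤ ip ψ (p i) ∧ ip ψ (p i) ≤ ip ψ (p a)

theorem exists_isExtreme (p : Fin n → Plane) (ψ : ℝ) : ∃ a b, IsExtreme p ψ a b := by
  obtain ⟨a, ha⟩ := Finite.exists_max (fun i => ip ψ (p i))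
  obtain ⟨b, hb⟩ := Finite.exists_min (fun i => ip ψ (p i))
  exact ⟨a, b, fun i => ⟨hb i, ha i⟩⟩

theorem IsExtreme.spread_eq {p : Fin n → Plane} {ψ : ℝ} {a b : Fin n} (h : IsExtreme p ψ a b) :
    spread p ψ = ip ψ (p a - p b) := by
  apply le_antisymm
  · refine ciSup_le fun ij => ?_
    rw [ip_sub, ip_sub]
    linarith [(h ij.1).2, (h ij.2).1]
  · exact (le_abs_self _).trans (abs_ip_le_spread p ψ a b)

theorem IsExtreme.abs_sub_le {p : Fin n → Plane} {ψ : ℝ} {a b : Fin n} (h : IsExtreme p ψ a b)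
    (i : Fin n) : |ip ψ (p i) - ip ψ (p a + p b) / 2| ≤ spread p ψ / 2 := by
  rw [h.spread_eq, ip_sub]
  have : ip ψ (p a + p b) = ip ψ (p a) + ip ψ (p b) := by simp [ip]; ring
  rw [this, abs_le]
  constructor <;> linarith [(h i).1, (h i).2]

/-- The point with given coordinates in the directions `φ - α` and `φ + α`. -/
noncomputable def obliquePoint (v φ A B : ℝ) : Plane :=
  ((A + B) / (2 * Real.cos (criticalAngle v))) • unitDir φ
    + ((B - A) / (2 * Real.sin (criticalAngle v))) • unitDir (φ + Real.pi / 2)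

theorem ip_obliquePoint {v : ℝ} (hv : 1 < v) (φ A B : ℝ) :
    ip (φ - criticalAngle v) (obliquePoint v φ A B) = A ∧
    ip (φ + criticalAngle v) (obliquePoint v φ A B) = B := by
  have hc := (cos_criticalAngle_pos hv).ne'
  have hs := (sin_criticalAngle_pos hv).ne'
  have key : ∀ ψ, ip ψ (obliquePoint v φ A B) =
      (A + B) / (2 * Real.cos (criticalAngle v)) * Real.cos (ψ - φ)
      + (B - A) / (2 * Real.sin (criticalAngle v)) * Real.sin (ψ - φ) := fun ψ => by
    have : ∀ x y, ip ψ (x + y) = ip ψ x + ip ψ y := fun x y => by simp [ip]; ring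
    rw [obliquePoint, this, ip_smul, ip_smul, ip_unitDir, ip_unitDir, ← sub_sub,
      Real.cos_sub_pi_div_two]
  rw [key, key, sub_sub_cancel_left, add_sub_cancel_left, Real.cos_neg, Real.sin_neg]
  constructor <;> field_simp <;> ring

/-- The center lies midway between the two supporting lines of both strips. This explicit center is
also what the program puts out. -/
theorem mem_rhombus_obliquePoint {v : ℝ} (hv : 1 < v) {φ w : ℝ} {p : Fin n → Plane}
    {a b a' b' : Fin n} (h : IsExtreme p (φ - criticalAngle v) a b)
    (h' : IsExtreme p (φ + criticalAngle v) a' b') (hw : spread p (φ - criticalAngle v) ≤ w)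
    (hw' : spread p (φ + criticalAngle v) ≤ w) (i : Fin n) :
    p i ∈ rhombus v φ (obliquePoint v φ (ip (φ - criticalAngle v) (p a + p b) / 2)
      (ip (φ + criticalAngle v) (p a' + p b') / 2)) w := by
  obtain ⟨h1, h2⟩ := ip_obliquePoint hv φ (ip (φ - criticalAngle v) (p a + p b) / 2)
      (ip (φ + criticalAngle v) (p a' + p b') / 2)
  rw [mem_rhombus_iff hv, rhNorm, ip_sub, ip_sub, h1, h2]
  exact max_le ((h.abs_sub_le i).trans (by linarith)) ((h'.abs_sub_le i).trans (by linarith))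

/-- Coordinates in the directions `φ - α` and `φ + α` can be prescribed independently because `0 < α
< π / 2`. So both strips can be centered at once, and the wider one decides. -/
theorem isLeast_rhombusWidth {v : ℝ} (hv : 1 < v) (p : Fin n → Plane) (φ : ℝ) :
    IsLeast {w : ℝ | ∃ c : Plane, ∀ i, p i ∈ rhombus v φ c w}
      (max (spread p (φ - criticalAngle v)) (spread p (φ + criticalAngle v))) := by
  obtain ⟨a, b, h⟩ := exists_isExtreme p (φ - criticalAngle v)
  obtain ⟨a', b', h'⟩ := exists_isExtreme p (φ + criticalAngle v)
  refine ⟨⟨_, mem_rhombus_obliquePoint hv h h' (le_max_left _ _) (le_max_right _ _)⟩, ?_⟩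
  rintro w ⟨c, hc⟩
  have key : ∀ i j, rhNorm v φ (p i - p j) ≤ w := fun i j => by
    have h1 := (mem_rhombus_iff hv).1 (hc i)
    have h2 := (mem_rhombus_iff hv).1 (hc j)
    linarith [rhNorm_sub_le v φ (p i) (p j) c]
  exact max_le
    (ciSup_le fun ij => (le_abs_self _).trans ((le_max_left _ _).trans (key ij.1 ij.2)))
    (ciSup_le fun ij => (le_abs_self _).trans ((le_max_right _ _).trans (key ij.1 ij.2)))

theorem rhombusWidth_eq {v : ℝ} (hv : 1 < v) (p : Fin n → Plane) (φ : ℝ) :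
    rhombusWidth v p φ =
      max (spread p (φ - criticalAngle v)) (spread p (φ + criticalAngle v)) :=
  (isLeast_rhombusWidth hv p φ).csInf_eq

/-- Replaces the infimum and the suprema in `z` by inequalities for single pairs, the form in which
travel times are bounded. -/
theorem envelope_le_iff {v : ℝ} (hv : 1 < v) (p : Fin n → Plane) (φ t : ℝ) :
    envelope v p φ ≤ t ↔
      ∀ i j, rhNorm v φ (p i - p j) ≤ t ∧ pairDist v (p i) (p j) φ ≤ t := by
  rw [envelope, rhombusWidth_eq hv]
  constructor
  · intro h i j
    obtain ⟨h1, h2⟩ := max_le_iff.1 h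
    obtain ⟨h1, h3⟩ := max_le_iff.1 h1
    exact ⟨max_le ((abs_ip_le_spread p _ i j).trans h1) ((abs_ip_le_spread p _ i j).trans h3),
      (le_iSup_fin (fun ij : Fin n × Fin n => pairDist v (p ij.1) (p ij.2) φ) (i, j)).trans h2⟩
  · intro h
    refine max_le (max_le (ciSup_le fun ij => ?_) (ciSup_le fun ij => ?_))
      (ciSup_le fun ij => (h ij.1 ij.2).2)
    · exact (le_abs_self _).trans ((le_max_left _ _).trans (h ij.1 ij.2).1)
    · exact (le_abs_self _).trans ((le_max_right _ _).trans (h ij.1 ij.2).1)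

theorem envelope_le_travelDiam {v : ℝ} (hv : 1 < v) (p : Fin n → Plane)
    {h : AffineSubspace ℝ Plane} {φ : ℝ} (ho : HasOrientation h φ) :
    envelope v p φ ≤ travelDiam v h p := by
  have hh := isHighway_of_hasOrientation ho
  rw [envelope_le_iff hv]
  intro i j
  have := le_iSup_fin (fun ij : Fin n × Fin n => travelTime v h (p ij.1) (p ij.2)) (i, j)
  exact ⟨(rhNorm_le_travelTime hv hh ho _ _).trans this,
    (pairDist_le_travelTime hv hh ho _ _).trans this⟩

theorem travelDiam_le_envelope {v : ℝ} (hv : 1 < v) (p : Fin n → Plane) {φ w : ℝ} {c : Plane}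
    (hw : w ≤ envelope v p φ) (hc : ∀ i, p i ∈ rhombus v φ c w) :
    travelDiam v (lineThrough c (unitDir φ)) p ≤ envelope v p φ :=
  ciSup_le fun ij => (travelTime_le_max hv (hc ij.1) (hc ij.2)).trans
    (max_le hw (((envelope_le_iff hv p φ _).1 le_rfl ij.1 ij.2).2))

theorem isLeast_travelDiam {v : ℝ} (hv : 1 < v) (p : Fin n → Plane) (φ : ℝ) :
    IsLeast {T : ℝ | ∃ h : AffineSubspace ℝ Plane, IsHighway h ∧ HasOrientation h φ ∧
      T = travelDiam v h p} (envelope v p φ) := by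
  obtain ⟨c, hc⟩ := (isLeast_rhombusWidth hv p φ).1
  rw [← rhombusWidth_eq hv] at hc
  have ho := hasOrientation_lineThrough c φ
  refine ⟨⟨_, isHighway_of_hasOrientation ho, ho, le_antisymm (envelope_le_travelDiam hv p ho)
    (travelDiam_le_envelope hv p (le_max_left _ _) hc)⟩, ?_⟩
  rintro T ⟨h, -, ho, rfl⟩
  exact envelope_le_travelDiam hv p ho

theorem envelope_add_pi {v : ℝ} (hv : 1 < v) (p : Fin n → Plane) (φ : ℝ) :
    envelope v p (φ + Real.pi) = envelope v p φ := by
  have key : ∀ t, envelope v p (φ + Real.pi) ≤ t ↔ envelope v p φ ≤ t := fun t => by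
    rw [envelope_le_iff hv, envelope_le_iff hv]
    simp only [pairDist_eq hv, rhNorm, add_sub_right_comm, add_right_comm φ Real.pi, ip_add_pi,
      abs_neg]
  exact le_antisymm ((key _).2 le_rfl) ((key _).1 le_rfl)

theorem exists_hasOrientation {h : AffineSubspace ℝ Plane} (hh : IsHighway h) :
    ∃ φ, HasOrientation h φ := by
  obtain ⟨x, hx, hspan⟩ := finrank_eq_one_iff'.1 hh
  obtain ⟨ψ, hψ⟩ := exists_eq_norm_smul_unitDir (x : Plane)
  have hx0 : ‖(x : Plane)‖ ≠ 0 := by simpa using hx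
  refine ⟨ψ, ?_⟩
  have h1 : h.direction = Submodule.span ℝ {(x : Plane)} := by
    ext y
    rw [Submodule.mem_span_singleton]
    constructor
    · intro hy
      obtain ⟨c, hc⟩ := hspan ⟨y, hy⟩
      exact ⟨c, congrArg Subtype.val hc⟩
    · rintro ⟨c, rfl⟩
      exact Submodule.smul_mem _ _ x.2
  rw [HasOrientation, h1]
  conv_lhs => rw [hψ]
  exact Submodule.span_singleton_smul_eq (IsUnit.mk0 _ hx0) _

theorem envelope_zsmul_pi {v : ℝ} (hv : 1 < v) (p : Fin n → Plane) (φ : ℝ) (k : ℤ) :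
    envelope v p (φ - k • Real.pi) = envelope v p φ :=
  Function.Periodic.sub_zsmul_eq (envelope_add_pi hv p) k

/-- A line on which the travel-time diameter is at most the minimum of the envelope over a period
is an optimal highway. -/
theorem isOptimalHighway_of_isMinOn {v : ℝ} (hv : 1 < v) (p : Fin n → Plane) {φ w : ℝ} {c : Plane}
    (hmin : IsMinOn (envelope v p) (Set.Ico 0 Real.pi) φ) (hw : w ≤ envelope v p φ)
    (hc : ∀ i, p i ∈ rhombus v φ c w) : IsOptimalHighway v p (lineThrough c (unitDir φ)) := by
  refine ⟨isHighway_of_hasOrientation (hasOrientation_lineThrough c φ), fun h' hh' => ?_⟩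
  obtain ⟨ψ, hψ⟩ := exists_hasOrientation hh'
  refine (travelDiam_le_envelope hv p hw hc).trans
    (le_trans ?_ (envelope_le_travelDiam hv p hψ))
  -- The competitor may have any real orientation; by periodicity it is moved to `[0, π)`.
  obtain ⟨k, hk, -⟩ := existsUnique_sub_zsmul_mem_Ico Real.pi_pos ψ 0
  rw [← envelope_zsmul_pi hv p ψ k]
  exact hmin (by simpa using hk)

end Finite

end Highway

/-! ### Continuity of `z`, and the extreme points of the set. -/

namespace Highway

theorem continuous_ip (x : Plane) : Continuous fun ψ => ip ψ x := by
  unfold ip; fun_prop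

theorem rhNorm_le_norm (v φ : ℝ) (x : Plane) : rhNorm v φ x ≤ ‖x‖ :=
  max_le (ip_le_norm _ _) (ip_le_norm _ _)

/-- When a vector makes exactly the angle `α` with the orientation, one of `φ ± α` is its own
direction up to sign. This is why the jumps of `f_{pq}` are invisible in `z`. -/
theorem rhNorm_eq_norm {v φ : ℝ} (hv : 1 < v) {x : Plane}
    (h : |ip φ x| = ‖x‖ * Real.cos (criticalAngle v)) : rhNorm v φ x = ‖x‖ := by
  have hs := sin_criticalAngle_pos hv
  have h1 := norm_sq_eq_ip φ x
  rw [← sq_abs (ip φ x), h] at h1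
  have h2 : |ip (φ + Real.pi / 2) x| = ‖x‖ * Real.sin (criticalAngle v) := by
    rw [← abs_of_nonneg (mul_nonneg (norm_nonneg x) hs.le), ← sq_eq_sq_iff_abs_eq_abs]
    linear_combination (-1) * h1 - ‖x‖ ^ 2 * Real.cos_sq_add_sin_sq (criticalAngle v)
  rw [rhNorm_eq hv, h, h2]
  linear_combination ‖x‖ * Real.cos_sq_add_sin_sq (criticalAngle v)

theorem max_rhNorm_pairDist {v : ℝ} (hv : 1 < v) (a b : Plane) (φ : ℝ) :
    max (rhNorm v φ (a - b)) (pairDist v a b φ) =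
      if |ip φ (a - b)| ≤ ‖a - b‖ * Real.cos (criticalAngle v) then ‖a - b‖
      else rhNorm v φ (a - b) := by
  rw [pairDist_eq hv]
  split_ifs with h1 h2 h2
  · exact max_eq_right (rhNorm_le_norm _ _ _)
  · exact absurd h1.le h2
  · rw [rhNorm_eq_norm hv (le_antisymm h2 (not_lt.1 h1)), max_eq_left (norm_nonneg _)]
  · exact max_eq_left ((abs_nonneg _).trans (le_max_left _ _))

/-- The distance of the pair and `rhNorm` are glued along the angles at which they agree, by
`rhNorm_eq_norm`. -/
theorem continuous_max_rhNorm_pairDist {v : ℝ} (hv : 1 < v) (a b : Plane) :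
    Continuous fun φ => max (rhNorm v φ (a - b)) (pairDist v a b φ) := by
  simp only [max_rhNorm_pairDist hv]
  refine Continuous.if_le continuous_const ?_ (continuous_ip _).abs continuous_const
    fun φ h => (rhNorm_eq_norm hv h).symm
  exact ((continuous_ip _).comp (continuous_id.sub continuous_const)).abs.max
    ((continuous_ip _).comp (continuous_id.add continuous_const)).abs

section Finite

variable {n : ℕ}

theorem continuous_envelope [NeZero n] {v : ℝ} (hv : 1 < v) (p : Fin n → Plane) :
    Continuous (envelope v p) := by
  have h : envelope v p = fun φ => Finset.univ.sup' Finset.univ_nonempty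
      fun ij : Fin n × Fin n =>
        max (rhNorm v φ (p ij.1 - p ij.2)) (pairDist v (p ij.1) (p ij.2) φ) := by
    ext φ
    refine eq_of_forall_ge_iff fun t => ?_
    rw [envelope_le_iff hv, Finset.sup'_le_iff]
    simp [Prod.forall]
  rw [h]
  exact Continuous.finset_sup'_apply _ fun ij _ => continuous_max_rhNorm_pairDist hv _ _

/-! ### Extreme points as functions of the direction -/

/-- The point `p a` is the last one in direction `ψ`, with ties broken by the direction
`ψ + π / 2`. -/
def IsLexMax (p : Fin n → Plane) (ψ : ℝ) (a : Fin n) : Prop :=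
  ∀ k, ip ψ (p k) < ip ψ (p a) ∨
    ip ψ (p k) = ip ψ (p a) ∧ ip (ψ + Real.pi / 2) (p k) ≤ ip (ψ + Real.pi / 2) (p a)

/-- The cross product of two vectors of the plane. -/
def cross (x y : Plane) : ℝ := x 0 * y 1 - x 1 * y 0

theorem cross_eq_ip (ψ : ℝ) (x y : Plane) :
    cross x y = ip ψ x * ip (ψ + Real.pi / 2) y - ip (ψ + Real.pi / 2) x * ip ψ y := by
  simp only [ip, cross, Real.cos_add_pi_div_two, Real.sin_add_pi_div_two]
  linear_combination (-(x 0 * y 1) + x 1 * y 0) * Real.cos_sq_add_sin_sq ψ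

/-- If `p i` is a vertex of the convex hull then no point lies to the right of the line from `p i`
to `p j`. -/
def IsPivot (p : Fin n → Plane) (i j : Fin n) : Prop :=
  j ≠ i ∧ ∀ ψ, (∀ k, k ≠ i → ip ψ (p k - p i) < 0) → ∀ k, 0 ≤ cross (p j - p i) (p k - p i)

/-- The derivative of `ip ψ x` in `ψ` is `ip (ψ + π / 2) x`, so breaking ties by the latter selects
the point that is the strict maximum just after `ψ`. -/
theorem IsLexMax.eventually_lt {p : Fin n → Plane} (hp : Function.Injective p) {ψ : ℝ} {a : Fin n}
    (h : IsLexMax p ψ a) : ∀ᶠ ψ' in 𝓝[>] ψ, ∀ k, k ≠ a → ip ψ' (p k - p a) < 0 := by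
  rw [eventually_all]
  intro k
  by_cases hk : k = a
  · exact Eventually.of_forall fun _ h => absurd hk h
  rcases h k with h1 | ⟨h1, h2⟩
  · have h3 : ip ψ (p k - p a) < 0 := by rw [ip_sub]; linarith
    have := ((continuous_ip (p k - p a)).tendsto ψ).eventually (gt_mem_nhds h3)
    exact (this.filter_mono nhdsWithin_le_nhds).mono fun _ h _ => h
  · have h3 : ip ψ (p k - p a) = 0 := by rw [ip_sub]; linarith
    have h4 : ip (ψ + Real.pi / 2) (p k - p a) < 0 := by
      refine lt_of_le_of_ne (by rw [ip_sub]; linarith) fun h0 => ?_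
      have := norm_sq_eq_ip ψ (p k - p a)
      rw [h3, h0] at this
      exact hk (hp (sub_eq_zero.1 (norm_eq_zero.1 (by simpa using this))))
    have h5 : ∀ᶠ ψ' in 𝓝[>] ψ, ψ' ∈ Ioo ψ (ψ + Real.pi) :=
      Ioo_mem_nhdsGT (by linarith [Real.pi_pos])
    filter_upwards [h5] with ψ' h6 _
    rw [ip_eq_expand ψ, h3, mul_zero, zero_add]
    exact mul_neg_of_pos_of_neg
      (Real.sin_pos_of_pos_of_lt_pi (by linarith [h6.1]) (by linarith [h6.2])) h4

/-- A point stays extreme while the direction turns until it is perpendicular to the edge that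
leads to the pivot of the point. -/
theorem IsLexMax.le_of_mem_Icc {p : Fin n → Plane} (hp : Function.Injective p) {x y : ℝ}
    {a j : Fin n} (h : IsLexMax p x a) (hj : IsPivot p a j) (hxy : y ≤ x + Real.pi)
    (hno : ∀ ψ ∈ Ioo x y, ip ψ (p j - p a) ≠ 0) {ψ : ℝ} (hψ : ψ ∈ Icc x y) (k : Fin n) :
    ip ψ (p k) ≤ ip ψ (p a) := by
  rcases hψ.1.eq_or_lt with rfl | hlt
  · rcases h k with h1 | ⟨h1, -⟩ <;> linarith
  by_contra hc
  have hk : 0 < ip ψ (p k - p a) := by rw [ip_sub]; linarith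
  -- Just after `x` the point `p a` is a strict maximum, so it is a vertex and the defining property
  -- of its pivot becomes available.
  obtain ⟨ψ₁, h1, h2⟩ := ((h.eventually_lt hp).and (Ioo_mem_nhdsGT hlt)).exists
  have hka : k ≠ a := by rintro rfl; simp [ip] at hk
  have hcr := hj.2 ψ₁ h1 k
  have hX := h1 j hj.1
  have hXk := h1 k hka
  have hsin : 0 < Real.sin (ψ - ψ₁) :=
    Real.sin_pos_of_pos_of_lt_pi (by linarith [h2.2]) (by linarith [h2.1, hψ.2])
  rw [cross_eq_ip ψ₁] at hcr
  -- If some `p k` has overtaken `p a`, so has the pivot. With values at `ψ₁` denoted by `X` and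
  -- `Xk`, one has `Xk * ip ψ (p j - p a) = X * ip ψ (p k - p a) - sin (ψ - ψ₁) * cross`, where `X`
  -- and `Xk` are negative and the cross product is nonnegative. By continuity the pivot edge was
  -- then perpendicular to an earlier direction.
  have hj' : 0 < ip ψ (p j - p a) := by
    rw [ip_eq_expand ψ₁] at hk ⊢
    have h3 := mul_neg_of_neg_of_pos hX hk
    have h4 := mul_nonneg hsin.le hcr
    by_contra hc'
    have h5 := mul_nonneg_of_nonpos_of_nonpos hXk.le (not_lt.1 hc')
    nlinarith
  obtain ⟨ψ₀, h6, h7⟩ := intermediate_value_Ioo h2.2.le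
    (continuous_ip (p j - p a)).continuousOn ⟨hX, hj'⟩
  exact hno ψ₀ ⟨h2.1.trans h6.1, h6.2.trans_le hψ.2⟩ h7

/-- The previous lemma is used for `a` at `ψ` and for `b` at `ψ + π`; a half turn does not change
the zeros of `ip`. -/
theorem isExtreme_of_isLexMax {p : Fin n → Plane} (hp : Function.Injective p) {x y : ℝ}
    {a b : Fin n} (ha : IsLexMax p x a) (hb : IsLexMax p (x + Real.pi) b) (hxy : y ≤ x + Real.pi)
    {J : Fin n → Fin n} (hJ : ∀ i, IsPivot p i (J i))
    (hno : ∀ ψ ∈ Ioo x y, ∀ i, ip ψ (p (J i) - p i) ≠ 0) {ψ : ℝ} (hψ : ψ ∈ Icc x y) :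
    IsExtreme p ψ a b := by
  refine fun k => ⟨?_, ha.le_of_mem_Icc hp (hJ a) hxy (fun ψ h => hno ψ h a) hψ k⟩
  have := hb.le_of_mem_Icc hp (hJ b) (y := y + Real.pi) (by linarith)
    (fun ψ h => ?_) (ψ := ψ + Real.pi) ⟨by linarith [hψ.1], by linarith [hψ.2]⟩ k
  · rw [ip_add_pi, ip_add_pi] at this; linarith
  · have := hno (ψ - Real.pi) ⟨by linarith [h.1], by linarith [h.2]⟩ b
    rwa [← neg_ne_zero, ← ip_add_pi, sub_add_cancel] at this

/-! ### The pivots are found by a linear scan -/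

/-- The state of the search for the pivot of `i` after the inspection of the first `m` points. -/
def PivotUpTo (p : Fin n → Plane) (i : Fin n) (m : ℕ) (j : Fin n) : Prop :=
  (j = i ∧ ∀ k : Fin n, (k : ℕ) < m → k = i) ∨
  (j ≠ i ∧ ∀ ψ, (∀ k, k ≠ i → ip ψ (p k - p i) < 0) →
    ∀ k : Fin n, (k : ℕ) < m → 0 ≤ cross (p j - p i) (p k - p i))

theorem PivotUpTo.zero (p : Fin n → Plane) (i : Fin n) : PivotUpTo p i 0 i :=
  Or.inl ⟨rfl, fun _ h => absurd h (Nat.not_lt_zero _)⟩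

theorem PivotUpTo.isPivot {p : Fin n → Plane} (hn : 2 ≤ n) {i j : Fin n}
    (h : PivotUpTo p i n j) : IsPivot p i j := by
  rcases h with ⟨-, h⟩ | ⟨h1, h2⟩
  · have h0 := h ⟨0, by omega⟩ (by simp; omega)
    have h1 := h ⟨1, by omega⟩ (by simp; omega)
    rw [← h1] at h0
    simp at h0
  · exact ⟨h1, fun ψ hψ k => h2 ψ hψ k k.2⟩

/-- Seen from a vertex all other points lie in an open half-plane, where the sign of the cross
product is a transitive order of directions; the scan keeps the clockwise-most one. For other points
no `ψ` is admissible and nothing is claimed. `k = i` is possible only while `j = i`, since otherwise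
the cross product is `0`. -/
theorem PivotUpTo.replace {p : Fin n → Plane} {i j k : Fin n} (h : PivotUpTo p i k j)
    (hc : j = i ∨ cross (p j - p i) (p k - p i) < 0) : PivotUpTo p i (k + 1) k := by
  by_cases hki : k = i
  · refine Or.inl ⟨hki, fun l hl => ?_⟩
    rcases h with ⟨-, h⟩ | ⟨h1, -⟩
    · rcases Nat.lt_succ_iff_lt_or_eq.1 hl with h2 | h2
      · exact h l h2
      · rw [← hki]; exact Fin.ext h2
    · rcases hc with hc | hc
      · exact absurd hc h1
      · rw [hki] at hc; simp [cross] at hc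
  · refine Or.inr ⟨hki, fun ψ hψ l hl => ?_⟩
    rcases Nat.lt_succ_iff_lt_or_eq.1 hl with h2 | h2
    · rcases h with ⟨-, h⟩ | ⟨h1, h3⟩
      · rw [h l h2]; simp [cross]
      · rcases hc with hc | hc
        · exact absurd hc h1
        · have h4 := h3 ψ hψ l h2
          by_cases hli : l = i
          · rw [hli]; simp [cross]
          have hj := hψ j h1
          have hk := hψ k hki
          have hl := hψ l hli
          rw [cross_eq_ip ψ] at hc h4 ⊢
          set X := ip ψ (p j - p i)
          have := mul_nonneg_of_nonpos_of_nonpos hk.le (neg_nonpos.2 h4)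
          have := mul_nonneg_of_nonpos_of_nonpos hl.le hc.le
          by_contra hcon
          have := mul_pos_of_neg_of_neg hj (not_le.1 hcon)
          nlinarith
    · rw [Fin.ext h2]; simp [cross]; linarith

theorem PivotUpTo.keep {p : Fin n → Plane} {i j k : Fin n} (h : PivotUpTo p i k j)
    (hc : j ≠ i ∧ 0 ≤ cross (p j - p i) (p k - p i)) : PivotUpTo p i (k + 1) j := by
  rcases h with ⟨h1, -⟩ | ⟨h1, h3⟩
  · exact absurd h1 hc.1
  · refine Or.inr ⟨h1, fun ψ hψ l hl => ?_⟩
    rcases Nat.lt_succ_iff_lt_or_eq.1 hl with h2 | h2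
    · exact h3 ψ hψ l h2
    · rw [Fin.ext h2]; exact hc.2

end Finite

end Highway

namespace Highway

/-! ### Keys of directions -/

/-- The orientation in `[0, π)` with the key `κ = -cos φ`. -/
noncomputable def keyAngle (κ : ℝ) : ℝ := Real.arccos (-κ)

/-- The key of the orientation of a vector. -/
noncomputable def keyOf (x y : ℝ) : ℝ :=
  if y < 0 then x / √(x * x + y * y) else if 0 < y then -(x / √(x * x + y * y)) else -1

theorem keyAngle_nonneg (κ : ℝ) : 0 ≤ keyAngle κ := Real.arccos_nonneg _

theorem keyAngle_lt_pi {κ : ℝ} (h : κ < 1) : keyAngle κ < Real.pi :=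
  lt_of_le_of_ne (Real.arccos_le_pi _) fun h1 => by
    have := Real.arccos_eq_pi.1 h1; linarith

theorem keyAngle_mem {κ : ℝ} (h : κ < 1) : keyAngle κ ∈ Ico 0 Real.pi :=
  ⟨keyAngle_nonneg κ, keyAngle_lt_pi h⟩

theorem cos_keyAngle {κ : ℝ} (h : κ ∈ Ico (-1) 1) : Real.cos (keyAngle κ) = -κ :=
  Real.cos_arccos (by linarith [h.2]) (by linarith [h.1])

theorem sin_keyAngle (κ : ℝ) : Real.sin (keyAngle κ) = √(1 - κ * κ) := by
  rw [keyAngle, Real.sin_arccos]; congr 1; ring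

theorem keyAngle_neg_cos {φ : ℝ} (h : φ ∈ Ico 0 Real.pi) : keyAngle (-Real.cos φ) = φ := by
  rw [keyAngle, neg_neg, Real.arccos_cos h.1 h.2.le]

theorem neg_cos_mem {φ : ℝ} (h : φ ∈ Ico 0 Real.pi) : -Real.cos φ ∈ Ico (-1 : ℝ) 1 := by
  refine ⟨by linarith [Real.cos_le_one φ], ?_⟩
  have := Real.strictAntiOn_cos (a := φ) (b := Real.pi) ⟨h.1, h.2.le⟩
    ⟨Real.pi_pos.le, le_rfl⟩ h.2
  rw [Real.cos_pi] at this
  linarith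

theorem keyAngle_neg_one : keyAngle (-1) = 0 := by simp [keyAngle]

theorem keyAngle_lt_keyAngle {a b : ℝ} (ha : -1 ≤ a) (hb : b ≤ 1) (h : a < b) :
    keyAngle a < keyAngle b :=
  Real.arccos_lt_arccos (by linarith) (by linarith) (by linarith)

theorem keyAngle_le_keyAngle {a b : ℝ} (h : a ≤ b) : keyAngle a ≤ keyAngle b :=
  Real.arccos_le_arccos (by linarith)

/-- Holds even for the zero vector, which gets the key `-1`. Degenerate vectors thus produce a
superfluous but legal event, and the program needs no test for them. -/
theorem keyOf_mem (x y : ℝ) : keyOf x y ∈ Ico (-1 : ℝ) 1 := by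
  have key : y ≠ 0 → |x| < √(x * x + y * y) := fun hy => by
    apply Real.lt_sqrt_of_sq_lt
    rw [sq_abs]
    have := sq_pos_of_ne_zero hy
    nlinarith
  unfold keyOf
  split_ifs with h1 h2
  · have h3 := key h1.ne
    have h4 : 0 < √(x * x + y * y) := (abs_nonneg x).trans_lt h3
    rw [abs_lt] at h3
    constructor
    · rw [le_div_iff₀ h4]; linarith
    · rw [div_lt_one h4]; linarith
  · have h3 := key h2.ne'
    have h4 : 0 < √(x * x + y * y) := (abs_nonneg x).trans_lt h3
    rw [abs_lt] at h3
    rw [← neg_div]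
    constructor
    · rw [le_div_iff₀ h4]; linarith
    · rw [div_lt_one h4]; linarith
  · constructor <;> norm_num

/-- The vector `(x, y)` is parallel to the direction of its key. -/
theorem keyOf_parallel (x y : ℝ) :
    Real.cos (keyAngle (keyOf x y)) * y = Real.sin (keyAngle (keyOf x y)) * x := by
  rw [cos_keyAngle (keyOf_mem x y), sin_keyAngle]
  have key : y ≠ 0 → ∀ s : ℝ, s * s = 1 →
      √(1 - s * (x / √(x * x + y * y)) * (s * (x / √(x * x + y * y)))) =
        |y| / √(x * x + y * y) := fun hy s hs => by
    have h1 : 0 < x * x + y * y :=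
      add_pos_of_nonneg_of_pos (mul_self_nonneg x) (mul_self_pos.2 hy)
    have h2 := Real.mul_self_sqrt h1.le
    have h3 := Real.sqrt_pos.2 h1
    rw [Real.sqrt_eq_iff_mul_self_eq_of_pos (div_pos (abs_pos.2 hy) h3)]
    set r := √(x * x + y * y)
    field_simp
    linear_combination abs_mul_abs_self y - h2 + x * x * hs
  unfold keyOf
  split_ifs with h1 h2
  · have := key h1.ne 1 (by norm_num)
    rw [one_mul] at this
    rw [this, abs_of_neg h1]; ring
  · have := key h2.ne' (-1) (by norm_num)
    rw [neg_one_mul] at this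
    rw [this, abs_of_pos h2]; ring
  · have : y = 0 := le_antisymm (not_lt.1 h2) (not_lt.1 h1)
    simp [this]

theorem eq_of_sin_sub_eq_zero {φ φ' : ℝ} (h : φ ∈ Ico 0 Real.pi) (h' : φ' ∈ Ico 0 Real.pi)
    (hs : Real.sin (φ - φ') = 0) : φ = φ' := by
  have := (Real.sin_eq_zero_iff_of_lt_of_lt (by linarith [h.1, h'.2])
    (by linarith [h.2, h'.1])).1 hs
  linarith

theorem sin_sub_nonneg {φ φ' : ℝ} (h : φ ∈ Ico 0 Real.pi) (h' : 0 ≤ φ') (hle : φ' ≤ φ) :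
    0 ≤ Real.sin (φ - φ') :=
  Real.sin_nonneg_of_nonneg_of_le_pi (by linarith) (by linarith [h.2])

/-- The only orientation that is parallel to a vector is the one given by its key. -/
theorem eq_keyAngle {x y φ : ℝ} (hxy : x ≠ 0 ∨ y ≠ 0) (hφ : φ ∈ Ico 0 Real.pi)
    (h : Real.cos φ * y = Real.sin φ * x) : φ = keyAngle (keyOf x y) := by
  have h1 := keyOf_parallel x y
  have h2 := keyAngle_mem (keyOf_mem x y).2
  apply eq_of_sin_sub_eq_zero hφ h2
  set ψ := keyAngle (keyOf x y)
  rw [Real.sin_sub]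
  rcases hxy with hx | hy
  · apply mul_right_cancel₀ hx
    linear_combination Real.cos φ * h1 - Real.cos ψ * h
  · apply mul_right_cancel₀ hy
    linear_combination Real.sin φ * h1 - Real.sin ψ * h

/-- The sign of the left side tells whether the directions `φ` and `θ` make an angle of at least
`α`. -/
theorem window_identity (φ θ α : ℝ) :
    Real.cos α ^ 2 - Real.cos (φ - θ) ^ 2 =
      Real.sin (φ - (θ + α)) * Real.sin (φ - (θ - α)) := by
  have e1 : φ - (θ + α) = (φ - θ) - α := by ring
  have e2 : φ - (θ - α) = (φ - θ) + α := by ring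
  rw [e1, e2, Real.sin_sub, Real.sin_add]
  have h1 := Real.cos_sq_add_sin_sq α
  have h2 := Real.cos_sq_add_sin_sq (φ - θ)
  linear_combination Real.cos α ^ 2 * (-h2) + Real.cos (φ - θ) ^ 2 * h1

/-- The orientations with which a vector of orientation `θ` makes an angle of at least `α` form a
window between the orientations `θ + α` and `θ - α`. -/
theorem window_sign {θ α a b : ℝ} (hθ : θ ∈ Ico 0 Real.pi) (hα : 0 < α) (hα' : α < Real.pi / 2)
    (ha : a ∈ Ico 0 Real.pi) (hb : b ∈ Ico 0 Real.pi) (hsa : Real.sin (a - (θ + α)) = 0)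
    (hsb : Real.sin (b - (θ - α)) = 0) :
    (b < a ∧ ∀ φ, Real.cos α ^ 2 - Real.cos (φ - θ) ^ 2 = Real.sin (φ - a) * Real.sin (φ - b)) ∨
    (a < b ∧ ∀ φ, Real.cos α ^ 2 - Real.cos (φ - θ) ^ 2 =
      -(Real.sin (φ - a) * Real.sin (φ - b))) := by
  have hpi := Real.pi_pos
  -- One of `θ - α`, `θ + α` may fall outside `[0, π)`, never both as `α < π / 2`. Shifting it back
  -- by `π` swaps the order of the ends and flips the sign of one sine.
  rcases lt_or_ge θ α with h1 | h1
  · have h2 : a = θ + α := eq_of_sin_sub_eq_zero ha ⟨by linarith [hθ.1], by linarith⟩ hsa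
    have h3 : b = θ - α + Real.pi := eq_of_sin_sub_eq_zero hb
      ⟨by linarith [hθ.1], by linarith⟩ (by rw [← sub_sub, Real.sin_sub_pi, hsb, neg_zero])
    refine Or.inr ⟨by linarith, fun φ => ?_⟩
    rw [window_identity, h2, h3, ← sub_sub φ _ Real.pi, Real.sin_sub_pi]; ring
  · rcases lt_or_ge (θ + α) Real.pi with h4 | h4
    · have h2 : a = θ + α := eq_of_sin_sub_eq_zero ha ⟨by linarith, by linarith⟩ hsa
      have h3 : b = θ - α := eq_of_sin_sub_eq_zero hb ⟨by linarith, by linarith⟩ hsb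
      refine Or.inl ⟨by linarith, fun φ => ?_⟩
      rw [window_identity, h2, h3]
    · have h2 : a = θ + α - Real.pi := eq_of_sin_sub_eq_zero ha
        ⟨by linarith, by linarith [hθ.2]⟩
        (by rw [← sub_add, Real.sin_add_pi, hsa, neg_zero])
      have h3 : b = θ - α := eq_of_sin_sub_eq_zero hb ⟨by linarith, by linarith [hθ.2]⟩ hsb
      refine Or.inr ⟨by linarith [hθ.2], fun φ => ?_⟩
      rw [window_identity, h2, h3, ← sub_add φ _ Real.pi, Real.sin_add_pi]; ring

theorem exists_eq_smul_unitDir_mem (x : Plane) :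
    ∃ r : ℝ, ∃ θ ∈ Ico 0 Real.pi, x = r • unitDir θ ∧ r ^ 2 = ‖x‖ ^ 2 := by
  have h := keyOf_parallel (x 0) (x 1)
  set θ := keyAngle (keyOf (x 0) (x 1))
  have h0 : ip (θ + Real.pi / 2) x = 0 := by
    rw [ip, Real.cos_add_pi_div_two, Real.sin_add_pi_div_two]; linarith
  refine ⟨ip θ x, θ, keyAngle_mem (keyOf_mem _ _).2, eq_smul_unitDir_of_ip_eq_zero h0, ?_⟩
  rw [norm_sq_eq_ip θ x, h0]; ring

/-- The step function of a pair of points: the value `L` on the window that starts at the key `a`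
and ends at the key `b`, and which contains the key `1` of the orientation `π` if `b ≤ a`. -/
noncomputable def windowVal (L a b κ : ℝ) : ℝ :=
  if a < b then (if κ < a then 0 else if κ < b then L else 0)
  else (if κ < b then L else if κ < a then 0 else L)

/-- `a` and `b` are the keys of `p - q` turned by `α` and `-α`, the ends of the window. The step
function need not agree with `f_{pq}` at these ends: there `f_{pq}` is `0` and `rhNorm` is `‖p -
q‖`, so either value satisfies both bounds, and `z` does not change. -/
theorem windowVal_spec {v : ℝ} (hv : 1 < v) {p q : Plane} (hpq : p ≠ q) {φ : ℝ}
    (hφ : φ ∈ Ico 0 Real.pi) {a b : ℝ}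
    (ha : a = keyOf
      (Real.cos (criticalAngle v) * (p - q) 0 - Real.sin (criticalAngle v) * (p - q) 1)
      (Real.sin (criticalAngle v) * (p - q) 0 + Real.cos (criticalAngle v) * (p - q) 1))
    (hb : b = keyOf
      (Real.cos (criticalAngle v) * (p - q) 0 + Real.sin (criticalAngle v) * (p - q) 1)
      (-(Real.sin (criticalAngle v) * (p - q) 0) + Real.cos (criticalAngle v) * (p - q) 1)) :
    pairDist v p q φ ≤ windowVal ‖p - q‖ a b (-Real.cos φ) ∧
    windowVal ‖p - q‖ a b (-Real.cos φ) ≤ max (rhNorm v φ (p - q)) (pairDist v p q φ) := by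
  have hc0 := cos_criticalAngle_pos hv
  set α := criticalAngle v
  obtain ⟨r, θ, hθ, hx, hr⟩ := exists_eq_smul_unitDir_mem (p - q)
  have hnorm : 0 < ‖p - q‖ := norm_pos_iff.2 (sub_ne_zero.2 hpq)
  have hr0 : r ≠ 0 := by rintro rfl; nlinarith
  have hx0 : (p - q) 0 = r * Real.cos θ := by rw [hx]; simp [unitDir]
  have hx1 : (p - q) 1 = r * Real.sin θ := by rw [hx]; simp [unitDir]
  have hip : ip φ (p - q) = r * Real.cos (φ - θ) := by
    conv_lhs => rw [hx]
    rw [ip_smul, ip_unitDir]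
  have hma : a ∈ Ico (-1 : ℝ) 1 := ha ▸ keyOf_mem _ _
  have hmb : b ∈ Ico (-1 : ℝ) 1 := hb ▸ keyOf_mem _ _
  have hA := keyAngle_mem hma.2
  have hB := keyAngle_mem hmb.2
  have hpa := keyOf_parallel (Real.cos α * (p - q) 0 - Real.sin α * (p - q) 1)
    (Real.sin α * (p - q) 0 + Real.cos α * (p - q) 1)
  have hpb := keyOf_parallel (Real.cos α * (p - q) 0 + Real.sin α * (p - q) 1)
    (-(Real.sin α * (p - q) 0) + Real.cos α * (p - q) 1)
  rw [← ha, hx0, hx1] at hpa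
  rw [← hb, hx0, hx1] at hpb
  have hsa : Real.sin (keyAngle a - (θ + α)) = 0 := by
    apply (mul_eq_zero.1 (_ : r * _ = 0)).resolve_left hr0
    rw [Real.sin_sub, Real.cos_add, Real.sin_add]; linear_combination -hpa
  have hsb : Real.sin (keyAngle b - (θ - α)) = 0 := by
    apply (mul_eq_zero.1 (_ : r * _ = 0)).resolve_left hr0
    rw [Real.sin_sub, Real.cos_sub, Real.sin_sub]; linear_combination -hpb
  have hlt_iff : ∀ {x y : ℝ}, x ∈ Ico (-1 : ℝ) 1 → y ∈ Ico (-1 : ℝ) 1 →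
      (x < y ↔ keyAngle x < keyAngle y) := fun {x y} hx hy =>
    ⟨fun h => keyAngle_lt_keyAngle hx.1 hy.2.le h, fun h => by
      by_contra hc; exact absurd (keyAngle_le_keyAngle (not_lt.1 hc)) (not_le.2 h)⟩
  have hk := neg_cos_mem hφ
  have hka := hlt_iff hk hma
  have hkb := hlt_iff hk hmb
  have hab := hlt_iff hma hmb
  rw [keyAngle_neg_cos hφ] at hka hkb
  -- the two cases of the sign
  have hin : 0 ≤ Real.cos α ^ 2 - Real.cos (φ - θ) ^ 2 →
      pairDist v p q φ ≤ ‖p - q‖ ∧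
        ‖p - q‖ ≤ max (rhNorm v φ (p - q)) (pairDist v p q φ) := fun h => by
    rw [max_rhNorm_pairDist hv, if_pos, pairDist_eq hv]
    · exact ⟨by split_ifs <;> linarith, le_rfl⟩
    · apply abs_le_of_sq_le_sq _ (by positivity)
      rw [hip, mul_pow, mul_pow, hr]
      exact mul_le_mul_of_nonneg_left (by linarith) (sq_nonneg _)
  have hout : Real.cos α ^ 2 - Real.cos (φ - θ) ^ 2 ≤ 0 →
      pairDist v p q φ ≤ 0 ∧ (0 : ℝ) ≤ max (rhNorm v φ (p - q)) (pairDist v p q φ) := fun h => by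
    refine ⟨?_, le_max_of_le_left ((abs_nonneg _).trans (le_max_left _ _))⟩
    rw [pairDist_eq hv, if_neg]
    rw [not_lt]
    apply le_of_sq_le_sq _ (abs_nonneg _)
    rw [sq_abs, hip, mul_pow, mul_pow, hr]
    exact mul_le_mul_of_nonneg_left (by linarith) (sq_nonneg _)
  have hs1 : ∀ c ∈ Ico 0 Real.pi, ¬ φ < c → 0 ≤ Real.sin (φ - c) := fun c hc h =>
    sin_sub_nonneg hφ hc.1 (not_lt.1 h)
  have hs2 : ∀ c ∈ Ico 0 Real.pi, φ < c → Real.sin (φ - c) ≤ 0 := fun c hc h => by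
    rw [← neg_sub, Real.sin_neg]
    linarith [sin_sub_nonneg hc hφ.1 h.le]
  have hα' := criticalAngle_lt hv
  unfold windowVal
  rcases window_sign hθ (criticalAngle_pos hv) hα' hA hB hsa hsb with ⟨hlt, hG⟩ | ⟨hlt, hG⟩
  · rw [if_neg (fun h => absurd (hab.1 h) hlt.not_gt)]
    split_ifs with h1 h2
    · rw [hkb] at h1
      apply hin
      rw [hG]
      exact mul_nonneg_of_nonpos_of_nonpos (hs2 _ hA (h1.trans hlt)) (hs2 _ hB h1)
    · rw [hkb] at h1
      rw [hka] at h2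
      apply hout
      rw [hG]
      exact mul_nonpos_of_nonpos_of_nonneg (hs2 _ hA h2) (hs1 _ hB h1)
    · rw [hkb] at h1
      rw [hka] at h2
      apply hin
      rw [hG]
      exact mul_nonneg (hs1 _ hA h2) (hs1 _ hB h1)
  · rw [if_pos (hab.2 hlt)]
    split_ifs with h1 h2
    · rw [hka] at h1
      apply hout
      rw [hG, neg_nonpos]
      exact mul_nonneg_of_nonpos_of_nonpos (hs2 _ hA h1) (hs2 _ hB (h1.trans hlt))
    · rw [hka] at h1
      rw [hkb] at h2
      apply hin
      rw [hG, neg_nonneg]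
      exact mul_nonpos_of_nonneg_of_nonpos (hs1 _ hA h1) (hs2 _ hB h2)
    · rw [hka] at h1
      rw [hkb] at h2
      apply hout
      rw [hG, neg_nonpos]
      exact mul_nonneg (hs1 _ hA h1) (hs1 _ hB h2)

end Highway

/-! ### Slot tables and event lists: `z` attains its minimum at an event. -/

namespace Highway

variable {n : ℕ}

/-- A table of orientations, given by their keys `κ t`, such that the extreme points in the
directions `φ - α` and `φ + α` do not change between these orientations. The vectors `D t` and
`D' t` connect the extreme points for the orientations that follow `κ t`, and `c t` is the key of
the orientation in which the two widths of these vectors agree. -/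
structure IsSlotTable (v : ℝ) (p : Fin n → Plane) (m : ℕ) (κ c : ℕ → ℝ) (D D' : ℕ → Plane) :
    Prop where
  pos : 0 < m
  key_zero : κ 0 = -1
  key_mem : ∀ t < m, κ t ∈ Ico (-1 : ℝ) 1
  left : ∀ t < m, ∃ a b, D t = p a - p b ∧ IsLexMax p (keyAngle (κ t) - criticalAngle v) a ∧
    IsLexMax p (keyAngle (κ t) - criticalAngle v + Real.pi) b
  right : ∀ t < m, ∃ a b, D' t = p a - p b ∧ IsLexMax p (keyAngle (κ t) + criticalAngle v) a ∧
    IsLexMax p (keyAngle (κ t) + criticalAngle v + Real.pi) b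
  crossing : ∀ t < m, ∀ φ ∈ Ico 0 Real.pi,
    ip (φ - criticalAngle v) (D t) = ip (φ + criticalAngle v) (D' t) → φ = keyAngle (c t) ∨
      ∀ ψ, ip (ψ - criticalAngle v) (D t) = ip (ψ + criticalAngle v) (D' t)
  complete : ∃ J : Fin n → Fin n, (∀ i, IsPivot p i (J i)) ∧ ∀ φ ∈ Ico 0 Real.pi, ∀ i,
    (ip (φ - criticalAngle v) (p (J i) - p i) = 0 ∨ ip (φ + criticalAngle v) (p (J i) - p i) = 0) →
      ∃ t < m, φ = keyAngle (κ t)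

/-- A sorted list of keys `K k` with the values `V k` of the step function `G`, which contains the
keys and the crossings of a slot table. -/
structure IsEventList (M : ℕ) (K V : ℕ → ℝ) (T : ℕ → ℕ) (m : ℕ) (κ c : ℕ → ℝ) (G : ℝ → ℝ) :
    Prop where
  sorted : ∀ i j, i ≤ j → j < M → K i ≤ K j
  mem : ∀ k < M, K k ∈ Ico (-1 : ℝ) 1
  step : ∀ k < M, ∀ x, K k ≤ x → (k + 1 < M → x < K (k + 1)) → V k = G x
  slots : ∀ t < m, ∃ k < M, K k = κ t ∧ T k = t
  crossings : ∀ t < m, ∃ k < M, K k = c t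
  tags : ∀ k < M, T k ≠ 0 → T k < m ∧ K k = κ (T k)

/-- The value at orientation `φ` of the upper envelope of a constant and the two widths of a
slot. -/
noncomputable def slotVal (v : ℝ) (D D' : ℕ → Plane) (t : ℕ) (x φ : ℝ) : ℝ :=
  max x (max (ip (φ - criticalAngle v) (D t)) (ip (φ + criticalAngle v) (D' t)))

section

variable [NeZero n] {v : ℝ} (hv : 1 < v) {p : Fin n → Plane} (hp : Function.Injective p)
  {m : ℕ} {κ c : ℕ → ℝ} {D D' : ℕ → Plane}

-- By `complete`, between `κ t` and `y` no pivot edge is perpendicular to `φ - α` or `φ + α`, so the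
-- extreme pairs recorded at `κ t` stay extreme, both ends included.
include hp in
theorem IsSlotTable.spread_eq (hS : IsSlotTable v p m κ c D D') {t : ℕ} (ht : t < m) {y : ℝ}
    (hy : y ≤ Real.pi) (hno : ∀ t' < m, keyAngle (κ t') ∉ Ioo (keyAngle (κ t)) y) {φ : ℝ}
    (hφ : φ ∈ Icc (keyAngle (κ t)) y) :
    spread p (φ - criticalAngle v) = ip (φ - criticalAngle v) (D t) ∧
    spread p (φ + criticalAngle v) = ip (φ + criticalAngle v) (D' t) := by
  obtain ⟨J, hJ, hcomp⟩ := hS.complete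
  have h0 := keyAngle_nonneg (κ t)
  constructor
  · obtain ⟨a, b, h1, h2, h3⟩ := hS.left t ht
    rw [h1]
    apply IsExtreme.spread_eq
    refine isExtreme_of_isLexMax hp h2 h3 (y := y - criticalAngle v) (by linarith) hJ
      (fun ψ hψ i hi => ?_) ⟨by linarith [hφ.1], by linarith [hφ.2]⟩
    obtain ⟨t', ht', h4⟩ := hcomp (ψ + criticalAngle v)
      ⟨by linarith [hψ.1], by linarith [hψ.2]⟩ i (Or.inl (by rwa [add_sub_cancel_right]))
    exact hno t' ht' ⟨by linarith [hψ.1], by linarith [hψ.2]⟩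
  · obtain ⟨a, b, h1, h2, h3⟩ := hS.right t ht
    rw [h1]
    apply IsExtreme.spread_eq
    refine isExtreme_of_isLexMax hp h2 h3 (y := y + criticalAngle v) (by linarith) hJ
      (fun ψ hψ i hi => ?_) ⟨by linarith [hφ.1], by linarith [hφ.2]⟩
    obtain ⟨t', ht', h4⟩ := hcomp (ψ - criticalAngle v)
      ⟨by linarith [hψ.1], by linarith [hψ.2]⟩ i (Or.inr (by rwa [sub_add_cancel]))
    exact hno t' ht' ⟨by linarith [hψ.1], by linarith [hψ.2]⟩

variable {M : ℕ} {K V : ℕ → ℝ} {T : ℕ → ℕ} {G : ℝ → ℝ}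

include hv hp in
/-- The value that is computed at the last event of a group of equal keys is the value of the
envelope. -/
theorem IsEventList.slotVal_eq (hS : IsSlotTable v p m κ c D D')
    (hE : IsEventList M K V T m κ c G)
    (hG : ∀ φ ∈ Ico 0 Real.pi, envelope v p φ = max (rhombusWidth v p φ) (G (-Real.cos φ)))
    {k t : ℕ} (hk : k < M) (hlast : k + 1 < M → K k < K (k + 1)) (ht : t < m) (htk : κ t ≤ K k)
    (hno : ∀ t' < m, κ t' ≤ κ t ∨ K k ≤ κ t') :
    slotVal v D D' t (V k) (keyAngle (K k)) = envelope v p (keyAngle (K k)) := by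
  have hmem := keyAngle_mem (hE.mem k hk).2
  -- Slots whose key equals `K k` do no harm, since the old extreme pairs are still extreme at the
  -- closed end of their interval.
  obtain ⟨h1, h2⟩ := hS.spread_eq hp ht hmem.2.le (fun t' ht' hc => by
    rcases hno t' ht' with h | h
    · exact absurd (keyAngle_le_keyAngle h) (not_le.2 hc.1)
    · exact absurd (keyAngle_le_keyAngle h) (not_le.2 hc.2)) ⟨keyAngle_le_keyAngle htk, le_rfl⟩
  rw [slotVal, hG _ hmem, rhombusWidth_eq hv, h1, h2, cos_keyAngle (hE.mem k hk), neg_neg,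
    hE.step k hk _ le_rfl hlast, max_comm]

theorem exists_last_le {j : ℕ} (hj : j < M) {x : ℝ}
    (hx : K j ≤ x) :
    ∃ k < M, j ≤ k ∧ K k ≤ x ∧ (k + 1 < M → x < K (k + 1)) := by
  classical
  have hne : ((Finset.range M).filter fun k => K k ≤ x).Nonempty :=
    ⟨j, by simp [hj, hx]⟩
  obtain ⟨k, hk, hmax⟩ := Finset.exists_max_image _ id hne
  simp only [Finset.mem_filter, Finset.mem_range, id] at hk hmax
  refine ⟨k, hk.1, hmax j ⟨hj, hx⟩, hk.2, fun h => ?_⟩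
  by_contra hc
  have := hmax (k + 1) ⟨h, not_lt.1 hc⟩
  omega

/-- If a nonnegative width is not smaller at `φ` than at both ends of an interval around `φ`, then
it is constant; in any case it is not larger at one of the ends. -/
theorem ip_le_or_ip_le {x : Plane} {β φ₁ φ φ₂ : ℝ} (h1 : φ₁ ≤ φ) (h2 : φ ≤ φ₂)
    (h3 : φ₂ ≤ φ₁ + Real.pi) (hnn : 0 ≤ ip (φ + β) x) :
    ip (φ₁ + β) x ≤ ip (φ + β) x ∨ ip (φ₂ + β) x ≤ ip (φ + β) x := by
  rw [ip_eq_expand (φ + β) (φ₁ + β), ip_eq_expand (φ + β) (φ₂ + β), add_sub_add_right_eq_sub,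
    add_sub_add_right_eq_sub, ← neg_sub φ φ₁, Real.cos_neg, Real.sin_neg]
  have hc1 := mul_le_mul_of_nonneg_right (Real.cos_le_one (φ - φ₁)) hnn
  have hc2 := mul_le_mul_of_nonneg_right (Real.cos_le_one (φ₂ - φ)) hnn
  have hs1 : 0 ≤ Real.sin (φ - φ₁) :=
    Real.sin_nonneg_of_nonneg_of_le_pi (by linarith) (by linarith)
  have hs2 : 0 ≤ Real.sin (φ₂ - φ) :=
    Real.sin_nonneg_of_nonneg_of_le_pi (by linarith) (by linarith)
  -- The sign of the derivative at `φ` selects the end: towards it the tangential term does not help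
  -- and the cosine only shrinks the value.
  rcases le_total 0 (ip (φ + β + Real.pi / 2) x) with h | h
  · left; nlinarith [mul_nonneg hs1 h]
  · right; nlinarith [mul_nonneg hs2 (neg_nonneg.2 h)]

/-- If two continuous functions do not meet on an open interval unless they are equal, then their
order is the same on the closed interval. -/
theorem le_of_no_crossing {f g : ℝ → ℝ} (hf : Continuous f) (hg : Continuous g) {a b φ : ℝ}
    (hφ : φ ∈ Ioo a b) (hle : g φ ≤ f φ)
    (hno : ∀ ψ ∈ Ioo a b, f ψ = g ψ → ∀ ψ, f ψ = g ψ) : g a ≤ f a ∧ g b ≤ f b := by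
  by_cases heq : f φ = g φ
  · exact ⟨(hno φ hφ heq a).ge, (hno φ hφ heq b).ge⟩
  have hpos : 0 < f φ - g φ := sub_pos.2 (lt_of_le_of_ne hle (Ne.symm heq))
  constructor
  · by_contra hc
    have hneg : f a - g a < 0 := by linarith
    obtain ⟨ψ, h1, h2⟩ := intermediate_value_Ioo hφ.1.le (hf.sub hg).continuousOn ⟨hneg, hpos⟩
    exact heq (hno ψ ⟨h1.1, h1.2.trans hφ.2⟩ (sub_eq_zero.1 h2) φ)
  · by_contra hc
    have hneg : f b - g b < 0 := by linarith
    obtain ⟨ψ, h1, h2⟩ := intermediate_value_Ioo' hφ.2.le (hf.sub hg).continuousOn ⟨hneg, hpos⟩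
    exact heq (hno ψ ⟨hφ.1.trans h1.1, h1.2⟩ (sub_eq_zero.1 h2) φ)

include hv hp in
/-- The minimum of the envelope is attained at an event. -/
theorem IsEventList.exists_envelope_le (hS : IsSlotTable v p m κ c D D')
    (hE : IsEventList M K V T m κ c G)
    (hG : ∀ φ ∈ Ico 0 Real.pi, envelope v p φ = max (rhombusWidth v p φ) (G (-Real.cos φ)))
    {φ : ℝ} (hφ : φ ∈ Ico 0 Real.pi) :
    ∃ k < M, (k + 1 < M → K k < K (k + 1)) ∧ envelope v p (keyAngle (K k)) ≤ envelope v p φ := by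
  -- every event has a representative that is the last one of its group
  have hrep : ∀ j < M, ∃ k < M, K k = K j ∧ (k + 1 < M → K k < K (k + 1)) := fun j hj => by
    obtain ⟨k, hk, hjk, h1, h2⟩ := exists_last_le hj le_rfl
    have h3 : K k = K j := le_antisymm h1 (hE.sorted j k hjk hk)
    exact ⟨k, hk, h3, fun h => h3 ▸ h2 h⟩
  obtain ⟨j₀, hj₀, hK₀, -⟩ := hE.slots 0 hS.pos
  rw [hS.key_zero] at hK₀
  have hx := neg_cos_mem hφ
  obtain ⟨k, hk, -, hkx, hklast⟩ := exists_last_le hj₀ (hK₀.le.trans hx.1)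
  have hklast' : k + 1 < M → K k < K (k + 1) := fun h => hkx.trans_lt (hklast h)
  rcases hkx.eq_or_lt with heq | hlt
  · exact ⟨k, hk, hklast', by rw [heq, keyAngle_neg_cos hφ]⟩
  -- the slot that is valid after the event `k`
  obtain ⟨t, ht, htk, htmax⟩ : ∃ t < m, κ t ≤ K k ∧ ∀ t' < m, κ t' ≤ K k → κ t' ≤ κ t := by
    classical
    have hne : ((Finset.range m).filter fun t => κ t ≤ K k).Nonempty :=
      ⟨0, by simp [hS.pos, hS.key_zero, (hE.mem k hk).1]⟩
    obtain ⟨t, ht, hmax⟩ := Finset.exists_max_image _ κ hne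
    simp only [Finset.mem_filter, Finset.mem_range] at ht hmax
    exact ⟨t, ht.1, ht.2, fun t' h1 h2 => hmax t' ⟨h1, h2⟩⟩
  -- the end of the interval
  obtain ⟨y, hyπ, hφy, hynext, hyend⟩ : ∃ y ≤ Real.pi, φ < y ∧
      (∀ j < M, K j ≤ K k ∨ y ≤ keyAngle (K j)) ∧
      ∃ j < M, envelope v p (keyAngle (K j)) = envelope v p y := by
    by_cases hkM : k + 1 < M
    · refine ⟨keyAngle (K (k + 1)), Real.arccos_le_pi _, ?_, fun j hj => ?_, k + 1, hkM, rfl⟩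
      · have := keyAngle_lt_keyAngle hx.1 (hE.mem _ hkM).2.le (hklast hkM)
        rwa [keyAngle_neg_cos hφ] at this
      · rcases le_or_gt j k with h | h
        · exact Or.inl (hE.sorted j k h hk)
        · exact Or.inr (keyAngle_le_keyAngle (hE.sorted _ _ h hj))
    -- After the last event the interval extends to `π`, where `z` has the same value as at the
    -- event of key `-1`, that is, at orientation `0`.
    · refine ⟨Real.pi, le_rfl, hφ.2, fun j hj => Or.inl (hE.sorted j k (by omega) hk), j₀, hj₀, ?_⟩
      rw [hK₀, keyAngle_neg_one, ← zero_add Real.pi, envelope_add_pi hv]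
  have hKφ : keyAngle (K k) < φ := by
    have := keyAngle_lt_keyAngle (hE.mem k hk).1 hx.2.le hlt
    rwa [keyAngle_neg_cos hφ] at this
  have hκφ : keyAngle (κ t) ≤ keyAngle (K k) := keyAngle_le_keyAngle htk
  have hspread : ∀ ψ ∈ Icc (keyAngle (K k)) y,
      spread p (ψ - criticalAngle v) = ip (ψ - criticalAngle v) (D t) ∧
      spread p (ψ + criticalAngle v) = ip (ψ + criticalAngle v) (D' t) := fun ψ hψ => by
    refine hS.spread_eq hp ht hyπ (fun t' ht' hc => ?_) ⟨hκφ.trans hψ.1, hψ.2⟩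
    obtain ⟨j, hj, hKj, -⟩ := hE.slots t' ht'
    rcases hynext j hj with h | h
    · exact absurd (keyAngle_le_keyAngle (htmax t' ht' (hKj ▸ h))) (not_le.2 hc.1)
    · exact absurd (hKj ▸ h) (not_le.2 hc.2)
  have hval : ∀ ψ ∈ Ico (keyAngle (K k)) y,
      envelope v p ψ = slotVal v D D' t (V k) ψ := fun ψ hψ => by
    have hψ' : ψ ∈ Ico 0 Real.pi := ⟨(keyAngle_nonneg _).trans hψ.1, hψ.2.trans_le hyπ⟩
    obtain ⟨h1, h2⟩ := hspread ψ ⟨hψ.1, hψ.2.le⟩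
    have hψk := neg_cos_mem hψ'
    rw [hG ψ hψ', rhombusWidth_eq hv, h1, h2, slotVal, max_comm, hE.step k hk (-Real.cos ψ)]
    · by_contra hc
      have := keyAngle_lt_keyAngle hψk.1 (hE.mem k hk).2.le (not_le.1 hc)
      rw [keyAngle_neg_cos hψ'] at this
      exact absurd hψ.1 (not_le.2 this)
    · intro hkM
      by_contra hc
      have h3 := keyAngle_le_keyAngle (not_lt.1 hc)
      rw [keyAngle_neg_cos hψ'] at h3
      rcases hynext (k + 1) hkM with h | h
      · exact absurd (hklast' hkM) (not_lt.2 h)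
      · exact absurd hψ.2 (not_lt.2 (h.trans h3))
  have hc1 : Continuous fun ψ => ip (ψ - criticalAngle v) (D t) :=
    (continuous_ip _).comp (continuous_id.sub continuous_const)
  have hc2 : Continuous fun ψ => ip (ψ + criticalAngle v) (D' t) :=
    (continuous_ip _).comp (continuous_id.add continuous_const)
  -- At `y` the step function may already have jumped, so the formula for `z` is carried there from
  -- the left by continuity of `z`.
  have hvaly : envelope v p y = slotVal v D D' t (V k) y := by
    have h1 : Tendsto (envelope v p) (𝓝[<] y) (𝓝 (envelope v p y)) :=
      (continuous_envelope hv p).continuousWithinAt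
    have h2 : Tendsto (slotVal v D D' t (V k)) (𝓝[<] y) (𝓝 (slotVal v D D' t (V k) y)) :=
      (continuous_const.max (hc1.max hc2)).continuousWithinAt
    refine tendsto_nhds_unique h1 (h2.congr' ?_)
    filter_upwards [Ioo_mem_nhdsLT (hKφ.trans hφy)] with ψ hψ
    exact (hval ψ ⟨hψ.1.le, hψ.2⟩).symm
  have hnocr : ∀ ψ ∈ Ioo (keyAngle (K k)) y,
      ip (ψ - criticalAngle v) (D t) = ip (ψ + criticalAngle v) (D' t) →
      ∀ ψ, ip (ψ - criticalAngle v) (D t) = ip (ψ + criticalAngle v) (D' t) := fun ψ hψ h => by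
    rcases hS.crossing t ht ψ ⟨(keyAngle_nonneg _).trans hψ.1.le, hψ.2.trans_le hyπ⟩ h with h1 | h1
    · obtain ⟨j, hj, hKj⟩ := hE.crossings t ht
      rw [← hKj] at h1
      rcases hynext j hj with h2 | h2
      · exact absurd (keyAngle_le_keyAngle h2) (not_le.2 (h1 ▸ hψ.1))
      · exact absurd (h1 ▸ hψ.2) (not_lt.2 h2)
    · exact h1
  have hφI : φ ∈ Ioo (keyAngle (K k)) y := ⟨hKφ, hφy⟩
  obtain ⟨hs1, hs2⟩ := hspread φ ⟨hKφ.le, hφy.le⟩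
  have hnn : ∀ ψ, 0 ≤ spread p ψ := fun ψ => (abs_nonneg _).trans (abs_ip_le_spread p ψ 0 0)
  have hlen : y ≤ keyAngle (K k) + Real.pi := by linarith [keyAngle_nonneg (K k)]
  -- one of the ends of the interval is as good as `φ`
  have hends : slotVal v D D' t (V k) (keyAngle (K k)) ≤ slotVal v D D' t (V k) φ ∨
      slotVal v D D' t (V k) y ≤ slotVal v D D' t (V k) φ := by
    simp only [slotVal]
    -- Since the widths do not cross inside, the one that is larger at `φ` is larger at both ends as
    -- well, and the maximum is governed by a single sinusoid.
    rcases le_total (ip (φ + criticalAngle v) (D' t)) (ip (φ - criticalAngle v) (D t)) with h | h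
    · obtain ⟨h1, h2⟩ := le_of_no_crossing hc1 hc2 hφI h hnocr
      rw [max_eq_left h, max_eq_left h1, max_eq_left h2]
      rcases ip_le_or_ip_le (x := D t) (β := -criticalAngle v) hKφ.le hφy.le hlen
        (by rw [← sub_eq_add_neg, ← hs1]; exact hnn _) with h3 | h3
      · exact Or.inl (max_le_max le_rfl (by simpa only [← sub_eq_add_neg] using h3))
      · exact Or.inr (max_le_max le_rfl (by simpa only [← sub_eq_add_neg] using h3))
    · obtain ⟨h1, h2⟩ := le_of_no_crossing hc2 hc1 hφI h
        (fun ψ hψ h ψ' => (hnocr ψ hψ h.symm ψ').symm)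
      rw [max_eq_right h, max_eq_right h1, max_eq_right h2]
      rcases ip_le_or_ip_le (x := D' t) (β := criticalAngle v) hKφ.le hφy.le hlen
        (by rw [← hs2]; exact hnn _) with h3 | h3
      · exact Or.inl (max_le_max le_rfl h3)
      · exact Or.inr (max_le_max le_rfl h3)
  rw [← hval φ ⟨hKφ.le, hφy⟩] at hends
  rcases hends with h | h
  · rw [← hval _ ⟨le_rfl, hKφ.trans hφy⟩] at h
    exact ⟨k, hk, hklast', h⟩
  · obtain ⟨j, hj, hje⟩ := hyend
    obtain ⟨k', hk', hKk', hlast'⟩ := hrep j hj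
    exact ⟨k', hk', hlast', by rw [hKk', hje, hvaly]; exact h⟩

end

end Highway

/-! ### A program logic for the real RAM: running times, frames, loops. -/

namespace RealRAM

/-- The program `P`, started in the state `s`, halts after at most `c` steps in a state that
satisfies `Q`. -/
def Runs (P : Prog) (s : State) (c : ℕ) (Q : State → Prop) : Prop :=
  ∃ t s', Exec P s t s' ∧ t ≤ c ∧ Q s'

theorem Runs.mono {P : Prog} {s : State} {c c' : ℕ} {Q Q' : State → Prop} (h : Runs P s c Q)
    (hc : c ≤ c') (hQ : ∀ s', Q s' → Q' s') : Runs P s c' Q' := by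
  obtain ⟨t, s', h1, h2, h3⟩ := h
  exact ⟨t, s', h1, h2.trans hc, hQ s' h3⟩

theorem Runs.seq {P P' : Prog} {s : State} {c c' : ℕ} {Q Q' : State → Prop} (h : Runs P s c Q)
    (h' : ∀ s', Q s' → Runs P' s' c' Q') : Runs (.seq P P') s (c + c') Q' := by
  obtain ⟨t, s', h1, h2, h3⟩ := h
  obtain ⟨t', s'', h4, h5, h6⟩ := h' s' h3
  exact ⟨_, s'', .seq h1 h4, by omega, h6⟩

/-! ### Frames -/

/-- The arrays of natural numbers to which a program writes. -/
def Prog.natWrites : Prog → List ℕ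
  | .nop => []
  | .setNat A _ _ => [A]
  | .setReal _ _ _ => []
  | .seq P Q => P.natWrites ++ Q.natWrites
  | .branch _ P Q => P.natWrites ++ Q.natWrites
  | .loop _ P => P.natWrites

/-- The arrays of real numbers to which a program writes. -/
def Prog.realWrites : Prog → List ℕ
  | .nop => []
  | .setNat _ _ _ => []
  | .setReal A _ _ => [A]
  | .seq P Q => P.realWrites ++ Q.realWrites
  | .branch _ P Q => P.realWrites ++ Q.realWrites
  | .loop _ P => P.realWrites

/-- The states `s` and `s'` differ at most in arrays to which `P` writes. -/
def Prog.Frame (P : Prog) (s s' : State) : Prop :=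
  (∀ A ∉ P.natWrites, s'.nat A = s.nat A) ∧ (∀ A ∉ P.realWrites, s'.real A = s.real A)

theorem Prog.Frame.refl (P : Prog) (s : State) : P.Frame s s := ⟨fun _ _ => rfl, fun _ _ => rfl⟩

theorem Prog.Frame.trans {P : Prog} {s s' s'' : State} (h : P.Frame s s') (h' : P.Frame s' s'') :
    P.Frame s s'' :=
  ⟨fun A hA => (h'.1 A hA).trans (h.1 A hA), fun A hA => (h'.2 A hA).trans (h.2 A hA)⟩

theorem Prog.Frame.mono {P Q : Prog} {s s' : State} (h : P.Frame s s')
    (h1 : ∀ A ∈ P.natWrites, A ∈ Q.natWrites) (h2 : ∀ A ∈ P.realWrites, A ∈ Q.realWrites) :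
    Q.Frame s s' :=
  ⟨fun A hA => h.1 A fun hc => hA (h1 A hc), fun A hA => h.2 A fun hc => hA (h2 A hc)⟩

/-- The lists of written arrays are computed from the syntax, so later claims that an array is
unchanged reduce to a membership question that `decide` settles. -/
theorem Exec.frame {P : Prog} {s s' : State} {t : ℕ} (h : Exec P s t s') : P.Frame s s' := by
  induction h with
  | nop s => exact .refl _ _
  | setNat s A e x =>
    refine ⟨fun B hB => ?_, fun _ _ => rfl⟩
    ext j
    simp only [Prog.natWrites, List.mem_singleton] at hB
    simp [State.setNat, hB]
  | setReal s A e x =>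
    refine ⟨fun _ _ => rfl, fun B hB => ?_⟩
    ext j
    simp only [Prog.realWrites, List.mem_singleton] at hB
    simp [State.setReal, hB]
  | seq _ _ h1 h2 =>
    exact (h1.mono (fun A h => List.mem_append_left _ h) fun A h => List.mem_append_left _ h).trans
      (h2.mono (fun A h => List.mem_append_right _ h) fun A h => List.mem_append_right _ h)
  | branch_true _ _ h1 =>
    exact h1.mono (fun A h => List.mem_append_left _ h) fun A h => List.mem_append_left _ h
  | branch_false _ _ h1 =>
    exact h1.mono (fun A h => List.mem_append_right _ h) fun A h => List.mem_append_right _ h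
  | loop_true _ _ _ h1 h2 => exact Prog.Frame.trans (P := .loop _ _) h1 h2
  | loop_false _ => exact .refl _ _

theorem Runs.frame {P : Prog} {s : State} {c : ℕ} {Q : State → Prop} (h : Runs P s c Q) :
    Runs P s c fun s' => Q s' ∧ P.Frame s s' := by
  obtain ⟨t, s', h1, h2, h3⟩ := h
  exact ⟨t, s', h1, h2, h3, h1.frame⟩

/-! ### Loops -/

/-- Induction on the number `r` of remaining rounds. The last summand `b.cost + 1` pays for the test
that fails. -/
theorem Runs.loop_aux {b : Test} {P : Prog} {c N : ℕ} {Inv : ℕ → State → Prop}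
    (hstep : ∀ k < N, ∀ s, Inv k s → b.Holds s ∧ Runs P s c (Inv (k + 1)))
    (hexit : ∀ s, Inv N s → ¬ b.Holds s) (r : ℕ) :
    ∀ k, k + r = N → ∀ s, Inv k s →
      Runs (.loop b P) s (r * (b.cost + c + 1) + (b.cost + 1)) (Inv N) := by
  induction r with
  | zero =>
    rintro k rfl s hs
    exact ⟨_, s, .loop_false (hexit s hs), by omega, hs⟩
  | succ r ih =>
    intro k hk s hs
    obtain ⟨h1, t, s', h2, h3, h4⟩ := hstep k (by omega) s hs
    obtain ⟨t', s'', h5, h6, h7⟩ := ih (k + 1) (by omega) s' h4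
    exact ⟨_, s'', .loop_true h1 h2 h5, by rw [Nat.succ_mul]; omega, h7⟩

/-- A loop that runs `N` times. The invariant may use that arrays to which the body does not write
keep their contents. -/
theorem Runs.loop {b : Test} {P : Prog} {s₀ : State} (c N : ℕ) (Inv : ℕ → State → Prop)
    (hinit : Inv 0 s₀)
    (hstep : ∀ k < N, ∀ s, P.Frame s₀ s → Inv k s → b.Holds s ∧ Runs P s c (Inv (k + 1)))
    (hexit : ∀ s, P.Frame s₀ s → Inv N s → ¬ b.Holds s) :
    Runs (.loop b P) s₀ (N * (b.cost + c + 1) + (b.cost + 1)) fun s => Inv N s ∧ P.Frame s₀ s := by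
  refine (Runs.loop_aux (Inv := fun k s => Inv k s ∧ P.Frame s₀ s) (fun k hk s hs => ?_)
    (fun s hs => hexit s hs.2 hs.1) N 0 (by omega) s₀ ⟨hinit, .refl _ _⟩)
  obtain ⟨h1, h2⟩ := hstep k hk s hs.2 hs.1
  exact ⟨h1, h2.frame.mono le_rfl fun s' h => ⟨h.1, hs.2.trans h.2⟩⟩

/-! ### Programs without loops -/

/-- Whether a program has no loops. -/
def Prog.loopFree : Prog → Bool
  | .nop => true
  | .setNat _ _ _ => true
  | .setReal _ _ _ => true
  | .seq P Q => P.loopFree && Q.loopFree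
  | .branch _ P Q => P.loopFree && Q.loopFree
  | .loop _ _ => false

open Classical in
/-- The state in which a program without loops halts. -/
noncomputable def Prog.run : Prog → State → State
  | .nop, s => s
  | .setNat A e x, s => s.setNat A (e.eval s) (x.eval s)
  | .setReal A e x, s => s.setReal A (e.eval s) (x.eval s)
  | .seq P Q, s => Q.run (P.run s)
  | .branch b P Q, s => if b.Holds s then P.run s else Q.run s
  | .loop _ _, s => s

/-- A bound on the number of steps of a program without loops. -/
def Prog.bound : Prog → ℕ
  | .nop => 1
  | .setNat _ e x => e.cost + x.cost + 1
  | .setReal _ e x => e.cost + x.cost + 1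
  | .seq P Q => P.bound + Q.bound
  | .branch b P Q => b.cost + (P.bound + Q.bound) + 1
  | .loop _ _ => 0

/-- Reduces the correctness of a loop-free program to evaluating `Prog.run` by simplification;
`loopFree` itself holds by `rfl`. -/
theorem Runs.of_loopFree {P : Prog} (hP : P.loopFree = true) (s : State) {Q : State → Prop}
    (hQ : Q (P.run s)) : Runs P s P.bound Q := by
  have key : ∀ s, ∃ t ≤ P.bound, Exec P s t (P.run s) := by
    clear hQ s
    induction P with
    | nop => exact fun s => ⟨1, le_rfl, .nop s⟩
    | setNat A e x => exact fun s => ⟨_, le_rfl, .setNat s A e x⟩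
    | setReal A e x => exact fun s => ⟨_, le_rfl, .setReal s A e x⟩
    | seq P P' h1 h2 =>
      intro s
      rw [Prog.loopFree, Bool.and_eq_true] at hP
      obtain ⟨t, h3, h4⟩ := h1 hP.1 s
      obtain ⟨t', h5, h6⟩ := h2 hP.2 (P.run s)
      exact ⟨_, Nat.add_le_add h3 h5, .seq h4 h6⟩
    | branch b P P' h1 h2 =>
      intro s
      rw [Prog.loopFree, Bool.and_eq_true] at hP
      by_cases hb : b.Holds s
      · obtain ⟨t, h3, h4⟩ := h1 hP.1 s
        refine ⟨b.cost + t + 1, by simp only [Prog.bound]; omega, ?_⟩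
        simpa only [Prog.run, if_pos hb] using Exec.branch_true (Q := P') hb h4
      · obtain ⟨t, h3, h4⟩ := h2 hP.2 s
        refine ⟨b.cost + t + 1, by simp only [Prog.bound]; omega, ?_⟩
        simpa only [Prog.run, if_neg hb] using Exec.branch_false (P := P) hb h4
    | loop => exact absurd hP Bool.false_ne_true
  obtain ⟨t, h1, h2⟩ := key s
  exact ⟨t, _, h2, h1, hQ⟩

theorem Prog.frame_run {P : Prog} (hP : P.loopFree = true) (s : State) : P.Frame s (P.run s) := by
  obtain ⟨t, s', h1, -, h2⟩ := Runs.of_loopFree hP s (Q := fun s' => s' = P.run s) rfl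
  exact h2 ▸ h1.frame

/-- A program without loops, followed by a loop that runs `N` times. -/
theorem Runs.init_loop {P₀ P : Prog} {b : Test} {s₀ : State} (hP : P₀.loopFree = true) (c N : ℕ)
    (Inv : ℕ → State → Prop) (hinit : Inv 0 (P₀.run s₀))
    (hstep : ∀ k < N, ∀ s, P.Frame (P₀.run s₀) s → Inv k s →
      b.Holds s ∧ Runs P s c (Inv (k + 1)))
    (hexit : ∀ s, P.Frame (P₀.run s₀) s → Inv N s → ¬ b.Holds s) :
    Runs (.seq P₀ (.loop b P)) s₀ (P₀.bound + (N * (b.cost + c + 1) + (b.cost + 1)))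
      fun s => Inv N s ∧ P.Frame (P₀.run s₀) s :=
  (Runs.of_loopFree hP s₀ (Q := fun s => s = P₀.run s₀) rfl).seq fun s hs => by
    subst hs; exact Runs.loop c N Inv hinit hstep hexit

/-- The factor `2` absorbs the final test, so that initialization and loop together are a constant
times the number of rounds. -/
theorem loop_cost_le {a b c n : ℕ} (hn : 0 < n) :
    a + (n * (b + c + 1) + (b + 1)) ≤ (a + 2 * (b + c + 1)) * n := by
  have h1 : a ≤ a * n := Nat.le_mul_of_pos_right a hn
  have h2 : b + 1 ≤ (b + 1) * n := Nat.le_mul_of_pos_right _ hn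
  nlinarith

/-! ### Notation for programs -/

/-- The scalar natural number variable `A`. -/
abbrev nvar (A : ℕ) : NExp := .get A (.lit 0)

/-- The scalar real variable `A`. -/
abbrev rvar (A : ℕ) : RExp := .get A (.lit 0)

/-- Assign to a scalar natural number variable. -/
abbrev nlet (A : ℕ) (x : NExp) : Prog := .setNat A (.lit 0) x

/-- Assign to a scalar real variable. -/
abbrev rlet (A : ℕ) (x : RExp) : Prog := .setReal A (.lit 0) x

/-- Increase a scalar variable by `1`. -/
abbrev incr (A : ℕ) : Prog := nlet A (.add (nvar A) (.lit 1))

infixr:60 " ;; " => Prog.seq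
infixl:65 " +ₙ " => NExp.add
infixl:65 " +ᵣ " => RExp.add
infixl:65 " -ᵣ " => RExp.sub
infixl:70 " *ᵣ " => RExp.mul
infixl:70 " /ᵣ " => RExp.div

theorem State.nat_setNat (s : State) (A i x B j : ℕ) :
    (s.setNat A i x).nat B j = if B = A ∧ j = i then x else s.nat B j := rfl

theorem State.real_setNat (s : State) (A i x : ℕ) : (s.setNat A i x).real = s.real := rfl

theorem State.nat_setReal (s : State) (A i : ℕ) (x : ℝ) : (s.setReal A i x).nat = s.nat := rfl

theorem State.real_setReal (s : State) (A i : ℕ) (x : ℝ) (B j : ℕ) :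
    (s.setReal A i x).real B j = if B = A ∧ j = i then x else s.real B j := rfl

end RealRAM

/-! ### Linear-time subroutines: keys, extreme points, pivots. -/

namespace Highway

open RealRAM

variable {n : ℕ} {v : ℝ} {p : Fin n → Plane}

/-- The memory holds the points and the cosine and the sine of the critical angle. -/
structure Env (v : ℝ) (p : Fin n → Plane) (s : State) : Prop where
  count : s.nat 0 0 = n
  xs : ∀ i : Fin n, s.real 1 i = p i 0
  ys : ∀ i : Fin n, s.real 2 i = p i 1
  cosα : s.real 4 0 = Real.cos (criticalAngle v)
  sinα : s.real 5 0 = Real.sin (criticalAngle v)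

theorem Env.frame {s s' : State} (h : Env v p s) {P : Prog} (hf : P.Frame s s')
    (h0 : 0 ∉ P.natWrites) (h1 : ∀ A ∈ [1, 2, 4, 5], A ∉ P.realWrites) : Env v p s' := by
  have e0 := hf.1 0 h0
  have e1 := hf.2 1 (h1 1 (by simp))
  have e2 := hf.2 2 (h1 2 (by simp))
  have e4 := hf.2 4 (h1 4 (by simp))
  have e5 := hf.2 5 (h1 5 (by simp))
  exact ⟨e0 ▸ h.count, e1 ▸ h.xs, e2 ▸ h.ys, e4 ▸ h.cosα, e5 ▸ h.sinα⟩

/-! ### The key of a vector -/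

/-- Compute the key of the vector in the variables `8` and `9`. -/
def keyProg : Prog :=
  .branch (.realLt (rvar 9) (.lit 0))
    (rlet 10 (rvar 8 /ᵣ .sqrt (rvar 8 *ᵣ rvar 8 +ᵣ rvar 9 *ᵣ rvar 9)))
    (.branch (.realLt (.lit 0) (rvar 9))
      (rlet 10 (.lit 0 -ᵣ rvar 8 /ᵣ .sqrt (rvar 8 *ᵣ rvar 8 +ᵣ rvar 9 *ᵣ rvar 9)))
      (rlet 10 (.lit (-1))))

theorem keyProg_run (s : State) :
    keyProg.run s = s.setReal 10 0 (keyOf (s.real 8 0) (s.real 9 0)) := by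
  simp only [keyProg, Prog.run, Test.Holds, RExp.eval, NExp.eval, keyOf, Rat.cast_zero, zero_sub,
    Rat.cast_neg, Rat.cast_one]
  split_ifs <;> rfl

/-! ### Extreme points in a direction -/

/-- Disjunction of tests. -/
abbrev orTest (b c : Test) : Test := .not (.and (.not b) (.not c))

theorem holds_orTest (s : State) (b c : Test) : (orTest b c).Holds s ↔ b.Holds s ∨ c.Holds s := by
  simp only [Test.Holds]; tauto

/-- The inner product of a point with the vector in the variables `6` and `7`. -/
abbrev along (e : NExp) : RExp := rvar 6 *ᵣ .get 1 e +ᵣ rvar 7 *ᵣ .get 2 e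

/-- The inner product of a point with the vector in the variables `6` and `7`, turned by a right
angle. -/
abbrev across (e : NExp) : RExp := rvar 6 *ᵣ .get 2 e -ᵣ rvar 7 *ᵣ .get 1 e

/-- Lexicographic comparison of points in the direction in the variables `6` and `7`. -/
abbrev lexTest (e f : NExp) : Test :=
  orTest (.realLt (along e) (along f))
    (.and (.realLe (along e) (along f)) (.realLt (across e) (across f)))

/-- The body of the loop of `widthProg`. -/
def widthBody : Prog :=
  .branch (lexTest (nvar 7) (nvar 3)) (nlet 7 (nvar 3)) .nop ;;
  .branch (lexTest (nvar 3) (nvar 8)) (nlet 8 (nvar 3)) .nop ;;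
  incr 3

/-- The initialization of `widthProg`. -/
def widthInit : Prog := nlet 3 (.lit 0) ;; nlet 7 (.lit 0) ;; nlet 8 (.lit 0)

/-- Find the indices `7` and `8` of the last and the first point in the direction in the variables
`6` and `7`. -/
def widthProg : Prog :=
  widthInit ;; .loop (.natLt (nvar 3) (nvar 0)) widthBody

/-- The position of a point in the direction `ψ`, with ties broken by the direction `ψ + π / 2`. -/
noncomputable def lexKey (p : Fin n → Plane) (ψ : ℝ) (i : Fin n) : ℝ ×ₗ ℝ :=
  toLex (ip ψ (p i), ip (ψ + Real.pi / 2) (p i))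

/-- Tests on reals offer `<` and `≤` but no equality; next to the first alternative, `≤` in the
second one is as good as `=`. -/
theorem lexKey_lt_iff {ψ : ℝ} {i j : Fin n} : lexKey p ψ i < lexKey p ψ j ↔
    ip ψ (p i) < ip ψ (p j) ∨
      ip ψ (p i) ≤ ip ψ (p j) ∧ ip (ψ + Real.pi / 2) (p i) < ip (ψ + Real.pi / 2) (p j) := by
  rw [lexKey, lexKey, Prod.Lex.toLex_lt_toLex]
  constructor
  · rintro (h | ⟨h, h'⟩)
    · exact Or.inl h
    · exact Or.inr ⟨h.le, h'⟩
  · rintro (h | ⟨h, h'⟩)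
    · exact Or.inl h
    · rcases h.eq_or_lt with h | h
      · exact Or.inr ⟨h, h'⟩
      · exact Or.inl h

theorem isLexMax_iff {ψ : ℝ} {a : Fin n} :
    IsLexMax p ψ a ↔ ∀ i, lexKey p ψ i ≤ lexKey p ψ a := by
  simp only [IsLexMax, lexKey, Prod.Lex.toLex_le_toLex]

/-- A half turn negates both coordinates of the lexicographic key, so one scan finds the extreme
points of `ψ` and of `ψ + π`. -/
theorem isLexMax_add_pi_iff {ψ : ℝ} {b : Fin n} :
    IsLexMax p (ψ + Real.pi) b ↔ ∀ i, lexKey p ψ b ≤ lexKey p ψ i := by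
  simp only [IsLexMax, lexKey, Prod.Lex.toLex_le_toLex, ip_add_pi, add_right_comm ψ Real.pi,
    neg_lt_neg_iff, neg_inj, neg_le_neg_iff, eq_comm]

/-- The variables `6` and `7` hold the unit vector of direction `ψ`. -/
def HasDir (s : State) (ψ : ℝ) : Prop := s.real 6 0 = Real.cos ψ ∧ s.real 7 0 = Real.sin ψ

theorem eval_along {s : State} (h : Env v p s) {ψ : ℝ} (hd : HasDir s ψ) {e : NExp} {i : Fin n}
    (he : e.eval s = i) : (along e).eval s = ip ψ (p i) := by
  simp only [RExp.eval, NExp.eval, he, h.xs, h.ys, hd.1, hd.2, ip]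

theorem eval_across {s : State} (h : Env v p s) {ψ : ℝ} (hd : HasDir s ψ) {e : NExp} {i : Fin n}
    (he : e.eval s = i) : (across e).eval s = ip (ψ + Real.pi / 2) (p i) := by
  simp only [RExp.eval, NExp.eval, he, h.xs, h.ys, hd.1, hd.2, ip, Real.cos_add_pi_div_two,
    Real.sin_add_pi_div_two]
  ring

theorem holds_lexTest {s : State} (h : Env v p s) {ψ : ℝ} (hd : HasDir s ψ) {e f : NExp}
    {i j : Fin n} (he : e.eval s = i) (hf : f.eval s = j) :
    (lexTest e f).Holds s ↔ lexKey p ψ i < lexKey p ψ j := by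
  rw [lexKey_lt_iff, holds_orTest]
  simp only [Test.Holds, eval_along h hd he, eval_along h hd hf, eval_across h hd he,
    eval_across h hd hf]

/-- The state of the search for extreme points after the inspection of `k` points. -/
def WidthInv (p : Fin n → Plane) (ψ : ℝ) (k : ℕ) (s : State) : Prop :=
  s.nat 3 0 = k ∧ ∃ a b : Fin n, s.nat 7 0 = a ∧ s.nat 8 0 = b ∧
    ∀ i : Fin n, (i : ℕ) < k → lexKey p ψ i ≤ lexKey p ψ a ∧ lexKey p ψ b ≤ lexKey p ψ i

theorem widthBody_spec {s : State} (h : Env v p s) {ψ : ℝ} (hd : HasDir s ψ) {k : ℕ} (hk : k < n)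
    (hI : WidthInv p ψ k s) : WidthInv p ψ (k + 1) (widthBody.run s) := by
  obtain ⟨h3, a, b, h7, h8, hab⟩ := hI
  set j : Fin n := ⟨k, hk⟩
  have hstep : ∀ a' b' : Fin n, lexKey p ψ a ≤ lexKey p ψ a' → lexKey p ψ j ≤ lexKey p ψ a' →
      lexKey p ψ b' ≤ lexKey p ψ b → lexKey p ψ b' ≤ lexKey p ψ j → ∀ i : Fin n, (i : ℕ) ≤ k →
      lexKey p ψ i ≤ lexKey p ψ a' ∧ lexKey p ψ b' ≤ lexKey p ψ i := by
    intro a' b' h1 h2 h3 h4 i hi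
    rcases hi.lt_or_eq with hi | hi
    · exact ⟨(hab i hi).1.trans h1, h3.trans (hab i hi).2⟩
    · have : i = j := Fin.ext hi
      exact this ▸ ⟨h2, h4⟩
  have hA := holds_lexTest h hd (e := nvar 7) (f := nvar 3) (i := a) (j := j) h7 h3
  -- The second test is evaluated after the first branch, which may have overwritten the variable
  -- `7`; it has to be understood in those states too.
  have hB := fun x => holds_lexTest (s := s.setNat 7 0 x) (e := nvar 3) (f := nvar 8) (i := j)
    (j := b) (ψ := ψ) ⟨h.count, h.xs, h.ys, h.cosα, h.sinα⟩ hd h3 h8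
  have hB' := holds_lexTest h hd (e := nvar 3) (f := nvar 8) (i := j) (j := b) h3 h8
  by_cases h1 : lexKey p ψ a < lexKey p ψ j <;> by_cases h2 : lexKey p ψ j < lexKey p ψ b <;>
    simp only [widthBody, Prog.run, hA, hB, hB', h1, h2, if_true, if_false, WidthInv,
      State.nat_setNat, NExp.eval, h3, h7, h8] <;> norm_num
  · exact ⟨j, rfl, j, rfl, hstep j j h1.le le_rfl h2.le le_rfl⟩
  · exact ⟨j, rfl, b, rfl, hstep j b h1.le le_rfl le_rfl (not_lt.1 h2)⟩
  · exact ⟨a, rfl, j, rfl, hstep a j le_rfl (not_lt.1 h1) h2.le le_rfl⟩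
  · exact ⟨a, rfl, b, rfl, hstep a b le_rfl (not_lt.1 h1) le_rfl (not_lt.1 h2)⟩

/-- The constant is chosen before `n`, `v`, `p` and the state, here and in the specifications below;
this is what makes the final constant independent of the input. -/
theorem widthProg_spec : ∃ c : ℕ, ∀ {n : ℕ} {v : ℝ} {p : Fin n → Plane} {s : State} {ψ : ℝ},
    0 < n → Env v p s → HasDir s ψ → Runs widthProg s (c * n) fun s' =>
      (∃ a b : Fin n, s'.nat 7 0 = a ∧ s'.nat 8 0 = b ∧ IsLexMax p ψ a ∧
        IsLexMax p (ψ + Real.pi) b) ∧ widthProg.Frame s s' := by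
  refine ⟨widthInit.bound + 2 * ((Test.natLt (nvar 3) (nvar 0)).cost + widthBody.bound + 1),
    fun {n v p s ψ} hn h hd => Runs.frame ?_⟩
  have h1 : Env v p (widthInit.run s) := ⟨h.count, h.xs, h.ys, h.cosα, h.sinα⟩
  refine (Runs.init_loop (P₀ := widthInit) rfl widthBody.bound n (WidthInv p ψ)
    ⟨rfl, ⟨0, hn⟩, ⟨0, hn⟩, rfl, rfl, fun i hi => absurd hi (Nat.not_lt_zero _)⟩
    (fun k hk s₂ hf hI => ?_) (fun s₂ hf hI => ?_)).mono (loop_cost_le hn) ?_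
  · have h2 := h1.frame hf (by decide) (by decide)
    have hd2 : HasDir s₂ ψ := by
      rw [HasDir, hf.2 6 (by decide), hf.2 7 (by decide)]; exact hd
    exact ⟨by simp only [Test.Holds, NExp.eval, h2.count, hI.1]; exact hk,
      Runs.of_loopFree rfl s₂ (widthBody_spec h2 hd2 hk hI)⟩
  · have h2 := h1.frame hf (by decide) (by decide)
    simp only [Test.Holds, NExp.eval, h2.count, hI.1]; exact lt_irrefl _
  · rintro s₂ ⟨⟨-, a, b, h7, h8, hab⟩, -⟩
    exact ⟨a, b, h7, h8, isLexMax_iff.2 fun i => (hab i i.2).1,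
      isLexMax_add_pi_iff.2 fun i => (hab i i.2).2⟩

/-! ### Pivots -/

/-- The body of the loop of `pivotProg`. -/
def pivotBody : Prog :=
  .branch (orTest (.natEq (nvar 4) (nvar 1)) (.realLt
      ((.get 1 (nvar 4) -ᵣ .get 1 (nvar 1)) *ᵣ (.get 2 (nvar 3) -ᵣ .get 2 (nvar 1)) -ᵣ
        (.get 2 (nvar 4) -ᵣ .get 2 (nvar 1)) *ᵣ (.get 1 (nvar 3) -ᵣ .get 1 (nvar 1))) (.lit 0)))
    (nlet 4 (nvar 3)) .nop ;;
  incr 3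

/-- The initialization of `pivotProg`. -/
def pivotInit : Prog := nlet 3 (.lit 0) ;; nlet 4 (nvar 1)

/-- Find the pivot `4` of the point with index `1`. -/
def pivotProg : Prog :=
  pivotInit ;; .loop (.natLt (nvar 3) (nvar 0)) pivotBody

/-- The state of the search for the pivot of `i` after the inspection of `k` points. -/
def PivotInv (p : Fin n → Plane) (i : Fin n) (k : ℕ) (s : State) : Prop :=
  s.nat 3 0 = k ∧ s.nat 1 0 = i ∧ ∃ j : Fin n, s.nat 4 0 = j ∧ PivotUpTo p i k j

theorem pivotBody_spec {s : State} (h : Env v p s) {i : Fin n} {k : ℕ} (hk : k < n)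
    (hI : PivotInv p i k s) : PivotInv p i (k + 1) (pivotBody.run s) := by
  obtain ⟨h3, h1, j, h4, hj⟩ := hI
  have ek : s.real 1 k = p ⟨k, hk⟩ 0 := h.xs ⟨k, hk⟩
  have ek' : s.real 2 k = p ⟨k, hk⟩ 1 := h.ys ⟨k, hk⟩
  have hT : (orTest (.natEq (nvar 4) (nvar 1)) (.realLt
      ((.get 1 (nvar 4) -ᵣ .get 1 (nvar 1)) *ᵣ (.get 2 (nvar 3) -ᵣ .get 2 (nvar 1)) -ᵣ
        (.get 2 (nvar 4) -ᵣ .get 2 (nvar 1)) *ᵣ (.get 1 (nvar 3) -ᵣ .get 1 (nvar 1)))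
      (.lit 0))).Holds s ↔ j = i ∨ cross (p j - p i) (p ⟨k, hk⟩ - p i) < 0 := by
    rw [holds_orTest]
    simp only [Test.Holds, NExp.eval, RExp.eval, h1, h3, h4, h.xs, h.ys, ek, ek', cross,
      Rat.cast_zero, PiLp.sub_apply, Fin.ext_iff]
  rw [pivotBody]
  simp only [Prog.run, hT]
  split_ifs with hc
  · refine ⟨?_, ?_, ⟨k, hk⟩, ?_, PivotUpTo.replace (k := ⟨k, hk⟩) hj hc⟩ <;>
      simp [State.nat_setNat, NExp.eval, h1, h3]
  · refine ⟨?_, ?_, j, ?_, PivotUpTo.keep (k := ⟨k, hk⟩) hj ?_⟩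
    · simp [State.nat_setNat, NExp.eval, h3]
    · simp [State.nat_setNat, h1]
    · simp [State.nat_setNat, h4]
    · push Not at hc; exact hc

theorem pivotProg_spec : ∃ c : ℕ, ∀ {n : ℕ} {v : ℝ} {p : Fin n → Plane} {s : State} {i : Fin n},
    2 ≤ n → Env v p s → s.nat 1 0 = i → Runs pivotProg s (c * n) fun s' =>
      (∃ j : Fin n, s'.nat 4 0 = j ∧ IsPivot p i j) ∧ pivotProg.Frame s s' := by
  refine ⟨pivotInit.bound + 2 * ((Test.natLt (nvar 3) (nvar 0)).cost + pivotBody.bound + 1),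
    fun {n v p s i} hn h hi => Runs.frame ?_⟩
  have h1 : Env v p (pivotInit.run s) := ⟨h.count, h.xs, h.ys, h.cosα, h.sinα⟩
  refine (Runs.init_loop (P₀ := pivotInit) rfl pivotBody.bound n (PivotInv p i)
    ⟨rfl, hi, i, hi, .zero p i⟩
    (fun k hk s₂ hf hI => ?_) (fun s₂ hf hI => ?_)).mono (loop_cost_le (by omega)) ?_
  · have h2 := h1.frame hf (by decide) (by decide)
    exact ⟨by simp only [Test.Holds, NExp.eval, h2.count, hI.1]; exact hk,
      Runs.of_loopFree rfl s₂ (pivotBody_spec h2 hk hI)⟩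
  · have h2 := h1.frame hf (by decide) (by decide)
    simp only [Test.Holds, NExp.eval, h2.count, hI.1]; exact lt_irrefl _
  · rintro s₂ ⟨⟨-, -, j, h4, hj⟩, -⟩
    exact ⟨j, h4, hj.isPivot hn⟩

end Highway

namespace Highway

open RealRAM

/-! ### Step functions in arrays -/

/-- The value at `x` of the step function given by `l` entries from the index `lo` on: the value of
the last entry whose key is at most `x`. -/
noncomputable def stepVal (K V : ℕ → ℝ) (lo : ℕ) : ℕ → ℝ → ℝ
  | 0, _ => 0
  | l + 1, x => if K (lo + l) ≤ x then V (lo + l) else stepVal K V lo l x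

theorem stepVal_congr {K V K' V' : ℕ → ℝ} {lo l : ℕ}
    (h : ∀ i < l, K' (lo + i) = K (lo + i) ∧ V' (lo + i) = V (lo + i)) (x : ℝ) :
    stepVal K' V' lo l x = stepVal K V lo l x := by
  induction l with
  | zero => rfl
  | succ l ih =>
    rw [stepVal, stepVal, (h l (by omega)).1, (h l (by omega)).2, ih fun i hi => h i (by omega)]

theorem stepVal_eq_zero {K V : ℕ → ℝ} {lo l : ℕ} (h : ∀ i < l, V (lo + i) = 0) (x : ℝ) :
    stepVal K V lo l x = 0 := by
  induction l with
  | zero => rfl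
  | succ l ih =>
    rw [stepVal, h l (by omega), ih fun i hi => h i (by omega), ite_self]

/-- The first `B` blocks of three entries hold step functions below `z` and the keys and crossings
of `m` slots. The remaining memory is empty. -/
structure Blocks (z : ℝ → ℝ) (m : ℕ) (κ c : ℕ → ℝ) (B : ℕ) (K V : ℕ → ℝ) (T : ℕ → ℕ) : Prop where
  rest : ∀ j, 3 * B ≤ j → K j = 0 ∧ V j = 0 ∧ T j = 0
  mem : ∀ j, K j ∈ Ico (-1 : ℝ) 1
  sorted : ∀ b, K (3 * b) ≤ K (3 * b + 1) ∧ K (3 * b + 1) ≤ K (3 * b + 2)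
  tags : ∀ j, T j ≠ 0 → T j < m ∧ K j = κ (T j)
  slots : ∀ t < m, (∃ j < 3 * B, K j = κ t ∧ T j = t) ∧ ∃ j < 3 * B, K j = c t
  low : ∀ b, ∀ φ ∈ Ico 0 Real.pi, stepVal K V (3 * b) 3 (-Real.cos φ) ≤ z φ

/-- Slots and pairs both append exactly one block of three entries. This collects what has to be
checked for the new block alone. -/
theorem Blocks.add {z : ℝ → ℝ} {m B : ℕ} {κ c K V : ℕ → ℝ} {T : ℕ → ℕ}
    (h : Blocks z m κ c B K V T) {m' : ℕ} {κ' c' K' V' : ℕ → ℝ} {T' : ℕ → ℕ} (hm : m ≤ m')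
    (hκ : ∀ t < m, κ' t = κ t ∧ c' t = c t)
    (hK : ∀ j, (j < 3 * B ∨ 3 * B + 3 ≤ j) → K' j = K j ∧ V' j = V j ∧ T' j = T j)
    (hmem : ∀ i < 3, K' (3 * B + i) ∈ Ico (-1 : ℝ) 1)
    (hs : K' (3 * B) ≤ K' (3 * B + 1) ∧ K' (3 * B + 1) ≤ K' (3 * B + 2))
    (htag : ∀ i < 3, T' (3 * B + i) ≠ 0 →
      T' (3 * B + i) < m' ∧ K' (3 * B + i) = κ' (T' (3 * B + i)))
    (hslots : ∀ t, m ≤ t → t < m' → (∃ i < 3, K' (3 * B + i) = κ' t ∧ T' (3 * B + i) = t) ∧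
      ∃ i < 3, K' (3 * B + i) = c' t)
    (hlow : ∀ φ ∈ Ico 0 Real.pi, stepVal K' V' (3 * B) 3 (-Real.cos φ) ≤ z φ) :
    Blocks z m' κ' c' (B + 1) K' V' T' := by
  have hcase : ∀ j, (j < 3 * B ∨ 3 * B + 3 ≤ j) ∨ ∃ i < 3, j = 3 * B + i := fun j => by
    by_cases h1 : j < 3 * B ∨ 3 * B + 3 ≤ j
    · exact Or.inl h1
    · exact Or.inr ⟨j - 3 * B, by omega, by omega⟩
  constructor
  · intro j hj
    obtain ⟨h1, h2, h3⟩ := hK j (by omega)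
    rw [h1, h2, h3]; exact h.rest j (by omega)
  · intro j
    rcases hcase j with h1 | ⟨i, h1, rfl⟩
    · rw [(hK j h1).1]; exact h.mem j
    · exact hmem i h1
  · intro b
    by_cases hb : b = B
    · rw [hb]; exact hs
    · rw [(hK (3 * b) (by omega)).1, (hK (3 * b + 1) (by omega)).1, (hK (3 * b + 2) (by omega)).1]
      exact h.sorted b
  · intro j
    rcases hcase j with h1 | ⟨i, h1, rfl⟩
    · rw [(hK j h1).1, (hK j h1).2.2]
      intro h2
      obtain ⟨h3, h4⟩ := h.tags j h2
      exact ⟨by omega, by rw [(hκ _ h3).1, h4]⟩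
    · exact htag i h1
  · intro t ht
    rcases lt_or_ge t m with h1 | h1
    · obtain ⟨⟨j, h2, h3⟩, j', h4, h5⟩ := h.slots t h1
      refine ⟨⟨j, by omega, ?_⟩, j', by omega, ?_⟩
      · rw [(hK j (Or.inl h2)).1, (hK j (Or.inl h2)).2.2, (hκ t h1).1]; exact h3
      · rw [(hK j' (Or.inl h4)).1, (hκ t h1).2]; exact h5
    · obtain ⟨⟨i, h2, h3⟩, i', h4, h5⟩ := hslots t h1 ht
      exact ⟨⟨_, by omega, h3⟩, _, by omega, h5⟩
  · intro b φ hφ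
    by_cases hb : b = B
    · rw [hb]; exact hlow φ hφ
    · rw [stepVal_congr (K := K) (V := V) fun i hi => ⟨(hK _ (by omega)).1, (hK _ (by omega)).2.1⟩]
      exact h.low b φ hφ

/-! ### Slots -/

variable {n : ℕ} {v : ℝ} {p : Fin n → Plane}

/-- The rows of a slot table. -/
structure SlotRows (v : ℝ) (p : Fin n → Plane) (m : ℕ) (κ c : ℕ → ℝ) (D D' : ℕ → Plane) :
    Prop where
  key_mem : ∀ t < m, κ t ∈ Ico (-1 : ℝ) 1
  left : ∀ t < m, ∃ a b, D t = p a - p b ∧ IsLexMax p (keyAngle (κ t) - criticalAngle v) a ∧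
    IsLexMax p (keyAngle (κ t) - criticalAngle v + Real.pi) b
  right : ∀ t < m, ∃ a b, D' t = p a - p b ∧ IsLexMax p (keyAngle (κ t) + criticalAngle v) a ∧
    IsLexMax p (keyAngle (κ t) + criticalAngle v + Real.pi) b
  crossing : ∀ t < m, ∀ φ ∈ Ico 0 Real.pi,
    ip (φ - criticalAngle v) (D t) = ip (φ + criticalAngle v) (D' t) → φ = keyAngle (c t) ∨
      ∀ ψ, ip (ψ - criticalAngle v) (D t) = ip (ψ + criticalAngle v) (D' t)

/-- The vectors with coordinates in the arrays `A` and `A'`. -/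
noncomputable def vecs (s : State) (A A' : ℕ) (t : ℕ) : Plane := !₂[s.real A t, s.real A' t]

/-- The memory holds `m` slots and `B` blocks of events. -/
structure SlotState (v : ℝ) (p : Fin n → Plane) (m B : ℕ) (s : State) : Prop where
  env : Env v p s
  slot : s.nat 5 0 = m
  base : s.nat 6 0 = 3 * B
  rows : SlotRows v p m (s.real 28) (s.real 29) (vecs s 24 25) (vecs s 26 27)
  blocks : Blocks (envelope v p) m (s.real 28) (s.real 29) B (s.real 20) (s.real 21) (s.nat 20)

theorem crossing_formula (D D' : Plane) (ψ α : ℝ) :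
    ip (ψ - α) D - ip (ψ + α) D' =
      Real.cos ψ * (Real.cos α * D 0 - Real.sin α * D 1 - Real.cos α * D' 0 - Real.sin α * D' 1) -
      Real.sin ψ *
        (Real.cos α * D' 1 - Real.sin α * D 0 - Real.cos α * D 1 - Real.sin α * D' 0) := by
  simp only [ip, Real.cos_sub, Real.sin_sub, Real.cos_add, Real.sin_add]; ring

/-- The difference of the two widths is again a sinusoid `y cos ψ - x sin ψ`. It vanishes only in
the orientation of the vector `(x, y)`, or identically if this vector is zero. -/
theorem crossing_of_keyOf {D D' : Plane} {α φ : ℝ} (hφ : φ ∈ Ico 0 Real.pi)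
    (h : ip (φ - α) D = ip (φ + α) D') :
    φ = keyAngle (keyOf
      (Real.cos α * D' 1 - Real.sin α * D 0 - Real.cos α * D 1 - Real.sin α * D' 0)
      (Real.cos α * D 0 - Real.sin α * D 1 - Real.cos α * D' 0 - Real.sin α * D' 1)) ∨
    ∀ ψ, ip (ψ - α) D = ip (ψ + α) D' := by
  by_cases hne : Real.cos α * D' 1 - Real.sin α * D 0 - Real.cos α * D 1 - Real.sin α * D' 0 ≠ 0 ∨
      Real.cos α * D 0 - Real.sin α * D 1 - Real.cos α * D' 0 - Real.sin α * D' 1 ≠ 0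
  · refine Or.inl (eq_keyAngle hne hφ ?_)
    have := crossing_formula D D' φ α
    linarith
  · push Not at hne
    refine Or.inr fun ψ => ?_
    have := crossing_formula D D' ψ α
    rw [hne.1, hne.2] at this
    linarith

/-- Set the direction to the one with key `11`, turned by `-α`. -/
def leftDirProg : Prog :=
  rlet 12 (.lit 0 -ᵣ rvar 11) ;; rlet 13 (.sqrt (.lit 1 -ᵣ rvar 11 *ᵣ rvar 11)) ;;
  rlet 6 (rvar 4 *ᵣ rvar 12 +ᵣ rvar 5 *ᵣ rvar 13) ;;
  rlet 7 (rvar 4 *ᵣ rvar 13 -ᵣ rvar 5 *ᵣ rvar 12)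

/-- Store the first vector of the slot and set the direction to the one with key `11`, turned by
`α`. -/
def storeLeftProg : Prog :=
  .setReal 24 (nvar 5) (.get 1 (nvar 7) -ᵣ .get 1 (nvar 8)) ;;
  .setReal 25 (nvar 5) (.get 2 (nvar 7) -ᵣ .get 2 (nvar 8)) ;;
  rlet 6 (rvar 4 *ᵣ rvar 12 -ᵣ rvar 5 *ᵣ rvar 13) ;;
  rlet 7 (rvar 4 *ᵣ rvar 13 +ᵣ rvar 5 *ᵣ rvar 12)

/-- Store the second vector of the slot and prepare the computation of the crossing. -/
def storeRightProg : Prog :=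
  .setReal 26 (nvar 5) (.get 1 (nvar 7) -ᵣ .get 1 (nvar 8)) ;;
  .setReal 27 (nvar 5) (.get 2 (nvar 7) -ᵣ .get 2 (nvar 8)) ;;
  rlet 8 (rvar 4 *ᵣ .get 27 (nvar 5) -ᵣ rvar 5 *ᵣ .get 24 (nvar 5) -ᵣ
    rvar 4 *ᵣ .get 25 (nvar 5) -ᵣ rvar 5 *ᵣ .get 26 (nvar 5)) ;;
  rlet 9 (rvar 4 *ᵣ .get 24 (nvar 5) -ᵣ rvar 5 *ᵣ .get 25 (nvar 5) -ᵣ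
    rvar 4 *ᵣ .get 26 (nvar 5) -ᵣ rvar 5 *ᵣ .get 27 (nvar 5))

/-- Store the block of events of the slot. -/
def storeBlockProg : Prog :=
  .setReal 28 (nvar 5) (rvar 11) ;; .setReal 29 (nvar 5) (rvar 10) ;;
  .setReal 20 (nvar 6) (.lit (-1)) ;;
  .branch (.realLe (rvar 11) (rvar 10))
    (.setReal 20 (nvar 6 +ₙ .lit 1) (rvar 11) ;; .setNat 20 (nvar 6 +ₙ .lit 1) (nvar 5) ;;
      .setReal 20 (nvar 6 +ₙ .lit 2) (rvar 10))
    (.setReal 20 (nvar 6 +ₙ .lit 1) (rvar 10) ;; .setReal 20 (nvar 6 +ₙ .lit 2) (rvar 11) ;;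
      .setNat 20 (nvar 6 +ₙ .lit 2) (nvar 5)) ;;
  incr 5 ;; nlet 6 (nvar 6 +ₙ .lit 3)

/-- Add the slot with key `11` to the table. -/
def slotProg : Prog :=
  leftDirProg ;; widthProg ;; storeLeftProg ;; widthProg ;; storeRightProg ;; keyProg ;;
    storeBlockProg

theorem leftDirProg_run {s : State} (h : Env v p s) {κ : ℝ} (hκ : κ ∈ Ico (-1) 1)
    (h11 : s.real 11 0 = κ) :
    HasDir (leftDirProg.run s) (keyAngle κ - criticalAngle v) ∧
    (leftDirProg.run s).real 12 0 = Real.cos (keyAngle κ) ∧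
    (leftDirProg.run s).real 13 0 = Real.sin (keyAngle κ) := by
  rw [HasDir, Real.cos_sub, Real.sin_sub, cos_keyAngle hκ, sin_keyAngle]
  simp [leftDirProg, Prog.run, State.real_setReal, RExp.eval, NExp.eval, h11, h.cosα, h.sinα]
  constructor <;> ring

theorem storeLeftProg_run {s : State} (h : Env v p s) {φ : ℝ} (h12 : s.real 12 0 = Real.cos φ)
    (h13 : s.real 13 0 = Real.sin φ) : HasDir (storeLeftProg.run s) (φ + criticalAngle v) := by
  rw [HasDir, Real.cos_add, Real.sin_add]
  simp [storeLeftProg, Prog.run, State.real_setReal, State.nat_setReal, RExp.eval,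
      NExp.eval, h12, h13,
    h.cosα, h.sinα]
  constructor <;> ring

end Highway

/-! ### Correctness of the computation of one slot. -/

namespace Highway

open RealRAM

variable {n : ℕ} {v : ℝ} {p : Fin n → Plane}

/-- The part of `slotProg` that follows the search for extreme points. -/
def slotTail : Prog := storeRightProg ;; keyProg ;; storeBlockProg

/-- The new block has the keys `-1`, `min κ cr`, `max κ cr`, and the tag `m` sits at the entry that
holds `κ`. The leading `-1` only fills the block up to three entries. -/
theorem slotTail_run {s : State} (h : Env v p s) {m b : ℕ} (h5 : s.nat 5 0 = m)
    (h6 : s.nat 6 0 = b) {κ cr : ℝ} (h11 : s.real 11 0 = κ) {i j : Fin n} (h7 : s.nat 7 0 = i)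
    (h8 : s.nat 8 0 = j) {D D' : Plane} (hD : D = vecs s 24 25 m) (hD' : D' = p i - p j)
    (hcr : cr = keyOf (Real.cos (criticalAngle v) * D' 1 - Real.sin (criticalAngle v) * D 0 -
        Real.cos (criticalAngle v) * D 1 - Real.sin (criticalAngle v) * D' 0)
      (Real.cos (criticalAngle v) * D 0 - Real.sin (criticalAngle v) * D 1 -
        Real.cos (criticalAngle v) * D' 0 - Real.sin (criticalAngle v) * D' 1)) :
    (∀ k, (slotTail.run s).real 26 k = if k = m then D' 0 else s.real 26 k) ∧
    (∀ k, (slotTail.run s).real 27 k = if k = m then D' 1 else s.real 27 k) ∧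
    (∀ k, (slotTail.run s).real 28 k = if k = m then κ else s.real 28 k) ∧
    (∀ k, (slotTail.run s).real 29 k = if k = m then cr else s.real 29 k) ∧
    (∀ k, (slotTail.run s).real 20 k = if k = b + 2 then max κ cr else
      if k = b + 1 then min κ cr else if k = b then -1 else s.real 20 k) ∧
    (∀ k, (slotTail.run s).nat 20 k = if k = (if κ ≤ cr then b + 1 else b + 2) then m
      else s.nat 20 k) ∧
    (slotTail.run s).nat 5 0 = m + 1 ∧ (slotTail.run s).nat 6 0 = b + 3 := by
  have e1 : s.real 1 i - s.real 1 j = D' 0 := by rw [h.xs, h.xs, hD']; rfl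
  have e2 : s.real 2 i - s.real 2 j = D' 1 := by rw [h.ys, h.ys, hD']; rfl
  have e3 : s.real 24 m = D 0 := by rw [hD]; rfl
  have e4 : s.real 25 m = D 1 := by rw [hD]; rfl
  have e5 : κ ≤ cr → max κ cr = cr ∧ min κ cr = κ := fun h => ⟨max_eq_right h, min_eq_left h⟩
  have e6 : ¬ κ ≤ cr → max κ cr = κ ∧ min κ cr = cr := fun h =>
    ⟨max_eq_left (not_le.1 h).le, min_eq_right (not_le.1 h).le⟩
  by_cases hle : κ ≤ cr <;> first | rw [(e5 hle).1, (e5 hle).2] | rw [(e6 hle).1, (e6 hle).2]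
  all_goals simp [slotTail, storeRightProg, storeBlockProg, Prog.run, keyProg_run, State.real_setReal,
    State.nat_setReal, State.real_setNat, State.nat_setNat, RExp.eval, NExp.eval, Test.Holds, h5, h6, h7, h8, h11,
    h.cosα, h.sinα, e1, e2, e3, e4, ← hcr, hle]

theorem slotProg_eq :
    slotProg = leftDirProg ;; widthProg ;; storeLeftProg ;; widthProg ;; slotTail := rfl

theorem slotProg_spec : ∃ c : ℕ, ∀ {n : ℕ} {v : ℝ} {p : Fin n → Plane} {s : State} {m B : ℕ}
    {κ : ℝ}, 0 < n → (∀ φ, 0 ≤ envelope v p φ) → SlotState v p m B s → κ ∈ Ico (-1 : ℝ) 1 →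
    s.real 11 0 = κ → Runs slotProg s (c * n) fun s' => SlotState v p (m + 1) (B + 1) s' ∧
      s'.real 28 m = κ ∧ (∀ t < m, s'.real 28 t = s.real 28 t) ∧ slotProg.Frame s s' := by
  obtain ⟨cw, hw⟩ := widthProg_spec
  refine ⟨leftDirProg.bound + (cw + (storeLeftProg.bound + (cw + slotTail.bound))),
    fun {n v p s m B κ} hn hz hS hκ h11 => ?_⟩
  suffices hR : Runs slotProg s
      (leftDirProg.bound + (cw * n + (storeLeftProg.bound + (cw * n + slotTail.bound)))) fun s' =>
      SlotState v p (m + 1) (B + 1) s' ∧ s'.real 28 m = κ ∧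
        ∀ t < m, s'.real 28 t = s.real 28 t by
    refine hR.frame.mono ?_ fun s' h => ⟨h.1.1, h.1.2.1, h.1.2.2, h.2⟩
    have h1 := Nat.le_mul_of_pos_right leftDirProg.bound hn
    have h2 := Nat.le_mul_of_pos_right storeLeftProg.bound hn
    have h3 := Nat.le_mul_of_pos_right slotTail.bound hn
    simp only [add_mul]
    omega
  rw [slotProg_eq]
  obtain ⟨hd1, h12, h13⟩ := leftDirProg_run hS.env hκ h11
  have hf1 := Prog.frame_run (P := leftDirProg) rfl s
  set s₁ := leftDirProg.run s
  have hE1 := hS.env.frame hf1 (by decide) (by decide)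
  refine (Runs.of_loopFree rfl s (Q := fun s' => s' = s₁) rfl).seq ?_
  rintro _ rfl
  refine (hw hn hE1 hd1).seq ?_
  rintro s₂ ⟨⟨a, b, h7, h8, ha, hb⟩, hf2⟩
  have hE2 := hE1.frame hf2 (by decide) (by decide)
  have hd3 := storeLeftProg_run hE2 (φ := keyAngle κ) (by rw [hf2.2 12 (by decide), h12])
    (by rw [hf2.2 13 (by decide), h13])
  have hf3 := Prog.frame_run (P := storeLeftProg) rfl s₂
  have h25 : s₂.nat 5 0 = m := by rw [hf2.1 5 (by decide), hf1.1 5 (by decide), hS.slot]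
  have h324 : ∀ k, (storeLeftProg.run s₂).real 24 k =
      if k = m then (p a - p b) 0 else s.real 24 k := by
    intro k
    rw [← hf1.2 24 (by decide), ← hf2.2 24 (by decide)]
    simp [storeLeftProg, Prog.run, State.real_setReal, State.nat_setReal, RExp.eval,
      NExp.eval, h7, h8,
      h25, hE2.xs]
  have h325 : ∀ k, (storeLeftProg.run s₂).real 25 k =
      if k = m then (p a - p b) 1 else s.real 25 k := by
    intro k
    rw [← hf1.2 25 (by decide), ← hf2.2 25 (by decide)]
    simp [storeLeftProg, Prog.run, State.real_setReal, State.nat_setReal, RExp.eval,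
      NExp.eval, h7, h8,
      h25, hE2.ys]
  set s₃ := storeLeftProg.run s₂
  have hE3 := hE2.frame hf3 (by decide) (by decide)
  refine (Runs.of_loopFree rfl s₂ (Q := fun s' => s' = s₃) rfl).seq ?_
  rintro _ rfl
  refine (hw hn hE3 hd3).seq ?_
  rintro s₄ ⟨⟨a', b', h7', h8', ha', hb'⟩, hf4⟩
  have hE4 := hE3.frame hf4 (by decide) (by decide)
  have h45 : s₄.nat 5 0 = m := by rw [hf4.1 5 (by decide), hf3.1 5 (by decide), h25]
  have hnat : ∀ A, A ∉ leftDirProg.natWrites → A ∉ widthProg.natWrites →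
      A ∉ storeLeftProg.natWrites → s₄.nat A = s.nat A := fun A i1 i2 i3 => by
    rw [hf4.1 A i2, hf3.1 A i3, hf2.1 A i2, hf1.1 A i1]
  have hreal : ∀ A, A ∉ leftDirProg.realWrites → A ∉ widthProg.realWrites →
      A ∉ storeLeftProg.realWrites → s₄.real A = s.real A := fun A i1 i2 i3 => by
    rw [hf4.2 A i2, hf3.2 A i3, hf2.2 A i2, hf1.2 A i1]
  have h46 : s₄.nat 6 0 = 3 * B := by
    rw [hnat 6 (by decide) (by decide) (by decide), hS.base]
  have h411 : s₄.real 11 0 = κ := by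
    rw [hreal 11 (by decide) (by decide) (by decide), h11]
  have hD : p a - p b = vecs s₄ 24 25 m := by
    ext i
    fin_cases i
    · simp [vecs, hf4.2 24 (by decide), h324]
    · simp [vecs, hf4.2 25 (by decide), h325]
  obtain ⟨g26, g27, g28, g29, g20, gT, g5, g6⟩ :=
    slotTail_run hE4 h45 h46 h411 h7' h8' hD rfl rfl
  have hf5 := Prog.frame_run (P := slotTail) rfl s₄
  refine Runs.of_loopFree rfl s₄ ?_
  set s₅ := slotTail.run s₄
  have g24 : ∀ k, s₅.real 24 k = if k = m then (p a - p b) 0 else s.real 24 k := fun k => by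
    rw [hf5.2 24 (by decide), hf4.2 24 (by decide), h324]
  have g25 : ∀ k, s₅.real 25 k = if k = m then (p a - p b) 1 else s.real 25 k := fun k => by
    rw [hf5.2 25 (by decide), hf4.2 25 (by decide), h325]
  have g21 : s₅.real 21 = s.real 21 := by
    rw [hf5.2 21 (by decide), hreal 21 (by decide) (by decide) (by decide)]
  rw [hreal 26 (by decide) (by decide) (by decide)] at g26
  rw [hreal 27 (by decide) (by decide) (by decide)] at g27
  rw [hreal 28 (by decide) (by decide) (by decide)] at g28
  rw [hreal 29 (by decide) (by decide) (by decide)] at g29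
  rw [hreal 20 (by decide) (by decide) (by decide)] at g20
  rw [hnat 20 (by decide) (by decide) (by decide)] at gT
  set cr := keyOf _ _ with hcr
  have hcrm : cr ∈ Ico (-1 : ℝ) 1 := keyOf_mem _ _
  clear_value cr
  have v1 : ∀ t < m, vecs s₅ 24 25 t = vecs s 24 25 t := fun t ht => by
    rw [vecs, g24, g25, if_neg ht.ne, if_neg ht.ne, vecs]
  have v2 : ∀ t < m, vecs s₅ 26 27 t = vecs s 26 27 t := fun t ht => by
    rw [vecs, g26, g27, if_neg ht.ne, if_neg ht.ne, vecs]
  have v1m : vecs s₅ 24 25 m = p a - p b := by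
    ext i; fin_cases i <;> simp [vecs, g24, g25]
  have v2m : vecs s₅ 26 27 m = p a' - p b' := by
    ext i; fin_cases i <;> simp [vecs, g26, g27]
  have k1 : ∀ t < m, s₅.real 28 t = s.real 28 t ∧ s₅.real 29 t = s.real 29 t := fun t ht => by
    rw [g28, g29, if_neg ht.ne, if_neg ht.ne]; exact ⟨rfl, rfl⟩
  have k1m : s₅.real 28 m = κ ∧ s₅.real 29 m = cr := by
    rw [g28, g29, if_pos rfl, if_pos rfl]; exact ⟨rfl, rfl⟩
  refine ⟨⟨hE4.frame hf5 (by decide) (by decide), g5, by rw [g6]; ring, ?_, ?_⟩, k1m.1,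
    fun t ht => (k1 t ht).1⟩
  · constructor
    · intro t ht
      rcases Nat.lt_succ_iff_lt_or_eq.1 ht with ht | rfl
      · rw [(k1 t ht).1]; exact hS.rows.key_mem t ht
      · rw [k1m.1]; exact hκ
    · intro t ht
      rcases Nat.lt_succ_iff_lt_or_eq.1 ht with ht | rfl
      · rw [(k1 t ht).1, v1 t ht]; exact hS.rows.left t ht
      · rw [k1m.1, v1m]; exact ⟨a, b, rfl, ha, hb⟩
    · intro t ht
      rcases Nat.lt_succ_iff_lt_or_eq.1 ht with ht | rfl
      · rw [(k1 t ht).1, v2 t ht]; exact hS.rows.right t ht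
      · rw [k1m.1, v2m]; exact ⟨a', b', rfl, ha', hb'⟩
    · intro t ht
      rcases Nat.lt_succ_iff_lt_or_eq.1 ht with ht | rfl
      · rw [(k1 t ht).2, v1 t ht, v2 t ht]; exact hS.rows.crossing t ht
      · rw [k1m.2, v1m, v2m, hcr]
        exact fun φ hφ h => crossing_of_keyOf hφ h
  · have hr0 := hS.blocks.rest
    have j2 : s₅.real 20 (3 * B + 2) = max κ cr := by rw [g20, if_pos rfl]
    have j1 : s₅.real 20 (3 * B + 1) = min κ cr := by
      rw [g20, if_neg (by omega), if_pos rfl]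
    have j0 : s₅.real 20 (3 * B) = -1 := by
      rw [g20, if_neg (by omega), if_neg (by omega), if_pos rfl]
    have jmin : min κ cr ∈ Ico (-1 : ℝ) 1 := ⟨le_min hκ.1 hcrm.1, min_lt_of_left_lt hκ.2⟩
    have jmax : max κ cr ∈ Ico (-1 : ℝ) 1 := ⟨le_max_of_le_left hκ.1, max_lt hκ.2 hcrm.2⟩
    have hkey : ∃ i, 1 ≤ i ∧ i < 3 ∧ s₅.real 20 (3 * B + i) = κ ∧
        3 * B + i = (if κ ≤ cr then 3 * B + 1 else 3 * B + 2) := by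
      by_cases hle : κ ≤ cr
      · exact ⟨1, by omega, by omega, by rw [j1, min_eq_left hle], by rw [if_pos hle]⟩
      · exact ⟨2, by omega, by omega, by rw [j2, max_eq_left (not_le.1 hle).le], by rw [if_neg hle]⟩
    have hcross : ∃ i < 3, s₅.real 20 (3 * B + i) = cr := by
      by_cases hle : κ ≤ cr
      · exact ⟨2, by omega, by rw [j2, max_eq_right hle]⟩
      · exact ⟨1, by omega, by rw [j1, min_eq_right (not_le.1 hle).le]⟩
    obtain ⟨i₀, hi1, hi3, hiκ, hie⟩ := hkey
    rw [← hie] at gT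
    refine hS.blocks.add (Nat.le_succ m) k1 (fun j hj => ⟨?_, by rw [g21], ?_⟩) ?_ ?_ ?_ ?_ ?_
    · rw [g20, if_neg (by omega), if_neg (by omega), if_neg (by omega)]
    · rw [gT, if_neg (by omega)]
    · intro i hi
      interval_cases i
      · rw [add_zero, j0]; norm_num
      · rw [j1]; exact jmin
      · rw [j2]; exact jmax
    · rw [j0, j1, j2]
      exact ⟨jmin.1, min_le_max⟩
    · intro i hi hne
      rw [gT] at hne ⊢
      split_ifs at hne ⊢ with hc
      · have : i = i₀ := by omega
        subst this
        exact ⟨Nat.lt_succ_self m, by rw [hiκ, k1m.1]⟩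
      · exact absurd (hr0 _ (by omega)).2.2 hne
    · intro t ht1 ht2
      obtain rfl : t = m := by omega
      rw [k1m.1, k1m.2]
      exact ⟨⟨i₀, hi3, hiκ, by rw [gT, if_pos rfl]⟩, hcross⟩
    -- The values of this block stay `0`: a slot contributes events but no step function, and `0` is
    -- below `z`.
    · intro φ _
      rw [stepVal_eq_zero fun i hi => ?_]
      · exact hz φ
      · rw [g21]; exact (hr0 _ (by omega)).2.1

end Highway

namespace Highway

open RealRAM

/-! ### The table of slots -/

variable {n : ℕ} {v : ℝ} {p : Fin n → Plane}

/-- The orientations that are perpendicular, up to the angle `α`, to the pivot edges of the first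
`k` points are among the keys of the slots. -/
def PivotsCovered (v : ℝ) (p : Fin n → Plane) (k m : ℕ) (κ : ℕ → ℝ) : Prop :=
  ∀ i : Fin n, (i : ℕ) < k → ∃ j, IsPivot p i j ∧ ∀ φ ∈ Ico 0 Real.pi,
    (ip (φ - criticalAngle v) (p j - p i) = 0 ∨ ip (φ + criticalAngle v) (p j - p i) = 0) →
      ∃ t < m, φ = keyAngle (κ t)

/-- `ip (φ - α) d = 0` says that `φ` is parallel to `d` turned by `α + π / 2`. The form `0 - …`
mirrors the program, which has no negation. -/
theorem eq_keyAngle_of_ip_sub {d : Plane} (hd : d ≠ 0) {φ α : ℝ} (hφ : φ ∈ Ico 0 Real.pi)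
    (h : ip (φ - α) d = 0) : φ = keyAngle (keyOf (0 - Real.sin α * d 0 - Real.cos α * d 1)
      (Real.cos α * d 0 - Real.sin α * d 1)) := by
  apply eq_keyAngle _ hφ
  · rw [ip, Real.cos_sub, Real.sin_sub] at h
    linear_combination h
  · by_contra hc
    push Not at hc
    have h1 := Real.cos_sq_add_sin_sq α
    apply hd
    ext i
    fin_cases i
    · change d 0 = 0
      linear_combination (-Real.sin α) * hc.1 + Real.cos α * hc.2 - d 0 * h1
    · change d 1 = 0
      linear_combination (-Real.cos α) * hc.1 - Real.sin α * hc.2 - d 1 * h1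

theorem eq_keyAngle_of_ip_add {d : Plane} (hd : d ≠ 0) {φ α : ℝ} (hφ : φ ∈ Ico 0 Real.pi)
    (h : ip (φ + α) d = 0) : φ = keyAngle (keyOf (Real.sin α * d 0 - Real.cos α * d 1)
      (Real.cos α * d 0 + Real.sin α * d 1)) := by
  have := eq_keyAngle_of_ip_sub hd (α := -α) hφ (by rwa [sub_neg_eq_add])
  rw [this, Real.cos_neg, Real.sin_neg]
  congr 2 <;> ring

/-- Compute the key at which the first width changes at the pivot edge. -/
def pivotKeyLeft : Prog :=
  rlet 14 (.get 1 (nvar 4) -ᵣ .get 1 (nvar 1)) ;; rlet 15 (.get 2 (nvar 4) -ᵣ .get 2 (nvar 1)) ;;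
  rlet 8 (.lit 0 -ᵣ rvar 5 *ᵣ rvar 14 -ᵣ rvar 4 *ᵣ rvar 15) ;;
  rlet 9 (rvar 4 *ᵣ rvar 14 -ᵣ rvar 5 *ᵣ rvar 15) ;; keyProg ;; rlet 11 (rvar 10)

/-- Compute the key at which the second width changes at the pivot edge. -/
def pivotKeyRight : Prog :=
  rlet 8 (rvar 5 *ᵣ rvar 14 -ᵣ rvar 4 *ᵣ rvar 15) ;;
  rlet 9 (rvar 4 *ᵣ rvar 14 +ᵣ rvar 5 *ᵣ rvar 15) ;; keyProg ;; rlet 11 (rvar 10)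

/-- Add the slots of a point. -/
def slotsBody : Prog :=
  pivotProg ;; pivotKeyLeft ;; slotProg ;; pivotKeyRight ;; slotProg ;; incr 1

/-- Add the slots of all points. -/
def slotsProg : Prog := nlet 1 (.lit 0) ;; .loop (.natLt (nvar 1) (nvar 0)) slotsBody

theorem pivotKeyLeft_run {s : State} (h : Env v p s) {i j : Fin n} (h1 : s.nat 1 0 = i)
    (h4 : s.nat 4 0 = j) : (pivotKeyLeft.run s).real 14 0 = (p j - p i) 0 ∧
    (pivotKeyLeft.run s).real 15 0 = (p j - p i) 1 ∧
    (pivotKeyLeft.run s).real 11 0 = keyOf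
      (0 - Real.sin (criticalAngle v) * (p j - p i) 0 -
        Real.cos (criticalAngle v) * (p j - p i) 1)
      (Real.cos (criticalAngle v) * (p j - p i) 0 -
        Real.sin (criticalAngle v) * (p j - p i) 1) := by
  simp [pivotKeyLeft, Prog.run, keyProg_run, State.real_setReal, State.nat_setReal, RExp.eval,
    NExp.eval, h1, h4, h.cosα, h.sinα, h.xs, h.ys]

theorem pivotKeyRight_run {s : State} (h : Env v p s) {d : Plane} (h14 : s.real 14 0 = d 0)
    (h15 : s.real 15 0 = d 1) : (pivotKeyRight.run s).real 11 0 = keyOf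
      (Real.sin (criticalAngle v) * d 0 - Real.cos (criticalAngle v) * d 1)
      (Real.cos (criticalAngle v) * d 0 + Real.sin (criticalAngle v) * d 1) := by
  simp [pivotKeyRight, Prog.run, keyProg_run, State.real_setReal, RExp.eval,
    NExp.eval, h14, h15, h.cosα, h.sinα]

theorem SlotState.frame {m B : ℕ} {s s' : State} (h : SlotState v p m B s) {P : Prog}
    (hf : P.Frame s s') (h0 : ∀ A ∈ [0, 5, 6, 20], A ∉ P.natWrites)
    (h1 : ∀ A ∈ [1, 2, 4, 5, 20, 21, 24, 25, 26, 27, 28, 29], A ∉ P.realWrites) :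
    SlotState v p m B s' := by
  have hn := fun A hA => hf.1 A (h0 A hA)
  have hr := fun A hA => hf.2 A (h1 A hA)
  have e1 : vecs s' 24 25 = vecs s 24 25 := by
    ext1 t; rw [vecs, vecs, hr 24 (by simp), hr 25 (by simp)]
  have e2 : vecs s' 26 27 = vecs s 26 27 := by
    ext1 t; rw [vecs, vecs, hr 26 (by simp), hr 27 (by simp)]
  constructor
  · exact h.env.frame hf (h0 0 (by simp)) fun A hA => h1 A (by simp at hA ⊢; omega)
  · rw [hn 5 (by simp)]; exact h.slot
  · rw [hn 6 (by simp)]; exact h.base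
  · rw [hr 28 (by simp), hr 29 (by simp), e1, e2]; exact h.rows
  · rw [hr 28 (by simp), hr 29 (by simp), hr 20 (by simp), hr 21 (by simp), hn 20 (by simp)]
    exact h.blocks

/-- The invariant of the loop of `slotsProg`. -/
def SlotsInv (v : ℝ) (p : Fin n → Plane) (k : ℕ) (s : State) : Prop :=
  SlotState v p (1 + 2 * k) (1 + 2 * k) s ∧ s.nat 1 0 = k ∧ s.real 28 0 = -1 ∧
    PivotsCovered v p k (1 + 2 * k) (s.real 28)

/-- Every point adds two slots, one for each of the two widths, to the initial slot of orientation
`0`; hence `1 + 2 * k`. Recomputing the extreme points costs `O(n)` per slot, which is affordable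
for `O(n)` slots. -/
theorem slotsBody_spec : ∃ c : ℕ, ∀ {n : ℕ} {v : ℝ} {p : Fin n → Plane} {s : State} {k : ℕ},
    2 ≤ n → Function.Injective p → (∀ φ, 0 ≤ envelope v p φ) → k < n → SlotsInv v p k s →
    Runs slotsBody s (c * n) (SlotsInv v p (k + 1)) := by
  obtain ⟨cp, hpv⟩ := pivotProg_spec
  obtain ⟨cs, hsl⟩ := slotProg_spec
  refine ⟨cp + (pivotKeyLeft.bound + (cs + (pivotKeyRight.bound + (cs + (incr 1).bound)))),
    fun {n v p s k} hn hp hz hk hI => ?_⟩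
  obtain ⟨hS, h1, h280, hcov⟩ := hI
  suffices hR : Runs slotsBody s (cp * n + (pivotKeyLeft.bound + (cs * n + (pivotKeyRight.bound +
      (cs * n + (incr 1).bound))))) (SlotsInv v p (k + 1)) by
    refine hR.mono ?_ fun _ h => h
    have h1 := Nat.le_mul_of_pos_right pivotKeyLeft.bound (show 0 < n by omega)
    have h2 := Nat.le_mul_of_pos_right pivotKeyRight.bound (show 0 < n by omega)
    have h3 := Nat.le_mul_of_pos_right (incr 1).bound (show 0 < n by omega)
    simp only [add_mul]
    omega
  refine (hpv hn hS.env (i := ⟨k, hk⟩) h1).seq ?_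
  rintro s₁ ⟨⟨j, h4, hj⟩, hf1⟩
  have hS1 := hS.frame hf1 (by decide) (by decide)
  have h11 : s₁.nat 1 0 = k := by rw [hf1.1 1 (by decide), h1]
  set i : Fin n := ⟨k, hk⟩
  have hd : p j - p i ≠ 0 := sub_ne_zero.2 (hp.ne hj.1)
  obtain ⟨g14, g15, g11⟩ := pivotKeyLeft_run hS1.env (i := i) h11 h4
  have hf2 := Prog.frame_run (P := pivotKeyLeft) rfl s₁
  set s₂ := pivotKeyLeft.run s₁
  refine (Runs.of_loopFree rfl s₁ (Q := fun s' => s' = s₂) rfl).seq ?_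
  rintro _ rfl
  have hS2 := hS1.frame hf2 (by decide) (by decide)
  refine (hsl (by omega) hz hS2 (keyOf_mem _ _) g11).seq ?_
  rintro s₃ ⟨hS3, hκ3, hlt3, hf3⟩
  have k11 := pivotKeyRight_run hS3.env (d := p j - p i) (by rw [hf3.2 14 (by decide), g14])
    (by rw [hf3.2 15 (by decide), g15])
  have hf4 := Prog.frame_run (P := pivotKeyRight) rfl s₃
  set s₄ := pivotKeyRight.run s₃
  refine (Runs.of_loopFree rfl s₃ (Q := fun s' => s' = s₄) rfl).seq ?_
  rintro _ rfl
  have hS4 := hS3.frame hf4 (by decide) (by decide)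
  refine (hsl (by omega) hz hS4 (keyOf_mem _ _) k11).seq ?_
  rintro s₅ ⟨hS5, hκ5, hlt5, hf5⟩
  refine Runs.of_loopFree rfl s₅ ?_
  have hf6 := Prog.frame_run (P := incr 1) rfl s₅
  have hm : 1 + 2 * (k + 1) = 1 + 2 * k + 1 + 1 := by ring
  have e51 : s₅.nat 1 0 = k := by
    rw [hf5.1 1 (by decide), hf4.1 1 (by decide), hf3.1 1 (by decide), hf2.1 1 (by decide), h11]
  have e28 : ∀ t < 1 + 2 * k, ((incr 1).run s₅).real 28 t = s.real 28 t := fun t ht => by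
    rw [hf6.2 28 (by decide), hlt5 t (by omega), hf4.2 28 (by decide), hlt3 t ht,
      hf2.2 28 (by decide), hf1.2 28 (by decide)]
  have ea : ((incr 1).run s₅).real 28 (1 + 2 * k) = s₂.real 11 0 := by
    rw [hf6.2 28 (by decide), hlt5 _ (by omega), hf4.2 28 (by decide), hκ3, g11]
  have eb : ((incr 1).run s₅).real 28 (1 + 2 * k + 1) = s₄.real 11 0 := by
    rw [hf6.2 28 (by decide), hκ5, k11]
  refine ⟨?_, ?_, ?_, fun i' hi' => ?_⟩
  · rw [hm]; exact hS5.frame hf6 (by decide) (by decide)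
  · simp [Prog.run, State.nat_setNat, NExp.eval, e51]
  · rw [e28 0 (by omega), h280]
  · rcases Nat.lt_succ_iff_lt_or_eq.1 hi' with hi' | hi'
    · obtain ⟨j', h5, h6⟩ := hcov i' hi'
      refine ⟨j', h5, fun φ hφ h => ?_⟩
      obtain ⟨t, ht, h7⟩ := h6 φ hφ h
      exact ⟨t, by omega, by rw [e28 t ht]; exact h7⟩
    · obtain rfl : i' = i := Fin.ext hi'
      refine ⟨j, hj, fun φ hφ h => ?_⟩
      rcases h with h | h
      · exact ⟨1 + 2 * k, by omega, by rw [ea, g11]; exact eq_keyAngle_of_ip_sub hd hφ h⟩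
      · exact ⟨1 + 2 * k + 1, by omega, by rw [eb, k11]; exact eq_keyAngle_of_ip_add hd hφ h⟩

theorem slotsProg_spec : ∃ c : ℕ, ∀ {n : ℕ} {v : ℝ} {p : Fin n → Plane} {s : State},
    2 ≤ n → Function.Injective p → (∀ φ, 0 ≤ envelope v p φ) → SlotState v p 1 1 s →
    s.real 28 0 = -1 → Runs slotsProg s (c * n ^ 2) fun s' =>
      SlotState v p (1 + 2 * n) (1 + 2 * n) s' ∧ IsSlotTable v p (1 + 2 * n) (s'.real 28)
        (s'.real 29) (vecs s' 24 25) (vecs s' 26 27) := by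
  obtain ⟨c, hc⟩ := slotsBody_spec
  refine ⟨(nlet 1 (.lit 0)).bound + 2 * ((Test.natLt (nvar 1) (nvar 0)).cost + c + 1),
    fun {n v p s} hn hp hz hS h28 => ?_⟩
  have hf := Prog.frame_run (P := nlet 1 (.lit 0)) rfl s
  refine (Runs.init_loop (P₀ := nlet 1 (.lit 0)) rfl (c * n) n (SlotsInv v p)
    ⟨hS.frame hf (by decide) (by decide), rfl, h28, fun i hi => absurd hi (Nat.not_lt_zero _)⟩
    (fun k hk s₂ _ hI => ⟨?_, hc hn hp hz hk hI⟩) (fun s₂ _ hI => ?_)).mono ?_ ?_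
  · simp only [Test.Holds, NExp.eval, hI.1.env.count, hI.2.1]; exact hk
  · simp only [Test.Holds, NExp.eval, hI.1.env.count, hI.2.1]; exact lt_irrefl _
  · set a := (nlet 1 (.lit 0)).bound
    set b := (Test.natLt (nvar 1) (nvar 0)).cost
    have h1 : b + c * n + 1 ≤ (b + c + 1) * n := by nlinarith
    have h2 : n ≤ n ^ 2 := by nlinarith
    nlinarith [Nat.mul_le_mul_left n h1, Nat.mul_le_mul_left a h2, Nat.mul_le_mul_left (b + 1) h2]
  · rintro s₂ ⟨⟨h1, -, h2, h3⟩, -⟩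
    refine ⟨h1, ⟨by omega, h2, h1.rows.key_mem, h1.rows.left, h1.rows.right, h1.rows.crossing, ?_⟩⟩
    choose J hJ using fun i : Fin n => h3 i i.2
    exact ⟨J, fun i => (hJ i).1, fun φ hφ i => (hJ i).2 φ hφ⟩

end Highway

namespace Highway

open RealRAM

/-! ### The step functions of the pairs of points -/

variable {n : ℕ} {v : ℝ} {p : Fin n → Plane}

/-- Add the block of the pair of points with the indices `1` and `2`. -/
def pairProg : Prog :=
  rlet 14 (.get 1 (nvar 1) -ᵣ .get 1 (nvar 2)) ;; rlet 15 (.get 2 (nvar 1) -ᵣ .get 2 (nvar 2)) ;;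
  rlet 8 (rvar 4 *ᵣ rvar 14 -ᵣ rvar 5 *ᵣ rvar 15) ;;
  rlet 9 (rvar 5 *ᵣ rvar 14 +ᵣ rvar 4 *ᵣ rvar 15) ;; keyProg ;; rlet 16 (rvar 10) ;;
  rlet 8 (rvar 4 *ᵣ rvar 14 +ᵣ rvar 5 *ᵣ rvar 15) ;;
  rlet 9 (.lit 0 -ᵣ rvar 5 *ᵣ rvar 14 +ᵣ rvar 4 *ᵣ rvar 15) ;; keyProg ;; rlet 17 (rvar 10) ;;
  rlet 13 (.sqrt (rvar 14 *ᵣ rvar 14 +ᵣ rvar 15 *ᵣ rvar 15)) ;;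
  .setReal 20 (nvar 6) (.lit (-1)) ;;
  .branch (.realLt (rvar 16) (rvar 17))
    (.setReal 20 (nvar 6 +ₙ .lit 1) (rvar 16) ;; .setReal 21 (nvar 6 +ₙ .lit 1) (rvar 13) ;;
      .setReal 20 (nvar 6 +ₙ .lit 2) (rvar 17))
    (.setReal 21 (nvar 6) (rvar 13) ;; .setReal 20 (nvar 6 +ₙ .lit 1) (rvar 17) ;;
      .setReal 20 (nvar 6 +ₙ .lit 2) (rvar 16) ;; .setReal 21 (nvar 6 +ₙ .lit 2) (rvar 13)) ;;
  nlet 6 (nvar 6 +ₙ .lit 3) ;; incr 2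

/-- If the window does not wrap around, the block is `(-1, 0), (κ, L), (κ', 0)`; otherwise it is
`(-1, L), (κ', 0), (κ, L)`, with `L` the distance. The middle and last keys are the minimum and the
maximum in both cases. -/
theorem pairProg_run {s : State} (h : Env v p s) {b : ℕ} (h6 : s.nat 6 0 = b) {i j : Fin n}
    (h1 : s.nat 1 0 = i) (h2 : s.nat 2 0 = j) {κ κ' : ℝ}
    (hκ : κ = keyOf
      (Real.cos (criticalAngle v) * (p i - p j) 0 - Real.sin (criticalAngle v) * (p i - p j) 1)
      (Real.sin (criticalAngle v) * (p i - p j) 0 + Real.cos (criticalAngle v) * (p i - p j) 1))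
    (hκ' : κ' = keyOf
      (Real.cos (criticalAngle v) * (p i - p j) 0 + Real.sin (criticalAngle v) * (p i - p j) 1)
      (-(Real.sin (criticalAngle v) * (p i - p j) 0) +
        Real.cos (criticalAngle v) * (p i - p j) 1)) :
    (∀ k, (pairProg.run s).real 20 k = if k = b + 2 then max κ κ' else
      if k = b + 1 then min κ κ' else if k = b then -1 else s.real 20 k) ∧
    (∀ k, (pairProg.run s).real 21 k =
      if κ < κ' then (if k = b + 1 then ‖p i - p j‖ else s.real 21 k)
      else (if k = b + 2 then ‖p i - p j‖ else if k = b then ‖p i - p j‖ else s.real 21 k)) ∧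
    (pairProg.run s).nat 6 0 = b + 3 ∧ (pairProg.run s).nat 2 0 = j + 1 := by
  have e1 : s.real 1 i - s.real 1 j = (p i - p j) 0 := by rw [h.xs, h.xs]; rfl
  have e2 : s.real 2 i - s.real 2 j = (p i - p j) 1 := by rw [h.ys, h.ys]; rfl
  have e3 : √((p i - p j) 0 * (p i - p j) 0 + (p i - p j) 1 * (p i - p j) 1) = ‖p i - p j‖ := by
    rw [← Real.sqrt_sq (norm_nonneg (p i - p j)), norm_sq_eq]; ring_nf
  have e5 : κ < κ' → max κ κ' = κ' ∧ min κ κ' = κ := fun h =>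
    ⟨max_eq_right h.le, min_eq_left h.le⟩
  have e6 : ¬ κ < κ' → max κ κ' = κ ∧ min κ κ' = κ' := fun h =>
    ⟨max_eq_left (not_lt.1 h), min_eq_right (not_lt.1 h)⟩
  generalize p i - p j = d at *
  by_cases hle : κ < κ' <;> first | rw [(e5 hle).1, (e5 hle).2] | rw [(e6 hle).1, (e6 hle).2]
  all_goals simp [pairProg, Prog.run, keyProg_run, State.real_setReal, State.nat_setReal,
    State.real_setNat, State.nat_setNat, RExp.eval, NExp.eval, Test.Holds, h6, h1, h2, h.cosα,
    h.sinα, e1, e2, e3, ← hκ, ← hκ', hle]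

/-- The step functions of all pairs up to `(k, l)` are stored in at most `N` blocks. -/
def PairState (v : ℝ) (p : Fin n → Plane) (m k l N : ℕ) (s : State) : Prop :=
  ∃ B ≤ N, SlotState v p m B s ∧ ∀ i j : Fin n, j < i →
    ((i : ℕ) < k ∨ (i : ℕ) = k ∧ (j : ℕ) < l) → ∃ b < B, ∀ φ ∈ Ico 0 Real.pi,
      pairDist v (p i) (p j) φ ≤ stepVal (s.real 20) (s.real 21) (3 * b) 3 (-Real.cos φ)

theorem pairProg_spec [NeZero n] (hv : 1 < v) (hp : Function.Injective p) {m N : ℕ} {s : State}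
    {i j : Fin n} (hji : j < i) (h1 : s.nat 1 0 = i) (h2 : s.nat 2 0 = j)
    (hS : PairState v p m i j N s) :
    PairState v p m i (j + 1) (N + 1) (pairProg.run s) ∧ (pairProg.run s).nat 2 0 = j + 1 := by
  obtain ⟨B, hB, hS, hcov⟩ := hS
  obtain ⟨κ, hκ⟩ : ∃ κ, κ = keyOf
    (Real.cos (criticalAngle v) * (p i - p j) 0 - Real.sin (criticalAngle v) * (p i - p j) 1)
    (Real.sin (criticalAngle v) * (p i - p j) 0 + Real.cos (criticalAngle v) * (p i - p j) 1) :=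
    ⟨_, rfl⟩
  obtain ⟨κ', hκ'⟩ : ∃ κ', κ' = keyOf
    (Real.cos (criticalAngle v) * (p i - p j) 0 + Real.sin (criticalAngle v) * (p i - p j) 1)
    (-(Real.sin (criticalAngle v) * (p i - p j) 0) +
      Real.cos (criticalAngle v) * (p i - p j) 1) := ⟨_, rfl⟩
  obtain ⟨g20, g21, g6, g2⟩ := pairProg_run hS.env hS.base h1 h2 hκ hκ'
  have hf := Prog.frame_run (P := pairProg) rfl s
  have hκm : κ ∈ Ico (-1 : ℝ) 1 := hκ ▸ keyOf_mem _ _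
  have hκm' : κ' ∈ Ico (-1 : ℝ) 1 := hκ' ▸ keyOf_mem _ _
  have hw := fun φ (hφ : φ ∈ Ico 0 Real.pi) =>
    windowVal_spec hv (hp.ne hji.ne') hφ hκ hκ'
  set s' := pairProg.run s
  have hr := hS.blocks.rest
  have j2 : s'.real 20 (3 * B + 2) = max κ κ' := by rw [g20, if_pos rfl]
  have j1 : s'.real 20 (3 * B + 1) = min κ κ' := by rw [g20, if_neg (by omega), if_pos rfl]
  have j0 : s'.real 20 (3 * B) = -1 := by
    rw [g20, if_neg (by omega), if_neg (by omega), if_pos rfl]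
  have jmin : min κ κ' ∈ Ico (-1 : ℝ) 1 := ⟨le_min hκm.1 hκm'.1, min_lt_of_left_lt hκm.2⟩
  have jmax : max κ κ' ∈ Ico (-1 : ℝ) 1 := ⟨le_max_of_le_left hκm.1, max_lt hκm.2 hκm'.2⟩
  have hold : ∀ k, (k < 3 * B ∨ 3 * B + 3 ≤ k) →
      s'.real 20 k = s.real 20 k ∧ s'.real 21 k = s.real 21 k := fun k hk => by
    rw [g20, g21, if_neg (by omega), if_neg (by omega), if_neg (by omega)]
    refine ⟨rfl, ?_⟩
    split_ifs <;> first | rfl | omega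
  -- For `-1 ≤ x` the first entry always applies, so the initial value `0` of `stepVal` is never
  -- reached.
  have hval : ∀ x, -1 ≤ x → stepVal (s'.real 20) (s'.real 21) (3 * B) 3 x =
      windowVal ‖p i - p j‖ κ κ' x := fun x hx => by
    have z0 := (hr (3 * B) (by omega)).2.1
    have z1 := (hr (3 * B + 1) (by omega)).2.1
    have z2 := (hr (3 * B + 2) (by omega)).2.1
    simp only [stepVal, add_zero, j0, j1, j2, if_pos hx, windowVal]
    by_cases hlt : κ < κ'
    · have q2 : s'.real 21 (3 * B + 2) = 0 := by rw [g21, if_pos hlt, if_neg (by omega), z2]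
      have q1 : s'.real 21 (3 * B + 1) = ‖p i - p j‖ := by rw [g21, if_pos hlt, if_pos rfl]
      have q0 : s'.real 21 (3 * B) = 0 := by rw [g21, if_pos hlt, if_neg (by omega), z0]
      rw [max_eq_right hlt.le, min_eq_left hlt.le, if_pos hlt, q0, q1, q2]
      rcases lt_or_ge x κ with h1 | h1
      · rw [if_pos h1, if_neg (by linarith), if_neg (by linarith)]
      · rcases lt_or_ge x κ' with h2 | h2
        · rw [if_neg (by linarith), if_pos h1, if_neg (by linarith), if_pos h2]
        · rw [if_pos h2, if_neg (by linarith), if_neg (by linarith)]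
    · have hle := not_lt.1 hlt
      have q2 : s'.real 21 (3 * B + 2) = ‖p i - p j‖ := by rw [g21, if_neg hlt, if_pos rfl]
      have q1 : s'.real 21 (3 * B + 1) = 0 := by
        rw [g21, if_neg hlt, if_neg (by omega), if_neg (by omega), z1]
      have q0 : s'.real 21 (3 * B) = ‖p i - p j‖ := by
        rw [g21, if_neg hlt, if_neg (by omega), if_pos rfl]
      rw [max_eq_left hle, min_eq_right hle, if_neg hlt, q0, q1, q2]
      rcases lt_or_ge x κ' with h1 | h1
      · rw [if_neg (by linarith), if_neg (by linarith), if_pos h1]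
      · rcases lt_or_ge x κ with h2 | h2
        · rw [if_neg (by linarith), if_pos h1, if_neg (by linarith), if_pos h2]
        · rw [if_pos h2, if_neg (by linarith), if_neg (by linarith)]
  have hnat : ∀ A, A ∉ pairProg.natWrites → s'.nat A = s.nat A := fun A hA => hf.1 A hA
  have e1 : vecs s' 24 25 = vecs s 24 25 := by
    ext1 t; rw [vecs, vecs, hf.2 24 (by decide), hf.2 25 (by decide)]
  have e2 : vecs s' 26 27 = vecs s 26 27 := by
    ext1 t; rw [vecs, vecs, hf.2 26 (by decide), hf.2 27 (by decide)]
  refine ⟨⟨B + 1, by omega, ⟨hS.env.frame hf (by decide) (by decide), ?_, by rw [g6]; ring, ?_, ?_⟩,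
    fun i' j' hji' hc => ?_⟩, g2⟩
  · rw [hnat 5 (by decide)]; exact hS.slot
  · rw [hf.2 28 (by decide), hf.2 29 (by decide), e1, e2]; exact hS.rows
  · rw [hf.2 28 (by decide), hf.2 29 (by decide), hnat 20 (by decide)]
    refine hS.blocks.add le_rfl (fun _ _ => ⟨rfl, rfl⟩)
      (fun k hk => ⟨(hold k hk).1, (hold k hk).2, rfl⟩) (fun l hl => ?_) ?_
      (fun l hl hne => absurd (hr _ (by omega)).2.2 hne) (fun t h1 h2 => by omega)
      fun φ hφ => ?_
    · interval_cases l
      · rw [add_zero, j0]; norm_num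
      · rw [j1]; exact jmin
      · rw [j2]; exact jmax
    · rw [j0, j1, j2]; exact ⟨jmin.1, min_le_max⟩
    · rw [hval _ (neg_cos_mem hφ).1]
      have := (envelope_le_iff hv p φ _).1 le_rfl i j
      exact (hw φ hφ).2.trans (max_le this.1 this.2)
  · by_cases hnew : i' = i ∧ j' = j
    · obtain ⟨rfl, rfl⟩ := hnew
      refine ⟨B, by omega, fun φ hφ => ?_⟩
      rw [hval _ (neg_cos_mem hφ).1]
      exact (hw φ hφ).1
    · obtain ⟨b, hb, h⟩ := hcov i' j' hji' (by
        rcases hc with hc | ⟨hc, hc'⟩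
        · exact Or.inl hc
        · refine Or.inr ⟨hc, ?_⟩
          have h3 : i' = i := Fin.ext hc
          have h4 : (j' : ℕ) ≠ j := fun h => hnew ⟨h3, Fin.ext h⟩
          omega)
      refine ⟨b, by omega, fun φ hφ => ?_⟩
      rw [stepVal_congr (K := s.real 20) (V := s.real 21) fun l hl => hold _ (by omega)]
      exact h φ hφ

/-- Add the blocks of all pairs whose first point has the index `1`. -/
def pairsBody : Prog :=
  (nlet 2 (.lit 0) ;; .loop (.natLt (nvar 2) (nvar 1)) pairProg) ;; incr 1

/-- Add the blocks of all pairs. -/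
def pairsProg : Prog := nlet 1 (.lit 0) ;; .loop (.natLt (nvar 1) (nvar 0)) pairsBody

theorem PairState.frame {m k l N : ℕ} {s s' : State} (h : PairState v p m k l N s) {P : Prog}
    (hf : P.Frame s s') (h0 : ∀ A ∈ [0, 5, 6, 20], A ∉ P.natWrites)
    (h1 : ∀ A ∈ [1, 2, 4, 5, 20, 21, 24, 25, 26, 27, 28, 29], A ∉ P.realWrites) :
    PairState v p m k l N s' := by
  obtain ⟨B, hB, hS, hcov⟩ := h
  refine ⟨B, hB, hS.frame hf h0 h1, ?_⟩
  rw [hf.2 20 (h1 20 (by simp)), hf.2 21 (h1 21 (by simp))]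
  exact hcov

theorem PairState.env {m k l N : ℕ} {s : State} (h : PairState v p m k l N s) : Env v p s :=
  h.choose_spec.2.1.env

/-- Only `k` blocks are added in this round; the cruder count `n` suffices for the bound. -/
theorem pairsBody_spec : ∃ c : ℕ, ∀ {n : ℕ} [NeZero n] {v : ℝ} {p : Fin n → Plane} {s : State}
    {m k N : ℕ}, 1 < v → Function.Injective p → k < n →
    PairState v p m k 0 N s → s.nat 1 0 = k → Runs pairsBody s (c * n) fun s' =>
      PairState v p m (k + 1) 0 (N + n) s' ∧ s'.nat 1 0 = k + 1 := by
  refine ⟨(nlet 2 (.lit 0)).bound + 2 * ((Test.natLt (nvar 2) (nvar 1)).cost + pairProg.bound + 1)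
    + (incr 1).bound, fun {n _ v p s m k N} hv hp hk hS h1 => ?_⟩
  have hn : 0 < n := by omega
  have hf := Prog.frame_run (P := nlet 2 (.lit 0)) rfl s
  have hrun := Runs.init_loop (P₀ := nlet 2 (.lit 0)) (P := pairProg)
    (b := .natLt (nvar 2) (nvar 1)) (s₀ := s) rfl pairProg.bound k
    (fun l s' => PairState v p m k l (N + l) s' ∧ s'.nat 2 0 = l)
    ⟨hS.frame hf (by decide) (by decide), rfl⟩ (fun l hl s₂ hf₂ hI => ?_) (fun s₂ hf₂ hI => ?_)
  · refine ((hrun.seq (P' := incr 1) (c' := (incr 1).bound) (Q' := fun s' =>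
      PairState v p m (k + 1) 0 (N + n) s' ∧ s'.nat 1 0 = k + 1) ?_)).mono ?_ fun _ h => h
    · rintro s₃ ⟨⟨⟨B, hB, hSB, hcov⟩, h32⟩, hf3⟩
      refine Runs.of_loopFree rfl s₃ ?_
      have hf4 := Prog.frame_run (P := incr 1) rfl s₃
      have h31 : s₃.nat 1 0 = k := by
        rw [hf3.1 1 (by decide), hf.1 1 (by decide), h1]
      -- As `j < i`, having treated all `j < k` for the first index `k` is the same as being ready
      -- for the first index `k + 1`.
      have h5 : PairState v p m (k + 1) 0 (N + n) s₃ := by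
        refine ⟨B, by omega, hSB, fun i j hji hc => hcov i j hji ?_⟩
        have : (j : ℕ) < i := hji
        omega
      refine ⟨h5.frame hf4 (by decide) (by decide), ?_⟩
      simp [Prog.run, State.nat_setNat, NExp.eval, h31]
    · set a := (nlet 2 (.lit 0)).bound
      set b := (Test.natLt (nvar 2) (nvar 1)).cost
      set d := pairProg.bound
      have h2 := loop_cost_le (a := a) (b := b) (c := d) hn
      have h3 : k * (b + d + 1) ≤ n * (b + d + 1) := Nat.mul_le_mul_right _ hk.le
      have h4 := Nat.le_mul_of_pos_right (incr 1).bound hn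
      rw [add_mul]
      omega
  · have h21 : s₂.nat 1 0 = k := by rw [hf₂.1 1 (by decide), hf.1 1 (by decide), h1]
    refine ⟨by simp only [Test.Holds, NExp.eval, h21, hI.2]; exact hl, Runs.of_loopFree rfl s₂ ?_⟩
    exact pairProg_spec hv hp (i := ⟨k, hk⟩) (j := ⟨l, by omega⟩) hl h21 hI.2 hI.1
  · have h21 : s₂.nat 1 0 = k := by rw [hf₂.1 1 (by decide), hf.1 1 (by decide), h1]
    simp only [Test.Holds, NExp.eval, h21, hI.2]; exact lt_irrefl _

theorem pairsProg_spec : ∃ c : ℕ, ∀ {n : ℕ} [NeZero n] {v : ℝ} {p : Fin n → Plane} {s : State}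
    {m B : ℕ}, 1 < v → Function.Injective p → SlotState v p m B s →
    Runs pairsProg s (c * n ^ 2) fun s' =>
      PairState v p m n 0 (B + n * n) s' ∧ pairsProg.Frame s s' := by
  obtain ⟨c, hc⟩ := pairsBody_spec
  refine ⟨(nlet 1 (.lit 0)).bound + 2 * ((Test.natLt (nvar 1) (nvar 0)).cost + c + 1),
    fun {n _ v p s m B} hv hp hS => Runs.frame ?_⟩
  have hf := Prog.frame_run (P := nlet 1 (.lit 0)) rfl s
  refine (Runs.init_loop (P₀ := nlet 1 (.lit 0)) rfl (c * n) n
    (fun k s' => PairState v p m k 0 (B + k * n) s' ∧ s'.nat 1 0 = k)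
    ⟨⟨B, by omega, hS.frame hf (by decide) (by decide), fun i j _ hc => by omega⟩, rfl⟩
    (fun k hk s₂ _ hI => ⟨?_, ?_⟩) (fun s₂ _ hI => ?_)).mono ?_ ?_
  · simp only [Test.Holds, NExp.eval, hI.1.env.count, hI.2]; exact hk
  · rw [Nat.succ_mul, ← add_assoc]; exact hc hv hp hk hI.1 hI.2
  · simp only [Test.Holds, NExp.eval, hI.1.env.count, hI.2]; exact lt_irrefl _
  · have hn : 0 < n := NeZero.pos n
    set a := (nlet 1 (.lit 0)).bound
    set b := (Test.natLt (nvar 1) (nvar 0)).cost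
    have h1 : b + c * n + 1 ≤ (b + c + 1) * n := by nlinarith
    have h2 : n ≤ n ^ 2 := by nlinarith
    nlinarith [Nat.mul_le_mul_left n h1, Nat.mul_le_mul_left a h2, Nat.mul_le_mul_left (b + 1) h2]
  · exact fun s₂ h => h.1.1

end Highway

namespace Highway

open RealRAM

/-! ### Merging step functions -/

/-- The last of `i` entries from the index `a` on, and `0` if there is none. -/
def lastVal (V : ℕ → ℝ) (a : ℕ) : ℕ → ℝ
  | 0 => 0
  | i + 1 => V (a + i)

theorem stepVal_eq_lastVal {K V : ℕ → ℝ} {a i : ℕ} {x : ℝ} (h : ∀ e < i, K (a + e) ≤ x) :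
    stepVal K V a i x = lastVal V a i := by
  cases i with
  | zero => rfl
  | succ i => rw [stepVal, if_pos (h i (Nat.lt_succ_self i)), lastVal]

/-- The list from the index `o` on arises by merging the first `i` of the `w` entries from the index
`a` on with the first `j` of the `w` entries from the index `b` on. -/
structure Merging (K V : ℕ → ℝ) (T : ℕ → ℕ) (w o a b i j : ℕ) (K' V' : ℕ → ℝ) (T' : ℕ → ℕ) :
    Prop where
  val : ∀ x, stepVal K' V' o (i + j) x = max (stepVal K V a i x) (stepVal K V b j x)
  sorted : ∀ e f, e ≤ f → f < i + j → K' (o + e) ≤ K' (o + f)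
  source : ∀ e < i + j, (∃ f < i, K' (o + e) = K (a + f) ∧ T' (o + e) = T (a + f)) ∨
    ∃ f < j, K' (o + e) = K (b + f) ∧ T' (o + e) = T (b + f)
  target_left : ∀ f < i, ∃ e < i + j, K' (o + e) = K (a + f) ∧ T' (o + e) = T (a + f)
  target_right : ∀ f < j, ∃ e < i + j, K' (o + e) = K (b + f) ∧ T' (o + e) = T (b + f)
  left_le : ∀ e < i, ∀ f, j ≤ f → f < w → K (a + e) ≤ K (b + f)
  right_le : ∀ e < j, ∀ f, i ≤ f → f < w → K (b + e) ≤ K (a + f)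

section

variable {K V K' V' K'' V'' : ℕ → ℝ} {T T' T'' : ℕ → ℕ} {w o a b i j : ℕ}

theorem Merging.zero : Merging K V T w o a b 0 0 K' V' T' := by
  constructor <;> simp [stepVal]

theorem Merging.swap (h : Merging K V T w o a b i j K' V' T') :
    Merging K V T w o b a j i K' V' T' := by
  obtain ⟨h1, h2, h3, h4, h5, h6, h7⟩ := h
  rw [add_comm i j] at *
  exact ⟨fun x => by rw [h1, max_comm], h2, fun e he => (h3 e he).symm, h5, h4, h7, h6⟩

theorem Merging.congr (h : Merging K V T w o a b i j K' V' T')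
    (he : ∀ e < i + j, K'' (o + e) = K' (o + e) ∧ V'' (o + e) = V' (o + e) ∧
      T'' (o + e) = T' (o + e)) : Merging K V T w o a b i j K'' V'' T'' := by
  constructor
  · intro x
    rw [stepVal_congr (K := K') (V := V') fun e h => ⟨(he e h).1, (he e h).2.1⟩, h.val]
  · intro e f hef hf
    rw [(he e (by omega)).1, (he f hf).1]; exact h.sorted e f hef hf
  · intro e hlt
    rw [(he e hlt).1, (he e hlt).2.2]; exact h.source e hlt
  · intro f hf
    obtain ⟨e, hlt, h'⟩ := h.target_left f hf
    exact ⟨e, hlt, by rw [(he e hlt).1, (he e hlt).2.2]; exact h'⟩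
  · intro f hf
    obtain ⟨e, hlt, h'⟩ := h.target_right f hf
    exact ⟨e, hlt, by rw [(he e hlt).1, (he e hlt).2.2]; exact h'⟩
  · exact h.left_le
  · exact h.right_le

/-- Everything already taken from the other list has key at most `K (a + i)`, so from this key on
the maximum of the two step functions is the maximum of the value just read and the last value taken
from the other list. Before this key nothing changes. -/
theorem Merging.step (h : Merging K V T w o a b i j K' V' T')
    (ha : ∀ e f, e ≤ f → f < w → K (a + e) ≤ K (a + f))
    (hb : ∀ e f, e ≤ f → f < w → K (b + e) ≤ K (b + f)) (hi : i < w)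
    (hle : j < w → K (a + i) ≤ K (b + j))
    (hK : ∀ e, K'' e = if e = o + (i + j) then K (a + i) else K' e)
    (hV : ∀ e, V'' e = if e = o + (i + j) then max (V (a + i)) (lastVal V b j) else V' e)
    (hT : ∀ e, T'' e = if e = o + (i + j) then T (a + i) else T' e) :
    Merging K V T w o a b (i + 1) j K'' V'' T'' := by
  have hold : ∀ e < i + j, K'' (o + e) = K' (o + e) ∧ V'' (o + e) = V' (o + e) ∧
      T'' (o + e) = T' (o + e) := fun e he => by
    rw [hK, hV, hT, if_neg (by omega), if_neg (by omega), if_neg (by omega)]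
    exact ⟨rfl, rfl, rfl⟩
  have h' := h.congr hold
  have k1 : K'' (o + (i + j)) = K (a + i) := by rw [hK, if_pos rfl]
  have v1 : V'' (o + (i + j)) = max (V (a + i)) (lastVal V b j) := by rw [hV, if_pos rfl]
  have t1 : T'' (o + (i + j)) = T (a + i) := by rw [hT, if_pos rfl]
  have hij : i + 1 + j = i + j + 1 := by ring
  have hout : ∀ e < i + j, K'' (o + e) ≤ K (a + i) := fun e he => by
    rcases h'.source e he with ⟨f, hf, h1, -⟩ | ⟨f, hf, h1, -⟩
    · rw [h1]; exact ha f i hf.le hi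
    · rw [h1]; exact h.right_le f hf i le_rfl hi
  constructor
  · intro x
    rw [hij, stepVal, k1, v1, stepVal]
    split_ifs with hx
    · rw [stepVal_eq_lastVal (K := K) (a := b) fun e he =>
        (h.right_le e he i le_rfl hi).trans hx]
    · exact h'.val x
  · intro e f hef hf
    rw [hij] at hf
    rcases Nat.lt_succ_iff_lt_or_eq.1 hf with hf | rfl
    · exact h'.sorted e f hef hf
    · rcases hef.lt_or_eq with hef | rfl
      · rw [k1]; exact hout e hef
      · exact le_rfl
  · intro e he
    rw [hij] at he
    rcases Nat.lt_succ_iff_lt_or_eq.1 he with he | rfl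
    · rcases h'.source e he with ⟨f, hf, h1⟩ | h1
      · exact Or.inl ⟨f, by omega, h1⟩
      · exact Or.inr h1
    · exact Or.inl ⟨i, by omega, k1, t1⟩
  · intro f hf
    rcases Nat.lt_succ_iff_lt_or_eq.1 hf with hf | rfl
    · obtain ⟨e, he, h1⟩ := h'.target_left f hf
      exact ⟨e, by omega, h1⟩
    · exact ⟨f + j, by omega, k1, t1⟩
  · intro f hf
    obtain ⟨e, he, h1⟩ := h'.target_right f hf
    exact ⟨e, by omega, h1⟩
  · intro e he f hf hfw
    rcases Nat.lt_succ_iff_lt_or_eq.1 he with he | rfl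
    · exact h.left_le e he f hf hfw
    · exact (hle (by omega)).trans (hb j f hf hfw)
  · exact fun e he f hf hfw => h.right_le e he f (by omega) hfw

end

/-- The state of the merge sort: `g` sorted blocks of `w` entries replace `g₀` blocks of three
entries. -/
structure Sorting (K₀ V₀ : ℕ → ℝ) (T₀ : ℕ → ℕ) (g₀ w g : ℕ) (K V : ℕ → ℝ) (T : ℕ → ℕ) :
    Prop where
  size : w * g = 3 * g₀
  sorted : ∀ b < g, ∀ e f, e ≤ f → f < w → K (w * b + e) ≤ K (w * b + f)
  val : ∀ x t, (∀ b < g, stepVal K V (w * b) w x ≤ t) ↔ ∀ b < g₀, stepVal K₀ V₀ (3 * b) 3 x ≤ t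
  source : ∀ e < w * g, ∃ f < w * g, K e = K₀ f ∧ T e = T₀ f
  target : ∀ f < w * g, ∃ e < w * g, K e = K₀ f ∧ T e = T₀ f

theorem block_index {w g e : ℕ} (he : e < w * g) : ∃ b < g, ∃ f < w, e = w * b + f := by
  have hw : 0 < w := Nat.pos_of_ne_zero fun h => by simp [h] at he
  exact ⟨e / w, Nat.div_lt_of_lt_mul he, e % w, Nat.mod_lt _ hw, (Nat.div_add_mod e w).symm⟩

theorem block_index_lt {w g b f : ℕ} (hb : b < g) (hf : f < w) : w * b + f < w * g :=
  calc w * b + f < w * b + w := by omega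
    _ = w * (b + 1) := by ring
    _ ≤ w * g := Nat.mul_le_mul_left w hb

/-- Only upper bounds on the step functions of all blocks are recorded in `val`, and these do not
change when two blocks are replaced by their pointwise maximum. -/
theorem Sorting.step {K₀ V₀ K V K' V' : ℕ → ℝ} {T₀ T T' : ℕ → ℕ} {g₀ w g : ℕ}
    (h : Sorting K₀ V₀ T₀ g₀ w (2 * g) K V T)
    (hm : ∀ b < g, Merging K V T w (2 * w * b) (2 * w * b) (2 * w * b + w) w w K' V' T') :
    Sorting K₀ V₀ T₀ g₀ (2 * w) g K' V' T' := by
  have hw2 : w + w = 2 * w := by ring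
  have hsz : w * (2 * g) = 2 * w * g := by ring
  have e0 : ∀ b, 2 * w * b = w * (2 * b) := fun b => by ring
  have e1 : ∀ b, 2 * w * b + w = w * (2 * b + 1) := fun b => by ring
  refine ⟨by rw [← h.size, hsz], fun b hb e f hef hf => ?_, fun x t => ?_, fun e he => ?_,
    fun f hf => ?_⟩
  · exact (hm b hb).sorted e f hef (by omega)
  · rw [← h.val]
    have hv : ∀ b < g, stepVal K' V' (2 * w * b) (2 * w) x =
        max (stepVal K V (w * (2 * b)) w x) (stepVal K V (w * (2 * b + 1)) w x) := fun b hb => by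
      have := (hm b hb).val x
      rw [hw2] at this
      rw [← e0, ← e1, this]
    constructor
    · intro h' b hb
      have h1 := h' (b / 2) (by omega)
      rw [hv _ (by omega), max_le_iff] at h1
      rcases Nat.mod_two_eq_zero_or_one b with h2 | h2
      · rw [show b = 2 * (b / 2) by omega]; exact h1.1
      · rw [show b = 2 * (b / 2) + 1 by omega]; exact h1.2
    · intro h' b hb
      rw [hv b hb]
      exact max_le (h' _ (by omega)) (h' _ (by omega))
  · obtain ⟨b, hb, f, hf, rfl⟩ := block_index he
    rw [← hsz]
    rcases (hm b hb).source f (by omega) with ⟨f', hf', h1, h2⟩ | ⟨f', hf', h1, h2⟩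
    · obtain ⟨k, hk, h3, h4⟩ := h.source (2 * w * b + f') (by
        rw [e0]; exact block_index_lt (by omega) hf')
      exact ⟨k, hk, h1.trans h3, h2.trans h4⟩
    · obtain ⟨k, hk, h3, h4⟩ := h.source (2 * w * b + w + f') (by
        rw [e1]; exact block_index_lt (by omega) hf')
      exact ⟨k, hk, h1.trans h3, h2.trans h4⟩
  · rw [← hsz] at hf
    obtain ⟨k, hk, h1, h2⟩ := h.target f hf
    rw [hsz] at hk
    obtain ⟨b, hb, e, he, rfl⟩ := block_index hk
    rcases lt_or_ge e w with hlt | hge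
    · obtain ⟨k, hk, h3, h4⟩ := (hm b hb).target_left e hlt
      exact ⟨_, block_index_lt hb (by omega), h3.trans h1, h4.trans h2⟩
    · obtain ⟨k, hk, h3, h4⟩ := (hm b hb).target_right (e - w) (by omega)
      rw [show 2 * w * b + w + (e - w) = 2 * w * b + e by omega] at h3 h4
      exact ⟨_, block_index_lt hb (by omega), h3.trans h1, h4.trans h2⟩

/-! ### The merge sort -/

/-- Take the next entry from the left list. -/
def takeLeft : Prog :=
  rlet 16 (.get 21 (nvar 1)) ;; .setReal 22 (nvar 3) (.get 20 (nvar 1)) ;;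
  .setNat 21 (nvar 3) (.get 20 (nvar 1)) ;; incr 1

/-- Take the next entry from the right list. -/
def takeRight : Prog :=
  rlet 17 (.get 21 (nvar 2)) ;; .setReal 22 (nvar 3) (.get 20 (nvar 2)) ;;
  .setNat 21 (nvar 3) (.get 20 (nvar 2)) ;; incr 2

/-- Store the maximum of the two current values. -/
def putMax : Prog :=
  .branch (.realLt (rvar 16) (rvar 17)) (.setReal 23 (nvar 3) (rvar 17))
    (.setReal 23 (nvar 3) (rvar 16)) ;;
  incr 3

/-- Whether the next entry comes from the left list. -/
def leftTest : Test :=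
  .and (.natLt (nvar 1) (nvar 12))
    (.not (.and (.natLt (nvar 2) (nvar 14))
      (.realLt (.get 20 (nvar 2)) (.get 20 (nvar 1)))))

/-- The body of the loop of `mergeProg`. -/
def mergeBody : Prog := .branch leftTest takeLeft takeRight ;; putMax

/-- The initialization of `mergeProg`. -/
def mergeInit : Prog :=
  nlet 1 (nvar 11) ;; nlet 12 (nvar 11 +ₙ nvar 10) ;; nlet 2 (nvar 12) ;;
  nlet 14 (nvar 12 +ₙ nvar 10) ;; nlet 3 (nvar 11) ;; rlet 16 (.lit 0) ;; rlet 17 (.lit 0)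

/-- Merge the two blocks from the index `11` on. -/
def mergeProg : Prog := mergeInit ;; .loop (.natLt (nvar 3) (nvar 14)) mergeBody

theorem takeLeft_run {s : State} {x k : ℕ} (h1 : s.nat 1 0 = x) (h3 : s.nat 3 0 = k) :
    (∀ e, ((takeLeft ;; putMax).run s).real 22 e = if e = k then s.real 20 x else s.real 22 e) ∧
    (∀ e, ((takeLeft ;; putMax).run s).real 23 e =
      if e = k then max (s.real 21 x) (s.real 17 0) else s.real 23 e) ∧
    (∀ e, ((takeLeft ;; putMax).run s).nat 21 e = if e = k then s.nat 20 x else s.nat 21 e) ∧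
    ((takeLeft ;; putMax).run s).nat 1 0 = x + 1 ∧
    ((takeLeft ;; putMax).run s).nat 2 0 = s.nat 2 0 ∧
    ((takeLeft ;; putMax).run s).nat 3 0 = k + 1 ∧
    ((takeLeft ;; putMax).run s).real 16 0 = s.real 21 x ∧
    ((takeLeft ;; putMax).run s).real 17 0 = s.real 17 0 := by
  rcases lt_or_ge (s.real 21 x) (s.real 17 0) with h | h
  · simp [takeLeft, putMax, Prog.run, State.real_setReal, State.nat_setReal, State.real_setNat,
      State.nat_setNat, RExp.eval, NExp.eval, Test.Holds, h1, h3, h, max_eq_right h.le]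
  · simp [takeLeft, putMax, Prog.run, State.real_setReal, State.nat_setReal, State.real_setNat,
      State.nat_setNat, RExp.eval, NExp.eval, Test.Holds, h1, h3, not_lt.2 h, max_eq_left h]

theorem takeRight_run {s : State} {x k : ℕ} (h2 : s.nat 2 0 = x) (h3 : s.nat 3 0 = k) :
    (∀ e, ((takeRight ;; putMax).run s).real 22 e = if e = k then s.real 20 x else s.real 22 e) ∧
    (∀ e, ((takeRight ;; putMax).run s).real 23 e =
      if e = k then max (s.real 21 x) (s.real 16 0) else s.real 23 e) ∧
    (∀ e, ((takeRight ;; putMax).run s).nat 21 e = if e = k then s.nat 20 x else s.nat 21 e) ∧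
    ((takeRight ;; putMax).run s).nat 1 0 = s.nat 1 0 ∧
    ((takeRight ;; putMax).run s).nat 2 0 = x + 1 ∧
    ((takeRight ;; putMax).run s).nat 3 0 = k + 1 ∧
    ((takeRight ;; putMax).run s).real 16 0 = s.real 16 0 ∧
    ((takeRight ;; putMax).run s).real 17 0 = s.real 21 x := by
  rcases lt_or_ge (s.real 16 0) (s.real 21 x) with h | h
  · simp [takeRight, putMax, Prog.run, State.real_setReal, State.nat_setReal, State.real_setNat,
      State.nat_setNat, RExp.eval, NExp.eval, Test.Holds, h2, h3, h, max_eq_left h.le]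
  · simp [takeRight, putMax, Prog.run, State.real_setReal, State.nat_setReal, State.real_setNat,
      State.nat_setNat, RExp.eval, NExp.eval, Test.Holds, h2, h3, not_lt.2 h, max_eq_right h]

/-- The invariant of the loop of `mergeProg`; `s₀` is the initial state. -/
def MergeInv (s₀ : State) (o w q : ℕ) (s : State) : Prop :=
  (∃ i j, i + j = q ∧ i ≤ w ∧ j ≤ w ∧ s.nat 1 0 = o + i ∧ s.nat 2 0 = o + w + j ∧
    s.nat 3 0 = o + q ∧ s.real 16 0 = lastVal (s₀.real 21) o i ∧
    s.real 17 0 = lastVal (s₀.real 21) (o + w) j ∧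
    Merging (s₀.real 20) (s₀.real 21) (s₀.nat 20) w o o (o + w) i j (s.real 22) (s.real 23)
      (s.nat 21)) ∧
  ∀ e < o, s.real 22 e = s₀.real 22 e ∧ s.real 23 e = s₀.real 23 e ∧ s.nat 21 e = s₀.nat 21 e

theorem mergeBody_spec {s₀ s : State} {o w q : ℕ} (hq : q < 2 * w)
    (h12 : s.nat 12 0 = o + w) (h14 : s.nat 14 0 = o + w + w) (e20 : s.real 20 = s₀.real 20)
    (e21 : s.real 21 = s₀.real 21) (eT : s.nat 20 = s₀.nat 20)
    (ha : ∀ e f, e ≤ f → f < w → s₀.real 20 (o + e) ≤ s₀.real 20 (o + f))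
    (hb : ∀ e f, e ≤ f → f < w → s₀.real 20 (o + w + e) ≤ s₀.real 20 (o + w + f))
    (hI : MergeInv s₀ o w q s) : MergeInv s₀ o w (q + 1) (mergeBody.run s) := by
  obtain ⟨⟨i, j, hij, hi, hj, h1, h2, h3, h16, h17, hm⟩, hlow⟩ := hI
  have hT : leftTest.Holds s ↔
      i < w ∧ (j < w → s₀.real 20 (o + i) ≤ s₀.real 20 (o + w + j)) := by
    simp only [leftTest, Test.Holds, NExp.eval, RExp.eval, h1, h2, h12, h14, e20,
      Nat.add_lt_add_iff_left, not_and, not_lt]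
  by_cases hc : leftTest.Holds s
  · have hrun : mergeBody.run s = (takeLeft ;; putMax).run s := by
      simp only [mergeBody, Prog.run, if_pos hc]
    rw [hrun]
    rw [hT] at hc
    obtain ⟨g22, g23, g21, g1, g2, g3, g16, g17⟩ := takeLeft_run h1 h3
    rw [← hij] at g22 g23 g21
    refine ⟨⟨i + 1, j, by omega, by omega, hj, by rw [g1]; ring, by rw [g2, h2],
      by rw [g3]; ring, by rw [g16, e21]; rfl, by rw [g17, h17],
      hm.step ha hb hc.1 hc.2 ?_ ?_ ?_⟩, fun e he => ?_⟩
    · rw [← e20]; exact g22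
    · rw [← h17, ← e21]; exact g23
    · rw [← eT]; exact g21
    · rw [g22, g23, g21, if_neg (by omega), if_neg (by omega), if_neg (by omega)]
      exact hlow e he
  · have hrun : mergeBody.run s = (takeRight ;; putMax).run s := by
      simp only [mergeBody, Prog.run, if_neg hc]
    rw [hrun]
    rw [hT] at hc
    obtain ⟨g22, g23, g21, g1, g2, g3, g16, g17⟩ := takeRight_run h2 h3
    rw [← hij, add_comm i j] at g22 g23 g21
    -- If the test fails with the right list exhausted, the left one is exhausted too, contrary to
    -- `q < 2 * w`.
    have hjw : j < w := by
      by_contra hjw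
      exact hc ⟨by omega, fun h => absurd h hjw⟩
    refine ⟨⟨i, j + 1, by omega, hi, by omega, by rw [g1, h1], by rw [g2]; ring,
      by rw [g3]; ring, by rw [g16, h16], by rw [g17, e21]; rfl,
      (hm.swap.step hb ha hjw (fun h => ?_) ?_ ?_ ?_).swap⟩, fun e he => ?_⟩
    · by_contra hle
      exact hc ⟨h, fun _ => (not_le.1 hle).le⟩
    · rw [← e20]; exact g22
    · rw [← h16, ← e21]; exact g23
    · rw [← eT]; exact g21
    · rw [g22, g23, g21, if_neg (by omega), if_neg (by omega), if_neg (by omega)]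
      exact hlow e he

/-- The output cells before `o` are kept, which preserves the blocks merged earlier in the same
pass. -/
theorem mergeProg_spec : ∃ c : ℕ, ∀ {s : State} {o w : ℕ}, 0 < w → s.nat 11 0 = o →
    s.nat 10 0 = w → (∀ e f, e ≤ f → f < w → s.real 20 (o + e) ≤ s.real 20 (o + f)) →
    (∀ e f, e ≤ f → f < w → s.real 20 (o + w + e) ≤ s.real 20 (o + w + f)) →
    Runs mergeProg s (c * w) fun s' =>
      (Merging (s.real 20) (s.real 21) (s.nat 20) w o o (o + w) w w (s'.real 22) (s'.real 23)
        (s'.nat 21) ∧ ∀ e < o, s'.real 22 e = s.real 22 e ∧ s'.real 23 e = s.real 23 e ∧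
          s'.nat 21 e = s.nat 21 e) ∧ mergeProg.Frame s s' := by
  refine ⟨(mergeInit.bound + 2 * ((Test.natLt (nvar 3) (nvar 14)).cost + mergeBody.bound + 1)) * 2,
    fun {s o w} hw h11 h10 ha hb => Runs.frame ?_⟩
  have hf := Prog.frame_run (P := mergeInit) rfl s
  have i12 : (mergeInit.run s).nat 12 0 = o + w ∧ (mergeInit.run s).nat 14 0 = o + w + w := by
    simp [mergeInit, Prog.run, State.nat_setReal, State.nat_setNat, NExp.eval, h11, h10]
  have hinit : MergeInv s o w 0 (mergeInit.run s) := by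
    refine ⟨⟨0, 0, rfl, by omega, by omega, ?_, ?_, ?_, ?_, ?_, .zero⟩, fun e _ => ⟨?_, ?_, ?_⟩⟩
    iterate 5 · simp [mergeInit, Prog.run, State.real_setReal, State.nat_setReal, State.nat_setNat,
      NExp.eval, RExp.eval, h11, h10, lastVal]
    · rw [hf.2 22 (by decide)]
    · rw [hf.2 23 (by decide)]
    · rw [hf.1 21 (by decide)]
  refine (Runs.init_loop (P₀ := mergeInit) rfl mergeBody.bound (2 * w) (MergeInv s o w) hinit
    (fun q hq s₂ hf₂ hI => ⟨?_, ?_⟩) (fun s₂ hf₂ hI => ?_)).mono ?_ ?_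
  · obtain ⟨⟨i, j, -, -, -, -, -, h3, -⟩, -⟩ := hI
    simp only [Test.Holds, NExp.eval, h3, hf₂.1 14 (by decide), i12.2]
    omega
  · refine Runs.of_loopFree rfl s₂ (mergeBody_spec hq ?_ ?_ ?_ ?_ ?_ ha hb hI)
    · rw [hf₂.1 12 (by decide), i12.1]
    · rw [hf₂.1 14 (by decide), i12.2]
    · rw [hf₂.2 20 (by decide), hf.2 20 (by decide)]
    · rw [hf₂.2 21 (by decide), hf.2 21 (by decide)]
    · rw [hf₂.1 20 (by decide), hf.1 20 (by decide)]
  · obtain ⟨⟨i, j, -, -, -, -, -, h3, -⟩, -⟩ := hI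
    simp only [Test.Holds, NExp.eval, h3, hf₂.1 14 (by decide), i12.2]
    omega
  · exact (loop_cost_le (by omega)).trans_eq (by ring)
  · rintro s₂ ⟨⟨⟨i, j, hij, hi, hj, -, -, -, -, -, hm⟩, hlow⟩, -⟩
    obtain rfl : i = w := by omega
    obtain rfl : j = i := by omega
    exact ⟨hm, hlow⟩

end Highway

/-! ### The passes of the merge sort. -/

namespace Highway

open RealRAM

/-- Merge the two blocks from the index `11` on and go to the next two blocks. -/
def mergeNext : Prog := mergeProg ;; nlet 11 (nvar 11 +ₙ nvar 10 +ₙ nvar 10)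

/-- Merge all pairs of blocks. -/
def mergeAll : Prog := nlet 11 (.lit 0) ;; .loop (.natLt (nvar 11) (nvar 9)) mergeNext

/-- Copy an entry of the merged list. -/
def copyBody : Prog :=
  .setReal 20 (nvar 3) (.get 22 (nvar 3)) ;; .setReal 21 (nvar 3) (.get 23 (nvar 3)) ;;
  .setNat 20 (nvar 3) (.get 21 (nvar 3)) ;; incr 3

/-- Copy the merged list. -/
def copyProg : Prog := nlet 3 (.lit 0) ;; .loop (.natLt (nvar 3) (nvar 9)) copyBody

/-- A pass of the merge sort. -/
def sortPass : Prog := mergeAll ;; copyProg ;; nlet 10 (nvar 10 +ₙ nvar 10)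

/-- Compute the size of the padded list. -/
def sizeProg : Prog :=
  nlet 9 (.lit 3) ;; .loop (.natLt (nvar 9) (nvar 6)) (nlet 9 (nvar 9 +ₙ nvar 9))

/-- The merge sort. -/
def sortLoop : Prog := nlet 10 (.lit 3) ;; .loop (.natLt (nvar 10) (nvar 9)) sortPass

theorem loop_cost_le_mul {a b c w n : ℕ} (hw : 0 < w) (hn : 0 < n) :
    a + (n * (b + c * w + 1) + (b + 1)) ≤ (a + 2 * (b + c + 1)) * (w * n) := by
  have h0 : 0 < w * n := Nat.mul_pos hw hn
  have h1 : b + c * w + 1 ≤ (b + c + 1) * w := by nlinarith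
  have h2 := Nat.mul_le_mul_left n h1
  have h3 := Nat.le_mul_of_pos_right a h0
  have h4 := Nat.le_mul_of_pos_right (b + 1) h0
  nlinarith

theorem mergeAll_spec : ∃ c : ℕ, ∀ {s : State} {w g : ℕ}, 0 < w → 0 < g → s.nat 10 0 = w →
    s.nat 9 0 = 2 * w * g →
    (∀ b < 2 * g, ∀ e f, e ≤ f → f < w → s.real 20 (w * b + e) ≤ s.real 20 (w * b + f)) →
    Runs mergeAll s (c * (w * g)) fun s' => (∀ b < g, Merging (s.real 20) (s.real 21) (s.nat 20) w
      (2 * w * b) (2 * w * b) (2 * w * b + w) w w (s'.real 22) (s'.real 23) (s'.nat 21)) ∧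
      mergeAll.Frame s s' := by
  obtain ⟨c, hc⟩ := mergeProg_spec
  set inc := nlet 11 (nvar 11 +ₙ nvar 10 +ₙ nvar 10) with hinc
  refine ⟨(nlet 11 (.lit 0)).bound + 2 * ((Test.natLt (nvar 11) (nvar 9)).cost +
    (c + inc.bound) + 1), fun {s w g} hw hg h10 h9 hsort => Runs.frame ?_⟩
  have hf := Prog.frame_run (P := nlet 11 (.lit 0)) rfl s
  have e0 : ∀ b, 2 * w * b = w * (2 * b) := fun b => by ring
  have e1 : ∀ b, 2 * w * b + w = w * (2 * b + 1) := fun b => by ring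
  refine (Runs.init_loop (P₀ := nlet 11 (.lit 0)) rfl ((c + inc.bound) * w) g
    (fun k s' => s'.nat 11 0 = 2 * w * k ∧ ∀ b < k, Merging (s.real 20) (s.real 21) (s.nat 20) w
      (2 * w * b) (2 * w * b) (2 * w * b + w) w w (s'.real 22) (s'.real 23) (s'.nat 21))
    ⟨by simp [Prog.run, State.nat_setNat, NExp.eval], fun b hb => absurd hb (Nat.not_lt_zero b)⟩
    (fun k hk s₂ hf₂ hI => ⟨?_, ?_⟩) (fun s₂ hf₂ hI => ?_)).mono (loop_cost_le_mul hw hg)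
    fun s' h => h.1.2
  · simp only [Test.Holds, NExp.eval, hI.1, hf₂.1 9 (by decide), hf.1 9 (by decide), h9]
    exact Nat.mul_lt_mul_of_pos_left hk (by omega)
  · have e20 : s₂.real 20 = s.real 20 := by rw [hf₂.2 20 (by decide), hf.2 20 (by decide)]
    have e21 : s₂.real 21 = s.real 21 := by rw [hf₂.2 21 (by decide), hf.2 21 (by decide)]
    have eT : s₂.nat 20 = s.nat 20 := by rw [hf₂.1 20 (by decide), hf.1 20 (by decide)]
    have e10 : s₂.nat 10 0 = w := by rw [hf₂.1 10 (by decide), hf.1 10 (by decide), h10]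
    refine ((hc hw hI.1 e10 ?_ ?_).seq (P' := inc) (c' := inc.bound) ?_).mono ?_ fun _ h => h
    · rw [e20, e0]; exact hsort (2 * k) (by omega)
    · rw [e20, e1]; exact hsort (2 * k + 1) (by omega)
    · rintro s₃ ⟨⟨hm, hlow⟩, hf3⟩
      have hf4 := Prog.frame_run (P := inc) rfl s₃
      refine Runs.of_loopFree rfl s₃ ⟨?_, fun b hb => ?_⟩
      · simp [hinc, Prog.run, State.nat_setNat, NExp.eval, hf3.1 11 (by decide),
          hf3.1 10 (by decide), hI.1, e10]
        ring
      · rw [hf4.2 22 (by decide), hf4.2 23 (by decide), hf4.1 21 (by decide)]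
        rcases Nat.lt_succ_iff_lt_or_eq.1 hb with hb | rfl
        · refine (hI.2 b hb).congr fun e he => hlow _ ?_
          calc 2 * w * b + e < 2 * w * b + 2 * w := by omega
            _ = 2 * w * (b + 1) := by ring
            _ ≤ 2 * w * k := Nat.mul_le_mul_left _ hb
        · rwa [e20, e21, eT] at hm
    · rw [add_mul]
      exact Nat.add_le_add_left (Nat.le_mul_of_pos_right _ hw) _
  · simp only [Test.Holds, NExp.eval, hI.1, hf₂.1 9 (by decide), hf.1 9 (by decide), h9]
    exact lt_irrefl _

theorem copyProg_spec : ∃ c : ℕ, ∀ {s : State} {M : ℕ}, 0 < M → s.nat 9 0 = M →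
    Runs copyProg s (c * M) fun s' => (∀ e < M, s'.real 20 e = s.real 22 e ∧
      s'.real 21 e = s.real 23 e ∧ s'.nat 20 e = s.nat 21 e) ∧ copyProg.Frame s s' := by
  refine ⟨(nlet 3 (.lit 0)).bound + 2 * ((Test.natLt (nvar 3) (nvar 9)).cost + copyBody.bound + 1),
    fun {s M} hM h9 => Runs.frame ?_⟩
  have hf := Prog.frame_run (P := nlet 3 (.lit 0)) rfl s
  refine (Runs.init_loop (P₀ := nlet 3 (.lit 0)) rfl copyBody.bound M
    (fun k s' => s'.nat 3 0 = k ∧ ∀ e < k, s'.real 20 e = s.real 22 e ∧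
      s'.real 21 e = s.real 23 e ∧ s'.nat 20 e = s.nat 21 e)
    ⟨by simp [Prog.run, State.nat_setNat, NExp.eval], fun e he => absurd he (Nat.not_lt_zero e)⟩
    (fun k hk s₂ hf₂ hI => ⟨?_, Runs.of_loopFree rfl s₂ ?_⟩) (fun s₂ hf₂ hI => ?_)).mono
    (loop_cost_le hM) fun s' h => h.1.2
  · simp only [Test.Holds, NExp.eval, hI.1, hf₂.1 9 (by decide), hf.1 9 (by decide), h9]
    exact hk
  · have e22 : s₂.real 22 = s.real 22 := by rw [hf₂.2 22 (by decide), hf.2 22 (by decide)]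
    have e23 : s₂.real 23 = s.real 23 := by rw [hf₂.2 23 (by decide), hf.2 23 (by decide)]
    have eT : s₂.nat 21 = s.nat 21 := by rw [hf₂.1 21 (by decide), hf.1 21 (by decide)]
    refine ⟨?_, fun e he => ?_⟩
    · simp [copyBody, Prog.run, State.nat_setNat, State.nat_setReal, NExp.eval, hI.1]
    · rcases Nat.lt_succ_iff_lt_or_eq.1 he with he | rfl
      · simp [copyBody, Prog.run, State.nat_setNat, State.nat_setReal, State.real_setNat,
          State.real_setReal, NExp.eval, RExp.eval, hI.1, he.ne, hI.2 e he]
      · simp [copyBody, Prog.run, State.nat_setNat, State.nat_setReal, State.real_setNat,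
          State.real_setReal, NExp.eval, RExp.eval, hI.1, e22, e23, eT]
  · simp only [Test.Holds, NExp.eval, hI.1, hf₂.1 9 (by decide), hf.1 9 (by decide), h9]
    exact lt_irrefl _

theorem sortPass_spec : ∃ c : ℕ, ∀ {s : State} {K₀ V₀ : ℕ → ℝ} {T₀ : ℕ → ℕ} {g₀ w g : ℕ},
    0 < w → 0 < g → s.nat 10 0 = w → s.nat 9 0 = 2 * w * g →
    Sorting K₀ V₀ T₀ g₀ w (2 * g) (s.real 20) (s.real 21) (s.nat 20) →
    Runs sortPass s (c * (w * g)) fun s' => s'.nat 10 0 = 2 * w ∧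
      Sorting K₀ V₀ T₀ g₀ (2 * w) g (s'.real 20) (s'.real 21) (s'.nat 20) := by
  obtain ⟨c, hc⟩ := mergeAll_spec
  obtain ⟨c', hc'⟩ := copyProg_spec
  set dbl := nlet 10 (nvar 10 +ₙ nvar 10) with hdbl
  refine ⟨c + (c' * 2 + dbl.bound), fun {s K₀ V₀ T₀ g₀ w g} hw hg h10 h9 hS => ?_⟩
  have hwg : 0 < w * g := Nat.mul_pos hw hg
  refine ((hc hw hg h10 h9 hS.sorted).seq (P' := copyProg ;; dbl)
    (c' := c' * (2 * w * g) + dbl.bound) ?_).mono ?_ fun _ h => h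
  · rintro s₁ ⟨hm, hf1⟩
    refine (hc' (by rw [mul_assoc]; omega) ((congrFun (hf1.1 9 (by decide)) 0).trans h9)).seq ?_
    rintro s₂ ⟨hcopy, hf2⟩
    have hf3 := Prog.frame_run (P := dbl) rfl s₂
    refine Runs.of_loopFree rfl s₂ ⟨?_, ?_⟩
    · simp [hdbl, Prog.run, State.nat_setNat, NExp.eval, hf2.1 10 (by decide),
        hf1.1 10 (by decide), h10]
      ring
    · rw [hf3.2 20 (by decide), hf3.2 21 (by decide), hf3.1 20 (by decide)]
      exact hS.step fun b hb => (hm b hb).congr fun e he =>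
        hcopy _ (block_index_lt hb (by omega))
  · have h1 := Nat.le_mul_of_pos_right dbl.bound hwg
    rw [add_mul, add_mul, mul_assoc c' 2, mul_assoc 2 w g]
    omega

/-- The number of blocks is rounded up to a power of two, so that every pass merges pairs of equal
length. Under `Blocks.rest` the padding has key, value and tag `0`: extra events at orientation `π /
2` with the trivial lower bound `0` for `z`. -/
theorem sizeProg_spec {s : State} {B : ℕ} (h6 : s.nat 6 0 = 3 * B) :
    Runs sizeProg s ((nlet 9 (.lit 3)).bound + (Nat.clog 2 B *
      ((Test.natLt (nvar 9) (nvar 6)).cost + (nlet 9 (nvar 9 +ₙ nvar 9)).bound + 1) +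
      ((Test.natLt (nvar 9) (nvar 6)).cost + 1)))
      fun s' => s'.nat 9 0 = 3 * 2 ^ Nat.clog 2 B ∧ sizeProg.Frame s s' := by
  have hf := Prog.frame_run (P := nlet 9 (.lit 3)) rfl s
  refine Runs.frame ((Runs.init_loop (P₀ := nlet 9 (.lit 3)) (P := nlet 9 (nvar 9 +ₙ nvar 9)) rfl
    (nlet 9 (nvar 9 +ₙ nvar 9)).bound (Nat.clog 2 B) (fun k s' => s'.nat 9 0 = 3 * 2 ^ k)
    (by simp [Prog.run, State.nat_setNat, NExp.eval])
    (fun k hk s₂ hf₂ hI => ⟨?_, Runs.of_loopFree rfl s₂ ?_⟩) (fun s₂ hf₂ hI => ?_)).mono le_rfl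
    fun s' h => h.1)
  · simp only [Test.Holds, NExp.eval, hI, hf₂.1 6 (by decide), hf.1 6 (by decide), h6]
    have := (Nat.lt_clog_iff_pow_lt Nat.one_lt_two).1 hk
    omega
  · simp [Prog.run, State.nat_setNat, NExp.eval, hI, pow_succ]
    ring
  · simp only [Test.Holds, NExp.eval, hI, hf₂.1 6 (by decide), hf.1 6 (by decide), h6]
    have := Nat.le_pow_clog Nat.one_lt_two B
    omega

/-- There are `r` passes over `3 * 2 ^ r` entries, starting from sorted blocks of three. The factor
`r + 1` covers `r = 0`, where the initialization and one test still cost something. -/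
theorem sortLoop_spec : ∃ c : ℕ, ∀ {s : State} {r : ℕ}, s.nat 9 0 = 3 * 2 ^ r →
    (∀ b < 2 ^ r, s.real 20 (3 * b) ≤ s.real 20 (3 * b + 1) ∧
      s.real 20 (3 * b + 1) ≤ s.real 20 (3 * b + 2)) →
    Runs sortLoop s (c * (2 ^ r * (r + 1))) fun s' =>
      Sorting (s.real 20) (s.real 21) (s.nat 20) (2 ^ r) (3 * 2 ^ r) 1 (s'.real 20) (s'.real 21)
        (s'.nat 20) ∧ sortLoop.Frame s s' := by
  obtain ⟨c, hc⟩ := sortPass_spec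
  refine ⟨(nlet 10 (.lit 3)).bound + 2 * ((Test.natLt (nvar 10) (nvar 9)).cost + (c * 3) + 1),
    fun {s r} h9 hs => Runs.frame ?_⟩
  have hf := Prog.frame_run (P := nlet 10 (.lit 3)) rfl s
  refine (Runs.init_loop (P₀ := nlet 10 (.lit 3)) rfl (c * 3 * 2 ^ r) r
    (fun k s' => s'.nat 10 0 = 3 * 2 ^ k ∧ Sorting (s.real 20) (s.real 21) (s.nat 20) (2 ^ r)
      (3 * 2 ^ k) (2 ^ (r - k)) (s'.real 20) (s'.real 21) (s'.nat 20)) ⟨?_, ?_⟩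
    (fun k hk s₂ hf₂ hI => ⟨?_, ?_⟩) (fun s₂ hf₂ hI => ?_)).mono ?_ fun s' h => ?_
  · simp [Prog.run, State.nat_setNat, NExp.eval]
  · rw [hf.2 20 (by decide), hf.2 21 (by decide), hf.1 20 (by decide), pow_zero, mul_one,
      Nat.sub_zero]
    refine ⟨rfl, fun b hb e f hef hf => ?_, fun x t => Iff.rfl, fun e he => ⟨e, he, rfl, rfl⟩,
      fun e he => ⟨e, he, rfl, rfl⟩⟩
    obtain ⟨h1, h2⟩ := hs b hb
    interval_cases f <;> interval_cases e <;>
      first | exact le_rfl | exact h1 | exact h2 | exact h1.trans h2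
  · simp only [Test.Holds, NExp.eval, hI.1, hf₂.1 9 (by decide), hf.1 9 (by decide), h9]
    exact Nat.mul_lt_mul_of_pos_left (Nat.pow_lt_pow_right Nat.one_lt_two hk) (by omega)
  · have e2 : 2 ^ (r - k) = 2 * 2 ^ (r - (k + 1)) := by
      rw [← pow_succ']; congr 1; omega
    have e3 : 2 ^ k * 2 ^ (r - (k + 1)) * 2 = 2 ^ r := by
      rw [← pow_add, ← pow_succ]; congr 1; omega
    have hS := hI.2
    rw [e2] at hS
    refine (hc (by positivity) (by positivity) hI.1 ?_ hS).mono ?_ fun s' h => ?_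
    · rw [hf₂.1 9 (by decide), hf.1 9 (by decide), h9, ← e3]; ring
    · rw [mul_assoc 3, mul_assoc c, ← e3]
      refine Nat.mul_le_mul_left c (Nat.mul_le_mul_left 3 ?_)
      omega
    · rw [pow_succ', show 3 * (2 * 2 ^ k) = 2 * (3 * 2 ^ k) by ring]; exact h
  · simp only [Test.Holds, NExp.eval, hI.1, hf₂.1 9 (by decide), hf.1 9 (by decide), h9]
    exact lt_irrefl _
  · rcases Nat.eq_zero_or_pos r with rfl | hr
    · simp only [zero_mul, pow_zero]; omega
    · refine (loop_cost_le_mul (w := 2 ^ r) (by positivity) hr).trans ?_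
      exact Nat.mul_le_mul_left _ (Nat.mul_le_mul_left _ (Nat.le_succ r))
  · have := h.1.2
    rwa [Nat.sub_self, pow_zero] at this

end Highway

namespace Highway

open RealRAM

/-! ### The sorted list of events -/

variable {n : ℕ} {v : ℝ} {p : Fin n → Plane}

theorem envelope_nonneg [NeZero n] (hv : 1 < v) (p : Fin n → Plane) (φ : ℝ) :
    0 ≤ envelope v p φ :=
  (le_max_of_le_left (abs_nonneg _)).trans ((envelope_le_iff hv p φ _).1 le_rfl 0 0).1

theorem pairDist_comm (hv : 1 < v) (a b : Plane) (φ : ℝ) :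
    pairDist v a b φ = pairDist v b a φ := by
  rw [pairDist_eq hv, pairDist_eq hv, norm_sub_rev b a, ← neg_sub a b, ip_neg, abs_neg]

/-- `stepVal` searches from the end, so among equal keys the last entry determines the value. -/
theorem stepVal_eq_of_sorted {K V : ℕ → ℝ} {M k : ℕ} {x : ℝ}
    (hs : ∀ i j, i ≤ j → j < M → K i ≤ K j) (hx : K k ≤ x) (hnext : k + 1 < M → x < K (k + 1)) :
    ∀ l, k < l → l ≤ M → stepVal K V 0 l x = V k := by
  intro l hl
  induction l with
  | zero => exact absurd hl (Nat.not_lt_zero k)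
  | succ l ih =>
    intro hM
    rw [stepVal, zero_add]
    rcases Nat.lt_succ_iff_lt_or_eq.1 hl with hlt | rfl
    · have h1 := (hnext (by omega)).trans_le (hs (k + 1) l hlt hM)
      rw [if_neg (not_le.2 h1), ih hlt (by omega)]
    · rw [if_pos hx]

theorem Sorting.isEventList {z : ℝ → ℝ} {m B N : ℕ} {κ c K₀ V₀ K V : ℕ → ℝ} {T₀ T : ℕ → ℕ}
    (h : Sorting K₀ V₀ T₀ N (3 * N) 1 K V T) (hB : Blocks z m κ c B K₀ V₀ T₀) (hN : B ≤ N) :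
    IsEventList (3 * N) K V T m κ c (stepVal K V 0 (3 * N)) := by
  have hs : ∀ i j, i ≤ j → j < 3 * N → K i ≤ K j := fun i j hij hj => by
    simpa using h.sorted 0 zero_lt_one i j hij hj
  have hsrc := h.source
  have htgt := h.target
  rw [mul_one] at hsrc htgt
  refine ⟨hs, fun k hk => ?_, fun k hk x hx hnext => ?_, fun t ht => ?_, fun t ht => ?_,
    fun k hk hne => ?_⟩
  · obtain ⟨f, -, h1, -⟩ := hsrc k hk
    rw [h1]; exact hB.mem f
  · exact (stepVal_eq_of_sorted hs hx hnext _ hk le_rfl).symm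
  · obtain ⟨⟨f, hf, h1, h2⟩, -⟩ := hB.slots t ht
    obtain ⟨e, he, h3, h4⟩ := htgt f (by omega)
    exact ⟨e, he, h3.trans h1, h4.trans h2⟩
  · obtain ⟨-, f, hf, h1⟩ := hB.slots t ht
    obtain ⟨e, he, h3, -⟩ := htgt f (by omega)
    exact ⟨e, he, h3.trans h1⟩
  · obtain ⟨f, -, h1, h2⟩ := hsrc k hk
    rw [h2] at hne ⊢
    rw [h1]
    exact hB.tags f hne

/-- The merged step function dominates every `f_{pq}` and, by `Blocks.low`, stays below `z`; so
together with `u` it gives `z` exactly. Pairs are stored for `j < i` only, which suffices by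
symmetry and since `f_{pp} = 0 ≤ u`. -/
theorem Sorting.envelope_eq [NeZero n] (hv : 1 < v) {m B N : ℕ} {κ c K₀ V₀ K V : ℕ → ℝ}
    {T₀ T : ℕ → ℕ} (h : Sorting K₀ V₀ T₀ N (3 * N) 1 K V T)
    (hB : Blocks (envelope v p) m κ c B K₀ V₀ T₀) (hN : B ≤ N)
    (hcov : ∀ i j : Fin n, j < i → ∃ b < B, ∀ φ ∈ Ico 0 Real.pi,
      pairDist v (p i) (p j) φ ≤ stepVal K₀ V₀ (3 * b) 3 (-Real.cos φ))
    {φ : ℝ} (hφ : φ ∈ Ico 0 Real.pi) :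
    envelope v p φ = max (rhombusWidth v p φ) (stepVal K V 0 (3 * N) (-Real.cos φ)) := by
  have hG : ∀ t, stepVal K V 0 (3 * N) (-Real.cos φ) ≤ t ↔
      ∀ b < N, stepVal K₀ V₀ (3 * b) 3 (-Real.cos φ) ≤ t := fun t => by
    rw [← h.val]
    refine ⟨fun h' b hb => ?_, fun h' => by simpa using h' 0 zero_lt_one⟩
    obtain rfl : b = 0 := by omega
    simpa using h'
  apply le_antisymm
  · have hlt : ∀ i j, j < i → pairDist v (p i) (p j) φ ≤
        stepVal K V 0 (3 * N) (-Real.cos φ) := fun i j hji => by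
      obtain ⟨b, hb, h1⟩ := hcov i j hji
      exact (h1 φ hφ).trans ((hG _).1 le_rfl b (by omega))
    refine max_le (le_max_left _ _) (ciSup_le fun ij => ?_)
    rcases lt_trichotomy ij.1 ij.2 with h1 | h1 | h1
    · rw [pairDist_comm hv]; exact le_max_of_le_right (hlt _ _ h1)
    · refine le_max_of_le_left ?_
      rw [h1, pairDist, dist_self, ite_self, rhombusWidth_eq hv]
      exact le_max_of_le_left ((abs_nonneg _).trans (abs_ip_le_spread p _ 0 0))
    · exact le_max_of_le_right (hlt _ _ h1)
  · exact max_le (le_max_left _ _) ((hG _).2 fun b _ => hB.low b φ hφ)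

/-! ### The scan -/

/-- Compute the step function and the widths of the current slot at the event with index `3`. -/
def widthsProg : Prog :=
  rlet 12 (.lit 0 -ᵣ .get 20 (nvar 3)) ;;
  rlet 13 (.sqrt (.lit 1 -ᵣ .get 20 (nvar 3) *ᵣ .get 20 (nvar 3))) ;;
  rlet 14 ((rvar 4 *ᵣ rvar 12 +ᵣ rvar 5 *ᵣ rvar 13) *ᵣ .get 24 (nvar 13) +ᵣ
    (rvar 4 *ᵣ rvar 13 -ᵣ rvar 5 *ᵣ rvar 12) *ᵣ .get 25 (nvar 13)) ;;
  rlet 15 ((rvar 4 *ᵣ rvar 12 -ᵣ rvar 5 *ᵣ rvar 13) *ᵣ .get 26 (nvar 13) +ᵣ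
    (rvar 4 *ᵣ rvar 13 +ᵣ rvar 5 *ᵣ rvar 12) *ᵣ .get 27 (nvar 13)) ;;
  rlet 16 (.get 21 (nvar 3))

/-- Set the variable `16` to the maximum of the variables `14`, `15` and `16`. -/
def maxProg : Prog :=
  .branch (.realLt (rvar 14) (rvar 15)) (rlet 14 (rvar 15)) .nop ;;
  .branch (.realLt (rvar 16) (rvar 14)) (rlet 16 (rvar 14)) .nop

/-- Evaluate `z` at the event with index `3`. -/
def evalProg : Prog := widthsProg ;; maxProg

/-- Update the best value and its key. -/
def updateProg : Prog :=
  .branch (orTest (.realLt (rvar 18) (.lit 0)) (.realLt (rvar 16) (rvar 18)))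
    (rlet 18 (rvar 16) ;; rlet 19 (.get 20 (nvar 3))) .nop

/-- Whether the event with index `3` is the last one with its key. -/
def lastTest : Test :=
  orTest (.not (.natLt (nvar 3 +ₙ .lit 1) (nvar 9)))
    (.realLt (.get 20 (nvar 3)) (.get 20 (nvar 3 +ₙ .lit 1)))

/-- Set the current slot. -/
def slotUpdate : Prog :=
  .branch (.natEq (.get 20 (nvar 3)) (.lit 0)) .nop (nlet 13 (.get 20 (nvar 3)))

/-- The body of the loop of `scanProg`. -/
def scanBody : Prog :=
  slotUpdate ;; .branch lastTest (evalProg ;; updateProg) .nop ;; incr 3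

/-- The initialization of `scanProg`. -/
def scanInit : Prog := nlet 3 (.lit 0) ;; nlet 13 (.lit 0) ;; rlet 18 (.lit (-1))

/-- Find the key `19` of a lowest point of `z`. -/
def scanProg : Prog := scanInit ;; .loop (.natLt (nvar 3) (nvar 9)) scanBody

theorem maxProg_run (s : State) : (maxProg.run s).real 16 0 =
    max (s.real 16 0) (max (s.real 14 0) (s.real 15 0)) := by
  rcases lt_or_ge (s.real 14 0) (s.real 15 0) with h | h
  · rw [max_eq_right h.le]
    rcases lt_or_ge (s.real 16 0) (s.real 15 0) with h' | h'
    · simp [maxProg, Prog.run, Test.Holds, RExp.eval, NExp.eval, State.real_setReal, h, h', h'.le]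
    · simp [maxProg, Prog.run, Test.Holds, RExp.eval, NExp.eval, State.real_setReal, h,
        not_lt.2 h', h']
  · rw [max_eq_left h]
    rcases lt_or_ge (s.real 16 0) (s.real 14 0) with h' | h'
    · simp [maxProg, Prog.run, Test.Holds, RExp.eval, NExp.eval, State.real_setReal, not_lt.2 h,
        h', h'.le]
    · simp [maxProg, Prog.run, Test.Holds, RExp.eval, NExp.eval, not_lt.2 h, not_lt.2 h', h']

theorem evalProg_run {s : State} {k t : ℕ} (h3 : s.nat 3 0 = k) (h13 : s.nat 13 0 = t)
    (h4 : s.real 4 0 = Real.cos (criticalAngle v)) (h5 : s.real 5 0 = Real.sin (criticalAngle v))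
    (hmem : s.real 20 k ∈ Ico (-1 : ℝ) 1) :
    (evalProg.run s).real 16 0 = slotVal v (vecs s 24 25) (vecs s 26 27) t (s.real 21 k)
      (keyAngle (s.real 20 k)) := by
  change (maxProg.run (widthsProg.run s)).real 16 0 = _
  rw [maxProg_run, slotVal]
  simp only [ip, vecs, Real.cos_sub, Real.sin_sub, Real.cos_add, Real.sin_add, cos_keyAngle hmem,
    sin_keyAngle]
  simp [widthsProg, Prog.run, RExp.eval, NExp.eval, State.real_setReal, State.nat_setReal, h3, h13,
    h4, h5]
  congr 2 <;> ring

theorem holds_lastTest {s : State} {k M : ℕ} (h3 : s.nat 3 0 = k) (h9 : s.nat 9 0 = M) :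
    lastTest.Holds s ↔ (k + 1 < M → s.real 20 k < s.real 20 (k + 1)) := by
  rw [lastTest, holds_orTest]
  simp only [Test.Holds, NExp.eval, RExp.eval, h3, h9]
  tauto

theorem slotUpdate_run {s : State} {k : ℕ} (h3 : s.nat 3 0 = k) :
    (slotUpdate.run s).nat 13 0 = if s.nat 20 k = 0 then s.nat 13 0 else s.nat 20 k := by
  simp only [slotUpdate, Prog.run, Test.Holds, NExp.eval, h3]
  split_ifs <;> simp [State.nat_setNat]

theorem updateProg_run {s : State} {k : ℕ} (h3 : s.nat 3 0 = k) :
    (updateProg.run s).real 18 0 =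
      (if s.real 18 0 < 0 ∨ s.real 16 0 < s.real 18 0 then s.real 16 0 else s.real 18 0) ∧
    (updateProg.run s).real 19 0 =
      (if s.real 18 0 < 0 ∨ s.real 16 0 < s.real 18 0 then s.real 20 k else s.real 19 0) := by
  have hT : (orTest (.realLt (rvar 18) (.lit 0)) (.realLt (rvar 16) (rvar 18))).Holds s ↔
      s.real 18 0 < 0 ∨ s.real 16 0 < s.real 18 0 := by
    rw [holds_orTest]; simp only [Test.Holds, RExp.eval, NExp.eval, Rat.cast_zero]
  simp only [updateProg, Prog.run, hT]
  split_ifs <;> simp [State.real_setReal, State.nat_setReal, RExp.eval, NExp.eval, h3]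

/-- The state of the scan after the inspection of `k` events: the current slot is the one with the
largest key so far, and the best value of `z` so far is known. -/
def ScanInv (z : ℝ → ℝ) (M m : ℕ) (κ : ℕ → ℝ) (k : ℕ) (s : State) : Prop :=
  s.nat 3 0 = k ∧ s.nat 13 0 < m ∧ (∀ e, k ≤ e → e < M → κ (s.nat 13 0) ≤ s.real 20 e) ∧
  (∀ e < k, s.nat 20 e ≠ 0 → s.real 20 e ≤ κ (s.nat 13 0)) ∧
  (∀ e < k, (e + 1 < M → s.real 20 e < s.real 20 (e + 1)) →
    0 ≤ s.real 18 0 ∧ s.real 18 0 ≤ z (keyAngle (s.real 20 e))) ∧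
  (0 ≤ s.real 18 0 → ∃ e < k, s.real 19 0 = s.real 20 e ∧ s.real 18 0 = z (keyAngle (s.real 20 e)))

/-- Before the last event of a group of equal keys the stored value may differ from the merged step
function, so `z` is evaluated only at the last one. The current slot is always the last one tagged
so far, which has the largest key. -/
theorem scanBody_spec [NeZero n] (hv : 1 < v) (hp : Function.Injective p) {s : State} {M m k : ℕ}
    {κ c : ℕ → ℝ} {G : ℝ → ℝ} (hE : Env v p s) (h9 : s.nat 9 0 = M) (hk : k < M)
    (hS : IsSlotTable v p m κ c (vecs s 24 25) (vecs s 26 27))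
    (hL : IsEventList M (s.real 20) (s.real 21) (s.nat 20) m κ c G)
    (hG : ∀ φ ∈ Ico 0 Real.pi, envelope v p φ = max (rhombusWidth v p φ) (G (-Real.cos φ)))
    (hI : ScanInv (envelope v p) M m κ k s) :
    ScanInv (envelope v p) M m κ (k + 1) (scanBody.run s) := by
  obtain ⟨h3, hm, hle, hge, hbest, hex⟩ := hI
  set t := if s.nat 20 k = 0 then s.nat 13 0 else s.nat 20 k with ht
  have hf0 := Prog.frame_run (P := slotUpdate) rfl s
  have e13 := slotUpdate_run h3
  rw [← ht] at e13
  set s₁ := slotUpdate.run s with hs1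
  have eR : s₁.real = s.real :=
    funext fun A => hf0.2 A (by simp [slotUpdate, Prog.realWrites])
  have htm : t < m := by
    rw [ht]; split_ifs with h
    · exact hm
    · exact (hL.tags k hk h).1
  have htk : κ t ≤ s.real 20 k := by
    rw [ht]; split_ifs with h
    · exact hle k le_rfl hk
    · exact (hL.tags k hk h).2.ge
  have hge' : ∀ e < k + 1, s.nat 20 e ≠ 0 → s.real 20 e ≤ κ t := by
    intro e he hne
    rw [ht]; split_ifs with h
    · have : e ≠ k := fun h' => hne (h' ▸ h)
      exact hge e (by omega) hne
    · rw [← (hL.tags k hk h).2]; exact hL.sorted e k (by omega) hk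
  have hno : ∀ t' < m, κ t' ≤ κ t ∨ s.real 20 k ≤ κ t' := by
    -- The tag `0` means both "no tag" and "slot `0`". This is harmless because slot `0` has the
    -- smallest key `-1` and is the initial current slot.
    intro t' ht'
    rcases Nat.eq_zero_or_pos t' with rfl | hpos
    · rw [hS.key_zero]; exact Or.inl (hS.key_mem t htm).1
    · obtain ⟨e, he, h1, h2⟩ := hL.slots t' ht'
      rcases lt_or_ge e (k + 1) with hek | hek
      · left; rw [← h1]; exact hge' e hek (by omega)
      · right; rw [← h1]; exact hL.sorted k e (by omega) he
  -- Whether or not `z` is evaluated, only the statements about the best value differ; the rest of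
  -- the invariant is proved once.
  suffices hfin : ∀ s₂ : State, s₂.nat 3 0 = k → s₂.nat 13 0 = t → s₂.nat 20 = s.nat 20 →
      s₂.real 20 = s.real 20 →
      (∀ e < k + 1, (e + 1 < M → s.real 20 e < s.real 20 (e + 1)) →
        0 ≤ s₂.real 18 0 ∧ s₂.real 18 0 ≤ envelope v p (keyAngle (s.real 20 e))) →
      (0 ≤ s₂.real 18 0 → ∃ e < k + 1, s₂.real 19 0 = s.real 20 e ∧
        s₂.real 18 0 = envelope v p (keyAngle (s.real 20 e))) →
      ScanInv (envelope v p) M m κ (k + 1) ((incr 3).run s₂) by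
    change ScanInv _ _ _ _ _ ((incr 3).run
      ((Prog.branch lastTest (evalProg ;; updateProg) .nop).run s₁))
    have i3 : s₁.nat 3 0 = k := (congrFun (hf0.1 3 (by decide)) 0).trans h3
    have i9 : s₁.nat 9 0 = M := (congrFun (hf0.1 9 (by decide)) 0).trans h9
    have iT : s₁.nat 20 = s.nat 20 := hf0.1 20 (by decide)
    have hT := holds_lastTest i3 i9
    rw [eR] at hT
    by_cases hlast : k + 1 < M → s.real 20 k < s.real 20 (k + 1)
    · have hrun : (Prog.branch lastTest (evalProg ;; updateProg) .nop).run s₁ =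
          updateProg.run (evalProg.run s₁) := if_pos (hT.2 hlast)
      rw [hrun]
      have hf1 := Prog.frame_run (P := evalProg) rfl s₁
      have hf2 := Prog.frame_run (P := updateProg) rfl (evalProg.run s₁)
      have hev := evalProg_run (v := v) i3 e13 (by rw [eR]; exact hE.cosα)
        (by rw [eR]; exact hE.sinα) (by rw [eR]; exact hL.mem k hk)
      have ev : ∀ A A', vecs s₁ A A' = vecs s A A' := fun A A' => by
        ext1 x; rw [vecs, vecs, eR]
      rw [ev, ev, eR, hL.slotVal_eq hv hp hS hG hk hlast htm htk hno] at hev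
      obtain ⟨u18, u19⟩ := updateProg_run (s := evalProg.run s₁) (k := k)
        ((congrFun (hf1.1 3 (by decide)) 0).trans i3)
      rw [hev, hf1.2 18 (by decide), eR] at u18 u19
      rw [hf1.2 19 (by decide), hf1.2 20 (by decide), eR] at u19
      have hz := envelope_nonneg hv p (keyAngle (s.real 20 k))
      refine hfin _ ?_ ?_ ?_ ?_ (fun e he hl => ?_) fun h => ?_
      · rw [hf2.1 3 (by decide), hf1.1 3 (by decide), i3]
      · rw [hf2.1 13 (by decide), hf1.1 13 (by decide), e13]
      · rw [hf2.1 20 (by decide), hf1.1 20 (by decide), iT]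
      · rw [hf2.2 20 (by decide), hf1.2 20 (by decide), eR]
      · rw [u18]
        rcases Nat.lt_succ_iff_lt_or_eq.1 he with he | rfl
        · obtain ⟨b1, b2⟩ := hbest e he hl
          split_ifs with hc
          · rcases hc with hc | hc
            · exact absurd b1 (not_le.2 hc)
            · exact ⟨hz, hc.le.trans b2⟩
          · exact ⟨b1, b2⟩
        · split_ifs with hc
          · exact ⟨hz, le_rfl⟩
          · push Not at hc; exact hc
      · rw [u18] at h ⊢
        rw [u19]
        split_ifs at h ⊢ with hc
        · exact ⟨k, Nat.lt_succ_self k, rfl, rfl⟩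
        · obtain ⟨e, he, h1⟩ := hex h
          exact ⟨e, by omega, h1⟩
    · have hrun : (Prog.branch lastTest (evalProg ;; updateProg) .nop).run s₁ = s₁ :=
        if_neg (hT.not.2 hlast)
      rw [hrun]
      refine hfin s₁ i3 e13 iT (by rw [eR]) (fun e he hl => ?_) fun h => ?_
      · have : e ≠ k := fun h' => hlast (h' ▸ hl)
        rw [eR]; exact hbest e (by omega) hl
      · rw [eR] at h ⊢
        obtain ⟨e, he, h1⟩ := hex h
        exact ⟨e, by omega, h1⟩
  intro s₂ i3 i13 iT i20 hb he
  have hf := Prog.frame_run (P := incr 3) rfl s₂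
  rw [ScanInv, hf.1 13 (by decide), hf.1 20 (by decide), hf.2 20 (by decide), hf.2 18 (by decide),
    hf.2 19 (by decide), i13, iT, i20]
  refine ⟨?_, htm, fun e he heM => htk.trans (hL.sorted k e (by omega) heM), hge', hb, he⟩
  simp [Prog.run, State.nat_setNat, NExp.eval, i3]

theorem scanProg_spec : ∃ C : ℕ, ∀ {n : ℕ} [NeZero n] {v : ℝ} {p : Fin n → Plane} {s : State}
    {M m : ℕ} {κ c : ℕ → ℝ} {G : ℝ → ℝ}, 1 < v → Function.Injective p → Env v p s →
    s.nat 9 0 = M → 0 < M → IsSlotTable v p m κ c (vecs s 24 25) (vecs s 26 27) →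
    IsEventList M (s.real 20) (s.real 21) (s.nat 20) m κ c G →
    (∀ φ ∈ Ico 0 Real.pi, envelope v p φ = max (rhombusWidth v p φ) (G (-Real.cos φ))) →
    Runs scanProg s (C * M) fun s' => (∃ κ ∈ Ico (-1 : ℝ) 1, s'.real 19 0 = κ ∧
      IsMinOn (envelope v p) (Ico 0 Real.pi) (keyAngle κ)) ∧ scanProg.Frame s s' := by
  refine ⟨scanInit.bound + 2 * ((Test.natLt (nvar 3) (nvar 9)).cost + scanBody.bound + 1),
    fun {n _ v p s M m κ c G} hv hp hE h9 hM hS hL hG => Runs.frame ?_⟩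
  have hf := Prog.frame_run (P := scanInit) rfl s
  have hinit : ScanInv (envelope v p) M m κ 0 (scanInit.run s) := by
    have h13 : (scanInit.run s).nat 13 0 = 0 := by
      simp [scanInit, Prog.run, State.nat_setNat, State.nat_setReal, NExp.eval]
    -- As `z` is nonnegative, the value `-1` marks that nothing has been evaluated yet.
    have h18 : (scanInit.run s).real 18 0 = -1 := by
      simp [scanInit, Prog.run, State.real_setReal, NExp.eval, RExp.eval]
    rw [ScanInv, h13, h18, hf.2 20 (by decide), hS.key_zero]
    refine ⟨?_, hS.pos, fun e _ he => (hL.mem e he).1, fun e he => absurd he (Nat.not_lt_zero e),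
      fun e he => absurd he (Nat.not_lt_zero e), fun h => by norm_num at h⟩
    simp [scanInit, Prog.run, State.nat_setNat, State.nat_setReal, NExp.eval]
  have hframe : ∀ s₂, scanBody.Frame (scanInit.run s) s₂ → Env v p s₂ ∧ s₂.nat 9 0 = M ∧
      s₂.nat 20 = s.nat 20 ∧ s₂.real 20 = s.real 20 ∧ s₂.real 21 = s.real 21 ∧
      vecs s₂ 24 25 = vecs s 24 25 ∧ vecs s₂ 26 27 = vecs s 26 27 := fun s₂ hf₂ => by
    refine ⟨(hE.frame hf (by decide) (by decide)).frame hf₂ (by decide) (by decide), ?_, ?_, ?_,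
      ?_, ?_, ?_⟩
    · rw [hf₂.1 9 (by decide), hf.1 9 (by decide), h9]
    · rw [hf₂.1 20 (by decide), hf.1 20 (by decide)]
    · rw [hf₂.2 20 (by decide), hf.2 20 (by decide)]
    · rw [hf₂.2 21 (by decide), hf.2 21 (by decide)]
    · ext1 x
      rw [vecs, vecs, hf₂.2 24 (by decide), hf.2 24 (by decide), hf₂.2 25 (by decide),
        hf.2 25 (by decide)]
    · ext1 x
      rw [vecs, vecs, hf₂.2 26 (by decide), hf.2 26 (by decide), hf₂.2 27 (by decide),
        hf.2 27 (by decide)]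
  refine (Runs.init_loop (P₀ := scanInit) rfl scanBody.bound M (ScanInv (envelope v p) M m κ) hinit
    (fun k hk s₂ hf₂ hI => ?_) (fun s₂ hf₂ hI => ?_)).mono (loop_cost_le hM) ?_
  · obtain ⟨i1, i2, i3, i4, i5, i6, i7⟩ := hframe s₂ hf₂
    refine ⟨by simp only [Test.Holds, NExp.eval, i2, hI.1]; exact hk, Runs.of_loopFree rfl s₂ ?_⟩
    refine scanBody_spec (c := c) hv hp i1 i2 hk ?_ ?_ hG hI
    · rw [i6, i7]; exact hS
    · rw [i3, i4, i5]; exact hL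
  · simp only [Test.Holds, NExp.eval, (hframe s₂ hf₂).2.1, hI.1]; exact lt_irrefl _
  · rintro s₂ ⟨⟨-, -, -, -, hbest, hex⟩, hf₂⟩
    rw [(hframe s₂ hf₂).2.2.2.1] at hbest hex
    have hmin : ∀ φ ∈ Ico 0 Real.pi, 0 ≤ s₂.real 18 0 ∧ s₂.real 18 0 ≤ envelope v p φ := by
      intro φ hφ
      obtain ⟨k, hk, h1, h2⟩ := hL.exists_envelope_le hv hp hS hG hφ
      obtain ⟨h3, h4⟩ := hbest k hk h1
      exact ⟨h3, h4.trans h2⟩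
    obtain ⟨e, he, h1, h2⟩ := hex (hmin 0 ⟨le_rfl, Real.pi_pos⟩).1
    refine ⟨_, hL.mem e he, h1, isMinOn_iff.2 fun φ hφ => ?_⟩
    rw [← h2]
    exact (hmin φ hφ).2

end Highway

namespace Highway

open RealRAM

/-! ### The output -/

variable {n : ℕ} {v : ℝ} {p : Fin n → Plane}

theorem IsLexMax.isExtreme [NeZero n] {ψ : ℝ} {a b : Fin n} (ha : IsLexMax p ψ a)
    (hb : IsLexMax p (ψ + Real.pi) b) : IsExtreme p ψ a b := by
  refine fun i => ⟨?_, ?_⟩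
  · rcases hb i with h | ⟨h, -⟩ <;> rw [ip_add_pi, ip_add_pi] at h <;> linarith
  · rcases ha i with h | ⟨h, -⟩ <;> linarith

/-- Set the direction to the one with key `19`, turned by `-α`. -/
def dirProg : Prog := rlet 11 (rvar 19) ;; leftDirProg

/-- Store the middle of the points in the current direction. -/
def midProg (A : ℕ) : Prog := rlet A ((along (nvar 7) +ᵣ along (nvar 8)) /ᵣ .lit 2)

/-- Write the output. -/
def outProg : Prog :=
  .setReal 3 (.lit 0) ((rvar 14 +ᵣ rvar 15) /ᵣ (.lit 2 *ᵣ rvar 4) *ᵣ rvar 12 -ᵣ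
    (rvar 15 -ᵣ rvar 14) /ᵣ (.lit 2 *ᵣ rvar 5) *ᵣ rvar 13) ;;
  .setReal 3 (.lit 1) ((rvar 14 +ᵣ rvar 15) /ᵣ (.lit 2 *ᵣ rvar 4) *ᵣ rvar 13 +ᵣ
    (rvar 15 -ᵣ rvar 14) /ᵣ (.lit 2 *ᵣ rvar 5) *ᵣ rvar 12) ;;
  .setReal 3 (.lit 2) (rvar 12) ;; .setReal 3 (.lit 3) (rvar 13)

/-- Compute the highway whose orientation has the key `19`. -/
def lineProg : Prog :=
  dirProg ;; widthProg ;; (midProg 14 ;; storeLeftProg) ;; widthProg ;; midProg 15 ;; outProg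

theorem midProg_run {s : State} (h : Env v p s) {ψ : ℝ} (hd : HasDir s ψ) {a b : Fin n}
    (h7 : s.nat 7 0 = a) (h8 : s.nat 8 0 = b) (A : ℕ) :
    ((midProg A).run s).real A 0 = ip ψ (p a + p b) / 2 := by
  have h1 := eval_along h hd (e := nvar 7) (i := a) h7
  have h2 := eval_along h hd (e := nvar 8) (i := b) h8
  have h3 : ((along (nvar 7) +ᵣ along (nvar 8)) /ᵣ .lit 2).eval s =
      ((along (nvar 7)).eval s + (along (nvar 8)).eval s) / ((2 : ℚ) : ℝ) := rfl
  simp only [midProg, Prog.run, State.real_setReal, NExp.eval]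
  rw [if_pos ⟨trivial, trivial⟩, h3, h1, h2]
  simp only [ip, PiLp.add_apply]
  push_cast
  ring

theorem outProg_run {s : State} {φ A B : ℝ} (h4 : s.real 4 0 = Real.cos (criticalAngle v))
    (h5 : s.real 5 0 = Real.sin (criticalAngle v)) (h12 : s.real 12 0 = Real.cos φ)
    (h13 : s.real 13 0 = Real.sin φ) (h14 : s.real 14 0 = A) (h15 : s.real 15 0 = B) :
    outputLine (outProg.run s) = lineThrough (obliquePoint v φ A B) (unitDir φ) := by
  rw [outputLine]
  congr 1
  · ext i
    fin_cases i
    · simp [outProg, Prog.run, State.real_setReal, RExp.eval, NExp.eval, h4, h5, h12, h13, h14, h15,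
        obliquePoint, unitDir, Real.cos_add_pi_div_two]
      ring
    · simp [outProg, Prog.run, State.real_setReal, RExp.eval, NExp.eval, h4, h5, h12, h13, h14, h15,
        obliquePoint, unitDir, Real.sin_add_pi_div_two]
  · ext i
    fin_cases i <;>
      simp [outProg, Prog.run, State.real_setReal, RExp.eval, NExp.eval, h12, h13, unitDir]

/-- Recomputes the extreme pairs for the best orientation; the middles of the two strips are the
oblique coordinates of the center of a smallest rhombus. -/
theorem lineProg_spec : ∃ c : ℕ, ∀ {n : ℕ} [NeZero n] {v : ℝ} {p : Fin n → Plane} {s : State}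
    {κ : ℝ}, Env v p s → κ ∈ Ico (-1 : ℝ) 1 → s.real 19 0 = κ →
    Runs lineProg s (c * n) fun s' => ∃ a b a' b' : Fin n,
      IsExtreme p (keyAngle κ - criticalAngle v) a b ∧
      IsExtreme p (keyAngle κ + criticalAngle v) a' b' ∧
      outputLine s' = lineThrough (obliquePoint v (keyAngle κ)
        (ip (keyAngle κ - criticalAngle v) (p a + p b) / 2)
        (ip (keyAngle κ + criticalAngle v) (p a' + p b') / 2)) (unitDir (keyAngle κ)) := by
  obtain ⟨cw, hw⟩ := widthProg_spec
  refine ⟨dirProg.bound + (cw + ((midProg 14 ;; storeLeftProg).bound + (cw +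
    (midProg 15 ;; outProg).bound))), fun {n _ v p s κ} hE hκ h19 => ?_⟩
  have hn : 0 < n := NeZero.pos n
  suffices hR : Runs lineProg s (dirProg.bound + (cw * n + ((midProg 14 ;; storeLeftProg).bound +
      (cw * n + (midProg 15 ;; outProg).bound)))) fun s' => ∃ a b a' b' : Fin n,
      IsExtreme p (keyAngle κ - criticalAngle v) a b ∧
      IsExtreme p (keyAngle κ + criticalAngle v) a' b' ∧
      outputLine s' = lineThrough (obliquePoint v (keyAngle κ)
        (ip (keyAngle κ - criticalAngle v) (p a + p b) / 2)
        (ip (keyAngle κ + criticalAngle v) (p a' + p b') / 2)) (unitDir (keyAngle κ)) by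
    refine hR.mono ?_ fun s' h => h
    have h1 := Nat.le_mul_of_pos_right dirProg.bound hn
    have h2 := Nat.le_mul_of_pos_right (midProg 14 ;; storeLeftProg).bound hn
    have h3 := Nat.le_mul_of_pos_right (midProg 15 ;; outProg).bound hn
    simp only [add_mul]
    omega
  have hfa := Prog.frame_run (P := rlet 11 (rvar 19)) rfl s
  have hEa := hE.frame hfa (by decide) (by decide)
  obtain ⟨hd, h12, h13⟩ := leftDirProg_run hEa hκ
    (by simp [Prog.run, State.real_setReal, RExp.eval, NExp.eval, h19])
  have hf1 := Prog.frame_run (P := dirProg) rfl s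
  change HasDir (dirProg.run s) _ at hd
  change (dirProg.run s).real 12 0 = _ at h12
  change (dirProg.run s).real 13 0 = _ at h13
  set s₁ := dirProg.run s
  have hE1 : Env v p s₁ := hE.frame hf1 (by decide) (by decide)
  refine (Runs.of_loopFree rfl s (Q := fun s' => s' = s₁) rfl).seq ?_
  rintro _ rfl
  refine (hw hn hE1 hd).seq ?_
  rintro s₂ ⟨⟨a, b, h7, h8, ha, hb⟩, hf2⟩
  have hE2 := hE1.frame hf2 (by decide) (by decide)
  have hd2 : HasDir s₂ (keyAngle κ - criticalAngle v) := by
    rw [HasDir, hf2.2 6 (by decide), hf2.2 7 (by decide)]; exact hd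
  have hm := midProg_run hE2 hd2 h7 h8 14
  have hf3 := Prog.frame_run (P := midProg 14) rfl s₂
  have hE3 := hE2.frame hf3 (by decide) (by decide)
  have hd3 := storeLeftProg_run hE3 (φ := keyAngle κ)
    (by rw [hf3.2 12 (by decide), hf2.2 12 (by decide), h12])
    (by rw [hf3.2 13 (by decide), hf2.2 13 (by decide), h13])
  have hf4 := Prog.frame_run (P := storeLeftProg) rfl ((midProg 14).run s₂)
  have hE4 := hE3.frame hf4 (by decide) (by decide)
  refine (Runs.of_loopFree rfl s₂ (Q := fun s' => s' = storeLeftProg.run ((midProg 14).run s₂))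
    rfl).seq ?_
  rintro _ rfl
  set s₄ := storeLeftProg.run ((midProg 14).run s₂)
  refine (hw hn hE4 hd3).seq ?_
  rintro s₅ ⟨⟨a', b', h7', h8', ha', hb'⟩, hf5⟩
  have hE5 := hE4.frame hf5 (by decide) (by decide)
  have hd5 : HasDir s₅ (keyAngle κ + criticalAngle v) := by
    rw [HasDir, hf5.2 6 (by decide), hf5.2 7 (by decide)]; exact hd3
  have hm' := midProg_run hE5 hd5 h7' h8' 15
  have hf6 := Prog.frame_run (P := midProg 15) rfl s₅
  have hE6 := hE5.frame hf6 (by decide) (by decide)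
  refine Runs.of_loopFree rfl s₅ ⟨a, b, a', b', ha.isExtreme hb, ha'.isExtreme hb', ?_⟩
  refine outProg_run (s := (midProg 15).run s₅) hE6.cosα hE6.sinα ?_ ?_ ?_ hm'
  · rw [hf6.2 12 (by decide), hf5.2 12 (by decide), hf4.2 12 (by decide), hf3.2 12 (by decide),
      hf2.2 12 (by decide), h12]
  · rw [hf6.2 13 (by decide), hf5.2 13 (by decide), hf4.2 13 (by decide), hf3.2 13 (by decide),
      hf2.2 13 (by decide), h13]
  · rw [hf6.2 14 (by decide), hf5.2 14 (by decide), hf4.2 14 (by decide), hm]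

/-! ### The program -/

/-- Compute the cosine and the sine of the critical angle and set the key of the first slot. -/
def setupProg : Prog :=
  rlet 4 (.lit 1 /ᵣ rvar 0) ;; rlet 5 (.sqrt (.lit 1 -ᵣ rvar 4 *ᵣ rvar 4)) ;; rlet 11 (.lit (-1))

/-- Compute an optimal highway. -/
def highwayProg : Prog :=
  setupProg ;; slotProg ;; slotsProg ;; pairsProg ;; sizeProg ;; sortLoop ;; scanProg ;; lineProg

theorem setupProg_run [NeZero n] (hv : 1 < v) (p : Fin n → Plane) :
    SlotState v p 0 0 (setupProg.run (inputState v p)) ∧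
      (setupProg.run (inputState v p)).real 11 0 = -1 := by
  have hf := Prog.frame_run (P := setupProg) rfl (inputState v p)
  have hnat : ∀ A, A ≠ 0 → ∀ i, (setupProg.run (inputState v p)).nat A i = 0 := fun A hA i => by
    rw [hf.1 A (by simp [setupProg, Prog.natWrites])]
    exact if_neg fun h => hA h.1
  have hreal : ∀ A, 2 < A → A ∉ setupProg.realWrites → ∀ i,
      (setupProg.run (inputState v p)).real A i = 0 := fun A hA hA' i => by
    rw [hf.2 A hA']
    simp only [inputState]
    rw [if_neg (by omega)]
    split_ifs <;> first | omega | rfl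
  have hK := hreal 20 (by omega) (by decide)
  have hV := hreal 21 (by omega) (by decide)
  have hT := hnat 20 (by omega)
  refine ⟨⟨⟨?_, fun i => ?_, fun i => ?_, ?_, ?_⟩, hnat 5 (by omega) 0, hnat 6 (by omega) 0, ?_,
    ?_⟩, ?_⟩
  · rw [hf.1 0 (by decide)]; simp [inputState]
  · rw [hf.2 1 (by decide)]; simp [inputState]
  · rw [hf.2 2 (by decide)]; simp [inputState]
  · rw [cos_criticalAngle hv]
    simp [setupProg, Prog.run, State.real_setReal, RExp.eval, NExp.eval, inputState]
  · rw [sin_criticalAngle]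
    simp [setupProg, Prog.run, State.real_setReal, RExp.eval, NExp.eval, inputState]
    congr 2
    ring
  · constructor <;> exact fun t ht => absurd ht (Nat.not_lt_zero t)
  · refine ⟨fun j _ => ⟨hK j, hV j, hT j⟩, fun j => ?_, fun b => ?_, fun j hj => absurd (hT j) hj,
      fun t ht => absurd ht (Nat.not_lt_zero t), fun b φ _ => ?_⟩
    · rw [hK]; norm_num
    · simp only [hK, le_refl, and_self]
    · rw [stepVal_eq_zero fun i _ => hV _]
      exact envelope_nonneg hv p φ
  · simp [setupProg, Prog.run, State.real_setReal, RExp.eval, NExp.eval]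

/-- There are `1 + 2 n` slots and at most `n²` pair blocks, and `(n + 1)² ≤ 2 n²` for `n ≥ 3`. -/
theorem clog_le_of_le {n B : ℕ} (hn : 3 ≤ n) (hB : B ≤ 1 + 2 * n + n * n) :
    Nat.clog 2 B ≤ Nat.clog 2 (2 * n ^ 2) :=
  Nat.clog_mono_right 2 (by nlinarith)

theorem two_pow_clog_le {n : ℕ} (hn : 3 ≤ n) : 2 ^ Nat.clog 2 (2 * n ^ 2) ≤ 4 * n ^ 2 := by
  have h1 : 1 < 2 * n ^ 2 := by nlinarith
  have h2 := Nat.pow_pred_clog_lt_self Nat.one_lt_two h1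
  have h3 := Nat.clog_pos Nat.one_lt_two h1
  obtain ⟨k, hk⟩ : ∃ k, Nat.clog 2 (2 * n ^ 2) = k + 1 := ⟨_, (Nat.succ_pred_eq_of_pos h3).symm⟩
  rw [hk] at h2 ⊢
  rw [Nat.pred_succ] at h2
  rw [pow_succ]
  omega

/-- `log n ≥ 1` because `e < 3 ≤ n`. From `2 ^ R ≤ 4 n²` follows `(R - 2) log 2 ≤ 2 log n`, so `R +
1 ≤ 3 + 3 log n`, and `7` leaves room. -/
theorem clog_add_one_le {n : ℕ} (hn : 3 ≤ n) :
    (Nat.clog 2 (2 * n ^ 2) : ℝ) + 1 ≤ 7 * Real.log n := by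
  have hn' : (3 : ℝ) ≤ n := by exact_mod_cast hn
  have h1 : (1 : ℝ) ≤ Real.log n := by
    rw [Real.le_log_iff_exp_le (by linarith)]
    linarith [Real.exp_one_lt_d9]
  have h2 : ((2 : ℝ) ^ Nat.clog 2 (2 * n ^ 2)) ≤ 4 * (n : ℝ) ^ 2 := by
    exact_mod_cast two_pow_clog_le hn
  have h3 := Real.log_le_log (by positivity) h2
  rw [Real.log_pow, Real.log_mul (by norm_num) (by positivity), Real.log_pow,
    show (4 : ℝ) = 2 ^ 2 by norm_num, Real.log_pow] at h3
  have h4 := Real.log_two_gt_d9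
  have h5 : (Nat.clog 2 (2 * n ^ 2) - 2 : ℝ) * Real.log 2 ≤ 2 * Real.log n := by
    push_cast at h3; linarith
  nlinarith

/-- The output is an optimal highway, and its orientation is a lowest point of `z`. -/
def IsSolution (v : ℝ) (p : Fin n → Plane) (s : State) : Prop :=
  IsOptimalHighway v p (outputLine s) ∧ ∃ φ ∈ Ico 0 Real.pi, HasOrientation (outputLine s) φ ∧
    IsMinOn (envelope v p) (Ico 0 Real.pi) φ

theorem Runs.seq_le {P P' : Prog} {s : State} {c c' d : ℕ} {Q Q' : State → Prop}
    (h : Runs P s c Q) (hd : c + c' ≤ d) (h' : ∀ s', Q s' → Runs P' s' c' Q') :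
    Runs (P ;; P') s d Q' :=
  (h.seq h').mono hd fun _ h => h

theorem highwayProg_spec : ∃ c : ℕ, ∀ {n : ℕ} {v : ℝ} {p : Fin n → Plane}, 1 < v → 3 ≤ n →
    Function.Injective p → Runs highwayProg (inputState v p)
      (c * (n ^ 2 * (Nat.clog 2 (2 * n ^ 2) + 1))) (IsSolution v p) := by
  obtain ⟨c₁, h₁⟩ := slotProg_spec
  obtain ⟨c₂, h₂⟩ := slotsProg_spec
  obtain ⟨c₃, h₃⟩ := pairsProg_spec
  obtain ⟨c₄, h₄⟩ := sortLoop_spec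
  obtain ⟨c₅, h₅⟩ := scanProg_spec
  obtain ⟨c₆, h₆⟩ := lineProg_spec
  set d := (nlet 9 (.lit 3)).bound
  set d' := (Test.natLt (nvar 9) (nvar 6)).cost + (nlet 9 (nvar 9 +ₙ nvar 9)).bound + 1
  set d'' := (Test.natLt (nvar 9) (nvar 6)).cost + 1
  -- The factors `4` and `12` come from `2 ^ r ≤ 4 n²` blocks in the sort and `3 * 2 ^ r ≤ 12 n²`
  -- events in the scan.
  refine ⟨setupProg.bound + (c₁ + (c₂ + (c₃ + ((d + d' + d'') + (c₄ * 4 + (c₅ * 12 + c₆)))))),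
    fun {n v p} hv hn hp => ?_⟩
  have : NeZero n := ⟨by omega⟩
  have hz := envelope_nonneg hv p
  set R := Nat.clog 2 (2 * n ^ 2) with hR
  set W := n ^ 2 * (R + 1) with hW
  have w2 : n ^ 2 ≤ W := Nat.le_mul_of_pos_right _ (Nat.succ_pos R)
  have w1 : n ≤ W := by nlinarith
  have w0 : 0 < W := by omega
  have wR : R ≤ W := by
    have := Nat.le_mul_of_pos_left (R + 1) (show 0 < n ^ 2 by positivity)
    omega
  rw [add_mul, add_mul, add_mul, add_mul, add_mul, add_mul (c₄ * 4), add_mul (c₅ * 12)]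
  obtain ⟨hS0, h11⟩ := setupProg_run hv p
  refine Runs.seq_le (Runs.of_loopFree rfl (inputState v p)
    (Q := fun s' => s' = setupProg.run (inputState v p)) rfl)
    (Nat.add_le_add_right (Nat.le_mul_of_pos_right _ w0) _) ?_
  rintro _ rfl
  refine Runs.seq_le (h₁ (by omega) hz hS0 (κ := -1) (by norm_num) h11)
    (Nat.add_le_add_right (Nat.mul_le_mul_left _ w1) _) ?_
  rintro s₁ ⟨hS1, h28, -, -⟩
  refine Runs.seq_le (h₂ (by omega) hp hz hS1 h28)
    (Nat.add_le_add_right (Nat.mul_le_mul_left _ w2) _) ?_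
  rintro s₂ ⟨hS2, hT2⟩
  refine Runs.seq_le (h₃ hv hp hS2)
    (Nat.add_le_add_right (Nat.mul_le_mul_left _ w2) _) ?_
  rintro s₃ ⟨⟨B, hB, hS3, hcov⟩, hf3⟩
  have hrR : Nat.clog 2 B ≤ R := clog_le_of_le hn hB
  have hBr := Nat.le_pow_clog Nat.one_lt_two B
  refine Runs.seq_le (sizeProg_spec hS3.base) (Nat.add_le_add_right ?_ _) ?_
  · have i1 := Nat.le_mul_of_pos_right d w0
    have i2 := Nat.le_mul_of_pos_right d'' w0
    have i3 : Nat.clog 2 B * d' ≤ d' * W := by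
      rw [mul_comm]; exact Nat.mul_le_mul_left _ (hrR.trans wR)
    change d + (Nat.clog 2 B * d' + d'') ≤ _
    rw [add_mul, add_mul]
    omega
  rintro s₄ ⟨h9, hf4⟩
  set r := Nat.clog 2 B
  have hrr : 2 ^ r ≤ 4 * n ^ 2 :=
    (Nat.pow_le_pow_right (by omega) hrR).trans (two_pow_clog_le hn)
  have hS4 := hS3.frame hf4 (by decide) (by decide)
  have hcov4 : ∀ i j : Fin n, j < i → ∃ b < B, ∀ φ ∈ Ico 0 Real.pi,
      pairDist v (p i) (p j) φ ≤ stepVal (s₄.real 20) (s₄.real 21) (3 * b) 3 (-Real.cos φ) := by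
    rw [hf4.2 20 (by decide), hf4.2 21 (by decide)]
    exact fun i j hji => hcov i j hji (Or.inl i.2)
  refine Runs.seq_le (h₄ h9 fun b _ => hS4.blocks.sorted b) (Nat.add_le_add_right ?_ _) ?_
  · rw [mul_assoc]
    refine Nat.mul_le_mul_left _ ?_
    calc 2 ^ r * (r + 1) ≤ 4 * n ^ 2 * (R + 1) := Nat.mul_le_mul hrr (by omega)
      _ = 4 * W := by rw [hW]; ring
  rintro s₅ ⟨hsort, hf5⟩
  have hE5 := hS4.env.frame hf5 (by decide) (by decide)
  have ev : ∀ A A', A ∉ pairsProg.realWrites → A' ∉ pairsProg.realWrites →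
      A ∉ sizeProg.realWrites → A' ∉ sizeProg.realWrites → A ∉ sortLoop.realWrites →
      A' ∉ sortLoop.realWrites → vecs s₅ A A' = vecs s₂ A A' := fun A A' i1 i2 i3 i4 i5 i6 => by
    ext1 t
    rw [vecs, vecs, hf5.2 A i5, hf5.2 A' i6, hf4.2 A i3, hf4.2 A' i4, hf3.2 A i1, hf3.2 A' i2]
  have hT5 : IsSlotTable v p (1 + 2 * n) (s₄.real 28) (s₄.real 29) (vecs s₅ 24 25)
      (vecs s₅ 26 27) := by
    rw [ev 24 25 (by decide) (by decide) (by decide) (by decide) (by decide) (by decide),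
      ev 26 27 (by decide) (by decide) (by decide) (by decide) (by decide) (by decide),
      hf4.2 28 (by decide), hf4.2 29 (by decide), hf3.2 28 (by decide), hf3.2 29 (by decide)]
    exact hT2
  refine Runs.seq_le (h₅ hv hp hE5 (by rw [hf5.1 9 (by decide), h9]) (by positivity) hT5
    (hsort.isEventList hS4.blocks hBr) fun φ hφ => hsort.envelope_eq hv hS4.blocks hBr hcov4 hφ)
    (Nat.add_le_add_right ?_ _) ?_
  · rw [mul_assoc]
    refine Nat.mul_le_mul_left _ ?_
    omega
  rintro s₆ ⟨⟨κ, hκ, h19, hmin⟩, hf6⟩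
  refine (h₆ (hE5.frame hf6 (by decide) (by decide)) hκ h19).mono (Nat.mul_le_mul_left _ w1) ?_
  rintro s₇ ⟨a, b, a', b', hab, hab', hout⟩
  rw [IsSolution, hout]
  have hw := (rhombusWidth_eq hv p (keyAngle κ)).ge
  exact ⟨isOptimalHighway_of_isMinOn hv p hmin (le_max_left _ _) fun i =>
    mem_rhombus_obliquePoint hv hab hab' ((le_max_left _ _).trans hw) ((le_max_right _ _).trans hw)
      i, keyAngle κ, keyAngle_mem hκ.2, hasOrientation_lineThrough _ _, hmin⟩

end Highway

/-! ### The theorem. -/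

theorem mainTheorem2 :
    -- for every orientation `φ`, the envelope value `z(φ)` is the optimal travel-time diameter
    (∀ (v : ℝ), 1 < v → ∀ (n : ℕ), 3 ≤ n →
      ∀ (p : Fin n → Highway.Plane), Function.Injective p → ∀ φ : ℝ,
        IsLeast {T : ℝ | ∃ h : AffineSubspace ℝ Highway.Plane, Highway.IsHighway h ∧
          Highway.HasOrientation h φ ∧ T = Highway.travelDiam v h p} (Highway.envelope v p φ)) ∧
    -- one real-RAM program finds an optimal highway, whose orientation is a lowest point of `z`,
    -- in `O(n² log n)` steps
    (∃ (P : RealRAM.Prog) (C : ℝ), ∀ (v : ℝ), 1 < v → ∀ (n : ℕ), 3 ≤ n →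
      ∀ (p : Fin n → Highway.Plane), Function.Injective p →
        ∃ (t : ℕ) (s : RealRAM.State),
          RealRAM.Exec P (Highway.inputState v p) t s ∧
          (t : ℝ) ≤ C * ((n : ℝ) ^ 2 * Real.log n) ∧
          Highway.IsOptimalHighway v p (Highway.outputLine s) ∧
          ∃ φ ∈ Set.Ico 0 Real.pi, Highway.HasOrientation (Highway.outputLine s) φ ∧
            IsMinOn (Highway.envelope v p) (Set.Ico 0 Real.pi) φ) := by
  refine ⟨fun v hv n hn p _ φ => ?_, ?_⟩
  · have : NeZero n := ⟨by omega⟩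
    exact Highway.isLeast_travelDiam hv p φ
  · obtain ⟨c, hc⟩ := Highway.highwayProg_spec
    refine ⟨Highway.highwayProg, c * 7, fun v hv n hn p hp => ?_⟩
    obtain ⟨t, s, hrun, ht, hs⟩ := hc hv hn hp
    refine ⟨t, s, hrun, ?_, hs⟩
    calc (t : ℝ) ≤ c * ((n : ℝ) ^ 2 * (Nat.clog 2 (2 * n ^ 2) + 1)) := by exact_mod_cast ht
      _ ≤ c * ((n : ℝ) ^ 2 * (7 * Real.log n)) := by
        have := Highway.clog_add_one_le hn
        gcongr
      _ = c * 7 * ((n : ℝ) ^ 2 * Real.log n) := by ring
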